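/- Let $k$ be a field. All algebras are finite-dimensional $k$-algebras, all modules are finitely generated left modules, and $k$ acts centrally on bimodules, which are finite-dimensional. Composites of morphisms are written from left to right, $fg$ meaning first $f$, then $g$. Put $D=\mathrm{Hom}_k(-,k)$; for an $A$-module $X$, $\mathrm{add}(X)$ is the class of direct summands of finite direct sums of copies of $X$. An algebra is representation-finite if it has only finitely many isomorphism classes of indecomposable modules. For an algebra $A$ let $\nu_A=D\,\mathrm{Hom}_A(-,A)$ be the Nakayama functor; a projective $A$-module $P$ is $\nu$-stably projective if $\nu_A^iP$ is projective for all $i>0$. If $e\in A$ is an idempotent such that $\mathrm{add}(Ae)$ is the class of all $\nu$-stably projective $A$-modules, then $eAe$ (unique up to Morita equivalence) is the Frobenius part of $A$; $A$ is *Frobenius-finite* if its Frobenius part is representation-finite. An $A$-module $M$ is a generator if $A\in\mathrm{add}(M)$, a generator-cogenerator if ${}_AA,{}_AD(A)\in\mathrm{add}(M)$, and torsionless if it is a submodule of a projective module. An Auslander algebra is an algebra of global dimension at most $2$ and dominant dimension at least $2$. A subset $\Theta\subseteq\mathbb N$ is admissible if $0\in\Theta$ and, for all $l,m,n\in\Theta$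 with $l+m+n\in\Theta$, one has $l+m\in\Theta$ if and only if $m+n\in\Theta$. For a finite admissible set $\Theta$ and an $A$-module $M$, the $\Theta$-Auslander–Yoneda algebra is $E_A^\Theta(M)=\bigoplus_{i\in\Theta}\mathrm{Ext}^i_A(M,M)$, where the product of elements of degrees $i$ and $j$ is their Yoneda product if $i+j\in\Theta$ and $0$ otherwise. **Proposition.** (1) If $M$ is a generator-cogenerator over a Frobenius-finite algebra $A$, then $\mathrm{End}_A(M)$ is Frobenius-finite. In particular, Auslander algebras are Frobenius-finite. (2) Let $M$ be a torsionless generator over a Frobenius-finite algebra $A$, and let $\Theta$ be a finite admissible subset of $\mathbb N$ such that $\mathrm{Ext}^i_A(M,A)=0$ for all $0\neq i\in\Theta$. Then $E_A^\Theta(M)$ is Frobenius-finite. In particular, if $A$ is a representation-finite self-injective algebra, then $E_A^\Theta(A\oplus X)$ is Frobenius-finite for every $A$-module $X$ and every finite admissible subset $\Theta$ of $\mathbb N$. (3) If $A$ and $B$ are Frobenius-finite algebras and $M$ is a $B$-$A$-bimodule, then the triangular matrix algebra $\begin{bmatrix}A&0\\M&B\end{bmatrix}$ is Frobenius-finite.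 More generally, let $A_1,\dots,A_m$ be Frobenius-finite algebras, let $M_{ij}$ be an $A_i$-$A_j$-bimodule for all $1\le j<i\le m$, and let bimodule homomorphisms $M_{ij}\otimes_{A_j}M_{jl}\to M_{il}$ ($l<j<i$) be given that satisfy the evident associativity condition. Then the resulting algebra of lower triangular matrices with diagonal entries in $A_1,\dots,A_m$ and $(i,j)$-entry in $M_{ij}$ for $j<i$ is Frobenius-finite. (4) If $A=A_0\oplus A_1\oplus\cdots\oplus A_n$ is an $\mathbb N$-graded algebra with $A_0$ Frobenius-finite, then for all $1\le m\le n$ the Beilinson–Green algebra $\Lambda_m$, that is, the algebra of lower triangular $(m+1)\times(m+1)$ matrices over $A$ with $(i,j)$-entry in $A_{i-j}$ for $j\le i$, is Frobenius-finite. -/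

import Mathlib

open CategoryTheory

universe u

namespace FrobFin

/-! ### Duality, Nakayama functor, additive closure -/

section Duality

/-- The `k`-dual `D N = Hom_k(N, k)` of a right `A`-module `N` (a module over `Aᵐᵒᵖ`),
with its left `A`-module structure `(a • φ) n = φ (n a)`. -/
def KDual (k N : Type u) [Field k] [AddCommGroup N] [Module k N] : Type u :=
  N →ₗ[k] k

variable (k A N : Type u) [Field k] [Ring A] [AddCommGroup N] [Module k N]

noncomputable instance : AddCommGroup (KDual k N) :=
  inferInstanceAs (AddCommGroup (N →ₗ[k] k))

/-- An element of the dual, seen as a linear form. -/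
def KDual.toHom (φ : KDual k N) : N →ₗ[k] k := φ

/-- A linear form, seen as an element of the dual. -/
def KDual.of (φ : N →ₗ[k] k) : KDual k N := φ

variable [Module Aᵐᵒᵖ N] [SMulCommClass Aᵐᵒᵖ k N]

noncomputable instance : Module A (KDual k N) where
  smul a φ := KDual.of k N ((KDual.toHom k N φ).comp
    ({ toFun := fun n => MulOpposite.op a • n
       map_add' := fun x y => smul_add _ x y
       map_smul' := fun c x => smul_comm _ c x } : N →ₗ[k] N))
  one_smul φ := LinearMap.ext fun n => congrArg (KDual.toHom k N φ) (one_smul Aᵐᵒᵖ n)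
  mul_smul a b φ := LinearMap.ext fun n =>
    congrArg (KDual.toHom k N φ) (mul_smul (MulOpposite.op b) (MulOpposite.op a) n)
  smul_zero _ := LinearMap.ext fun _ => rfl
  smul_add _ _ _ := LinearMap.ext fun _ => rfl
  add_smul a b φ := LinearMap.ext fun n =>
    (congrArg (KDual.toHom k N φ)
      (add_smul (MulOpposite.op a) (MulOpposite.op b) n)).trans (map_add (KDual.toHom k N φ) _ _)
  zero_smul φ := LinearMap.ext fun n =>
    (congrArg (KDual.toHom k N φ) (zero_smul Aᵐᵒᵖ n)).trans (map_zero (KDual.toHom k N φ))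

theorem KDual.smul_apply (a : A) (φ : KDual k N) (n : N) :
    KDual.toHom k N (a • φ) n = KDual.toHom k N φ (MulOpposite.op a • n) := rfl

end Duality

section Nakayama

variable (k A : Type u) [Field k] [Ring A] [Algebra k A]

/-- The Nakayama functor on objects: `ν_A P = D Hom_A(P, A)`, where `Hom_A(P, A)` is a right
`A`-module through right multiplication on `A`. -/
noncomputable def nakayama (P : ModuleCat.{u} A) : ModuleCat.{u} A :=
  ModuleCat.of A (KDual k (P →ₗ[A] A))

/-- `P` is a finitely generated projective module all of whose iterates `ν_A^i P` are
projective. -/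
def IsNuStablyProjective (P : ModuleCat.{u} A) : Prop :=
  Module.Finite A P ∧ ∀ i : ℕ, Module.Projective A ((nakayama k A)^[i] P : ModuleCat.{u} A)

end Nakayama

/-- `Y ∈ add(X)`: `Y` is a direct summand of a finite direct sum of copies of `X`. -/
def InAdd (A X Y : Type u) [Ring A] [AddCommGroup X] [Module A X] [AddCommGroup Y]
    [Module A Y] : Prop :=
  ∃ (n : ℕ) (s : Y →ₗ[A] (Fin n → X)) (r : (Fin n → X) →ₗ[A] Y), r ∘ₗ s = LinearMap.id

/-! ### Representation-finite, Frobenius-finite and Auslander algebras -/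

/-- There are only finitely many isomorphism classes of indecomposable finitely generated
left `A`-modules. -/
def IsRepresentationFinite (A : Type u) [Ring A] : Prop :=
  ∃ (n : ℕ) (N : Fin n → ModuleCat.{u} A), ∀ X : ModuleCat.{u} A,
    Module.Finite A X → Indecomposable X → ∃ i, Nonempty (X ≅ N i)

/-- `e` is an idempotent such that `add(Ae)` is the category of `ν`-stably projective
`A`-modules; then `eAe` is the Frobenius part (the associated self-injective algebra) of `A`. -/
structure IsFrobeniusIdempotent (k : Type u) {A : Type u} [Field k] [Ring A] [Algebra k A]
    (e : A) : Prop where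
  idem : IsIdempotentElem e
  add_eq : ∀ P : ModuleCat.{u} A, InAdd A (Ideal.span {e}) P ↔ IsNuStablyProjective k A P

/-- A finite-dimensional algebra is Frobenius-finite if its Frobenius part `eAe` is
representation-finite. -/
def IsFrobeniusFinite (k A : Type u) [Field k] [Ring A] [Algebra k A] : Prop :=
  Module.Finite k A ∧
    ∃ (e : A) (he : IsFrobeniusIdempotent k e), IsRepresentationFinite he.idem.Corner

/-- The dominant dimension of the finitely generated module `X` is at least `n`: there is an
exact sequence `0 → X → I₀ → ⋯ → I_{n-1}` with all `I_j` finitely generated projective-injective.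
The sequence is built one term at a time, through the successive cokernels. -/
def HasDominantDimensionGE (A : Type u) [Ring A] : ℕ → ModuleCat.{u} A → Prop
  | 0, _ => True
  | n + 1, X => ∃ (I : ModuleCat.{u} A) (f : X →ₗ[A] I),
      Module.Finite A I ∧ Module.Projective A I ∧ Module.Injective A I ∧
      Function.Injective f ∧ HasDominantDimensionGE A n (ModuleCat.of A (I ⧸ LinearMap.range f))

/-- A finite-dimensional algebra of global dimension at most `2` and dominant dimension at
least `2`. -/
structure IsAuslanderAlgebra (k A : Type u) [Field k] [Ring A] [Algebra k A] : Prop where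
  finite : Module.Finite k A
  gldim_le : ∀ X : ModuleCat.{u} A, Module.Finite A X → HasProjectiveDimensionLE X 2
  domdim_ge : HasDominantDimensionGE A 2 (ModuleCat.of A A)

/-! ### Generators, cogenerators, torsionless modules -/

/-- `add(M)` contains the left regular module. -/
def IsGeneratorModule (A M : Type u) [Ring A] [AddCommGroup M] [Module A M] : Prop :=
  InAdd A M A

/-- `add(M)` contains the left module `D(A)`, the dual of the right regular module. -/
def IsCogeneratorModule (k A M : Type u) [Field k] [Ring A] [Algebra k A]
    [AddCommGroup M] [Module A M] : Prop :=
  InAdd A M (KDual k A)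

/-- `M` is a submodule of a (finitely generated) projective module. -/
def IsTorsionless (A M : Type u) [Ring A] [AddCommGroup M] [Module A M] : Prop :=
  ∃ (P : ModuleCat.{u} A) (f : M →ₗ[A] P),
    Module.Finite A P ∧ Module.Projective A P ∧ Function.Injective f

/-! ### Auslander–Yoneda algebras -/

/-- `0 ∈ Θ`, and for `l, m, n ∈ Θ` with `l + m + n ∈ Θ` one has `l + m ∈ Θ` iff `m + n ∈ Θ`. -/
structure IsAdmissible (Θ : Set ℕ) : Prop where
  zero_mem : 0 ∈ Θ
  add_mem_iff : ∀ l ∈ Θ, ∀ m ∈ Θ, ∀ n ∈ Θ, l + m + n ∈ Θ → (l + m ∈ Θ ↔ m + n ∈ Θ)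

section AuslanderYoneda

open Abelian

variable {C : Type*} [Category C] [Abelian C] [HasExt.{u} C]

/-- The (underlying type of the) `Θ`-Auslander–Yoneda algebra `⨁_{i ∈ Θ} Hom_{D(C)}(M, M[i])`
of an object `M` for a finite admissible set `Θ`. -/
def AuslanderYoneda (Θ : Finset ℕ) (_hΘ : IsAdmissible (Θ : Set ℕ)) (M : C) : Type u :=
  ∀ i : Θ, Ext.{u} M M (i : ℕ)

namespace AuslanderYoneda

variable {Θ : Finset ℕ} {hΘ : IsAdmissible (Θ : Set ℕ)} {M : C}

noncomputable instance : AddCommGroup (AuslanderYoneda Θ hΘ M) :=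
  inferInstanceAs (AddCommGroup (∀ i : Θ, Ext.{u} M M (i : ℕ)))

/-- For `f` of degree `i` and `g` of degree `j`, the product `f * g` is the composite
`f` followed by `g[i]` if `i + j ∈ Θ`, and zero otherwise. -/
noncomputable instance : Mul (AuslanderYoneda Θ hΘ M) where
  mul x y := fun n => ∑ i : Θ, ∑ j : Θ,
    if h : (i : ℕ) + (j : ℕ) = (n : ℕ) then (x i).comp (y j) h else 0

noncomputable instance : One (AuslanderYoneda Θ hΘ M) where
  one := fun n => if h : (0 : ℕ) = (n : ℕ) then h ▸ Ext.mk₀ (𝟙 M) else 0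

theorem mul_apply (x y : AuslanderYoneda Θ hΘ M) (n : Θ) :
    (x * y) n = ∑ i : Θ, ∑ j : Θ,
      if h : (i : ℕ) + (j : ℕ) = (n : ℕ) then (x i).comp (y j) h else 0 := rfl

theorem add_apply (x y : AuslanderYoneda Θ hΘ M) (n : Θ) : (x + y) n = x n + y n := rfl

theorem zero_apply (n : Θ) : (0 : AuslanderYoneda Θ hΘ M) n = 0 := rfl

theorem one_apply_zero :
    (1 : AuslanderYoneda Θ hΘ M) ⟨0, hΘ.zero_mem⟩ = Ext.mk₀ (𝟙 M) := by
  change (if h : (0 : ℕ) = 0 then h ▸ Ext.mk₀ (𝟙 M) else 0) = _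
  simp

theorem one_apply_of_ne (n : Θ) (hn : n ≠ ⟨0, hΘ.zero_mem⟩) :
    (1 : AuslanderYoneda Θ hΘ M) n = 0 := by
  change (if h : (0 : ℕ) = (n : ℕ) then h ▸ Ext.mk₀ (𝟙 M) else 0) = _
  rw [dif_neg]
  intro h
  exact hn (Subtype.ext h.symm)

theorem ext' {x y : AuslanderYoneda Θ hΘ M} (h : ∀ n, x n = y n) : x = y := funext h

protected theorem one_mul (x : AuslanderYoneda Θ hΘ M) : 1 * x = x := by
  refine ext' fun n => ?_
  rw [mul_apply, Finset.sum_eq_single ⟨0, hΘ.zero_mem⟩, Finset.sum_eq_single n]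
  · rw [dif_pos (by simp), one_apply_zero, Ext.mk₀_id_comp]
  · intro j _ hj
    rw [dif_neg]
    intro h
    exact hj (Subtype.ext (by simpa using h))
  · simp
  · intro i _ hi
    refine Finset.sum_eq_zero fun j _ => ?_
    rw [one_apply_of_ne i hi]
    simp
  · simp

protected theorem mul_one (x : AuslanderYoneda Θ hΘ M) : x * 1 = x := by
  refine ext' fun n => ?_
  rw [mul_apply, Finset.sum_eq_single n, Finset.sum_eq_single ⟨0, hΘ.zero_mem⟩]
  · rw [dif_pos (by simp), one_apply_zero, Ext.comp_mk₀_id]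
  · intro j _ hj
    rw [one_apply_of_ne j hj]
    simp
  · simp
  · intro i _ hi
    refine Finset.sum_eq_zero fun j _ => ?_
    by_cases hj : j = ⟨0, hΘ.zero_mem⟩
    · rw [dif_neg]
      intro h
      subst hj
      exact hi (Subtype.ext (by simpa using h))
    · rw [one_apply_of_ne j hj]
      simp
  · simp

private theorem sum_comp' {X Y Z : C} {p q n : ℕ} {ι : Type*} (s : Finset ι)
    (f : ι → Ext.{u} X Y p) (g : Ext.{u} Y Z q) (h : p + q = n) :
    (∑ i ∈ s, f i).comp g h = ∑ i ∈ s, (f i).comp g h :=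
  map_sum ((Ext.bilinearComp X Y Z p q n h).flip g) f s

private theorem comp_sum' {X Y Z : C} {p q n : ℕ} {ι : Type*} (s : Finset ι)
    (f : Ext.{u} X Y p) (g : ι → Ext.{u} Y Z q) (h : p + q = n) :
    f.comp (∑ i ∈ s, g i) h = ∑ i ∈ s, f.comp (g i) h :=
  map_sum (Ext.bilinearComp X Y Z p q n h f) g s

protected theorem mul_assoc (x y z : AuslanderYoneda Θ hΘ M) : x * y * z = x * (y * z) := by
  refine ext' fun n => ?_
  have hL : (x * y * z) n = ∑ i : Θ, ∑ j : Θ, ∑ l : Θ,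
      if h : (i : ℕ) + j ∈ Θ ∧ (i : ℕ) + j + l = n then
        ((x i).comp (y j) rfl).comp (z l) h.2 else 0 := by
    rw [mul_apply, Finset.sum_comm]
    have : ∀ l : Θ, (∑ s : Θ, if h : (s : ℕ) + l = n then ((x * y) s).comp (z l) h else 0)
        = ∑ i : Θ, ∑ j : Θ, if h : (i : ℕ) + j ∈ Θ ∧ (i : ℕ) + j + l = n then
          ((x i).comp (y j) rfl).comp (z l) h.2 else 0 := by
      intro l
      have h1 : ∀ s : Θ, (if h : (s : ℕ) + l = n then ((x * y) s).comp (z l) h else 0)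
          = ∑ i : Θ, ∑ j : Θ, if h : (i : ℕ) + j = s ∧ (s : ℕ) + l = n then
            ((x i).comp (y j) h.1).comp (z l) h.2 else 0 := by
        intro s
        by_cases hs : (s : ℕ) + l = n
        · rw [dif_pos hs, mul_apply, sum_comp']
          refine Finset.sum_congr rfl fun i _ => ?_
          rw [sum_comp']
          refine Finset.sum_congr rfl fun j _ => ?_
          by_cases hij : (i : ℕ) + j = s
          · rw [dif_pos hij, dif_pos ⟨hij, hs⟩]
          · rw [dif_neg hij, dif_neg (fun h => hij h.1), Ext.zero_comp]
        · rw [dif_neg hs]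
          symm
          refine Finset.sum_eq_zero fun i _ => Finset.sum_eq_zero fun j _ => ?_
          rw [dif_neg (fun h => hs h.2)]
      rw [Finset.sum_congr rfl fun s _ => h1 s, Finset.sum_comm]
      refine Finset.sum_congr rfl fun i _ => ?_
      rw [Finset.sum_comm]
      refine Finset.sum_congr rfl fun j _ => ?_
      by_cases hij : (i : ℕ) + j ∈ Θ
      · rw [Finset.sum_eq_single ⟨(i : ℕ) + j, hij⟩]
        · by_cases hn : (i : ℕ) + j + l = n
          · rw [dif_pos ⟨rfl, hn⟩, dif_pos ⟨hij, hn⟩]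
          · rw [dif_neg (fun h => hn h.2), dif_neg (fun h => hn h.2)]
        · intro s _ hs
          rw [dif_neg]
          rintro ⟨h, -⟩
          exact hs (Subtype.ext h.symm)
        · simp
      · rw [dif_neg (fun h => hij h.1)]
        refine Finset.sum_eq_zero fun s _ => ?_
        rw [dif_neg]
        rintro ⟨h, -⟩
        exact hij (h ▸ s.2)
    rw [Finset.sum_congr rfl fun l _ => this l, Finset.sum_comm]
    refine Finset.sum_congr rfl fun i _ => ?_
    rw [Finset.sum_comm]
  have hR : (x * (y * z)) n = ∑ i : Θ, ∑ j : Θ, ∑ l : Θ,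
      if h : (j : ℕ) + l ∈ Θ ∧ (i : ℕ) + (j + l) = n then
        (x i).comp ((y j).comp (z l) rfl) h.2 else 0 := by
    rw [mul_apply]
    refine Finset.sum_congr rfl fun i _ => ?_
    have h1 : ∀ s : Θ, (if h : (i : ℕ) + s = n then (x i).comp ((y * z) s) h else 0)
        = ∑ j : Θ, ∑ l : Θ, if h : (j : ℕ) + l = s ∧ (i : ℕ) + s = n then
          (x i).comp ((y j).comp (z l) h.1) h.2 else 0 := by
      intro s
      by_cases hs : (i : ℕ) + s = n
      · rw [dif_pos hs, mul_apply, comp_sum']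
        refine Finset.sum_congr rfl fun j _ => ?_
        rw [comp_sum']
        refine Finset.sum_congr rfl fun l _ => ?_
        by_cases hij : (j : ℕ) + l = s
        · rw [dif_pos hij, dif_pos ⟨hij, hs⟩]
        · rw [dif_neg hij, dif_neg (fun h => hij h.1), Ext.comp_zero]
      · rw [dif_neg hs]
        symm
        refine Finset.sum_eq_zero fun j _ => Finset.sum_eq_zero fun l _ => ?_
        rw [dif_neg (fun h => hs h.2)]
    rw [Finset.sum_congr rfl fun s _ => h1 s, Finset.sum_comm]
    refine Finset.sum_congr rfl fun j _ => ?_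
    rw [Finset.sum_comm]
    refine Finset.sum_congr rfl fun l _ => ?_
    by_cases hjl : (j : ℕ) + l ∈ Θ
    · rw [Finset.sum_eq_single ⟨(j : ℕ) + l, hjl⟩]
      · by_cases hn : (i : ℕ) + (j + l) = n
        · rw [dif_pos ⟨rfl, hn⟩, dif_pos ⟨hjl, hn⟩]
        · rw [dif_neg (fun h => hn h.2), dif_neg (fun h => hn h.2)]
      · intro s _ hs
        rw [dif_neg]
        rintro ⟨h, -⟩
        exact hs (Subtype.ext h.symm)
      · simp
    · rw [dif_neg (fun h => hjl h.1)]
      refine Finset.sum_eq_zero fun s _ => ?_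
      rw [dif_neg]
      rintro ⟨h, -⟩
      exact hjl (h ▸ s.2)
  rw [hL, hR]
  refine Finset.sum_congr rfl fun i _ => Finset.sum_congr rfl fun j _ =>
    Finset.sum_congr rfl fun l _ => ?_
  by_cases hn : (i : ℕ) + j + l = n
  · have hadm : (i : ℕ) + j ∈ Θ ↔ (j : ℕ) + l ∈ Θ :=
      hΘ.add_mem_iff i i.2 j j.2 l l.2 (by rw [hn]; exact n.2)
    by_cases hij : (i : ℕ) + j ∈ Θ
    · rw [dif_pos ⟨hij, hn⟩, dif_pos ⟨hadm.1 hij, by omega⟩]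
      exact Ext.comp_assoc _ _ _ _ _ hn
    · rw [dif_neg (fun h => hij h.1), dif_neg (fun h => hij (hadm.2 h.1))]
  · rw [dif_neg (fun h => hn h.2), dif_neg (fun h => hn (by omega))]

protected theorem mul_add (x y z : AuslanderYoneda Θ hΘ M) : x * (y + z) = x * y + x * z := by
  refine ext' fun n => ?_
  simp only [mul_apply, add_apply, ← Finset.sum_add_distrib]
  refine Finset.sum_congr rfl fun i _ => Finset.sum_congr rfl fun j _ => ?_
  split_ifs with h
  · exact Ext.comp_add _ _ _ _
  · simp

protected theorem add_mul (x y z : AuslanderYoneda Θ hΘ M) : (x + y) * z = x * z + y * z := by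
  refine ext' fun n => ?_
  simp only [mul_apply, add_apply, ← Finset.sum_add_distrib]
  refine Finset.sum_congr rfl fun i _ => Finset.sum_congr rfl fun j _ => ?_
  split_ifs with h
  · exact Ext.add_comp _ _ _ _
  · simp

noncomputable instance : Ring (AuslanderYoneda Θ hΘ M) where
  __ := (inferInstance : AddCommGroup (AuslanderYoneda Θ hΘ M))
  mul := (· * ·)
  one := 1
  left_distrib := AuslanderYoneda.mul_add
  right_distrib := AuslanderYoneda.add_mul
  zero_mul x := by
    have := AuslanderYoneda.add_mul (0 : AuslanderYoneda Θ hΘ M) 0 x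
    simpa using this
  mul_zero x := by
    have := AuslanderYoneda.mul_add x (0 : AuslanderYoneda Θ hΘ M) 0
    simpa using this
  mul_assoc := AuslanderYoneda.mul_assoc
  one_mul := AuslanderYoneda.one_mul
  mul_one := AuslanderYoneda.mul_one

variable {k : Type*} [Field k] [Linear k C]

noncomputable instance : Module k (AuslanderYoneda Θ hΘ M) :=
  inferInstanceAs (Module k (∀ i : Θ, Ext.{u} M M (i : ℕ)))

theorem smul_apply (c : k) (x : AuslanderYoneda Θ hΘ M) (n : Θ) : (c • x) n = c • x n := rfl

noncomputable instance : Algebra k (AuslanderYoneda Θ hΘ M) :=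
  Algebra.ofModule
    (fun c x y => ext' fun n => by
      simp only [mul_apply, smul_apply, Finset.smul_sum]
      refine Finset.sum_congr rfl fun i _ => Finset.sum_congr rfl fun j _ => ?_
      split_ifs with h
      · exact Ext.smul_comp _ _ _ _
      · simp)
    (fun c x y => ext' fun n => by
      simp only [mul_apply, smul_apply, Finset.smul_sum]
      refine Finset.sum_congr rfl fun i _ => Finset.sum_congr rfl fun j _ => ?_
      split_ifs with h
      · exact Ext.comp_smul _ _ _ _
      · simp)

end AuslanderYoneda

end AuslanderYoneda

/-! ### Triangular matrix algebras -/

/-- The matrices `[a 0; m b]` with `a ∈ A`, `b ∈ B` and `m` in the `B`-`A`-bimodule `M`. -/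
@[ext]
structure TriangularMatrix (A B M : Type u) where
  a : A
  m : M
  b : B

namespace TriangularMatrix

section Instances

variable {A B M : Type u} [Ring A] [Ring B] [AddCommGroup M]

instance : Zero (TriangularMatrix A B M) := ⟨⟨0, 0, 0⟩⟩
instance : One (TriangularMatrix A B M) := ⟨⟨1, 0, 1⟩⟩
instance : Add (TriangularMatrix A B M) := ⟨fun x y => ⟨x.a + y.a, x.m + y.m, x.b + y.b⟩⟩
instance : Neg (TriangularMatrix A B M) := ⟨fun x => ⟨-x.a, -x.m, -x.b⟩⟩

@[simp] theorem zero_a : (0 : TriangularMatrix A B M).a = 0 := rfl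
@[simp] theorem zero_m : (0 : TriangularMatrix A B M).m = 0 := rfl
@[simp] theorem zero_b : (0 : TriangularMatrix A B M).b = 0 := rfl
@[simp] theorem one_a : (1 : TriangularMatrix A B M).a = 1 := rfl
@[simp] theorem one_m : (1 : TriangularMatrix A B M).m = 0 := rfl
@[simp] theorem one_b : (1 : TriangularMatrix A B M).b = 1 := rfl
@[simp] theorem add_a (x y : TriangularMatrix A B M) : (x + y).a = x.a + y.a := rfl
@[simp] theorem add_m (x y : TriangularMatrix A B M) : (x + y).m = x.m + y.m := rfl
@[simp] theorem add_b (x y : TriangularMatrix A B M) : (x + y).b = x.b + y.b := rfl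
@[simp] theorem neg_a (x : TriangularMatrix A B M) : (-x).a = -x.a := rfl
@[simp] theorem neg_m (x : TriangularMatrix A B M) : (-x).m = -x.m := rfl
@[simp] theorem neg_b (x : TriangularMatrix A B M) : (-x).b = -x.b := rfl

instance : AddCommGroup (TriangularMatrix A B M) where
  add_assoc x y z := by ext <;> simp [add_assoc]
  zero_add x := by ext <;> simp
  add_zero x := by ext <;> simp
  add_comm x y := by ext <;> simp [add_comm]
  neg_add_cancel x := by ext <;> simp
  nsmul := nsmulRec
  zsmul := zsmulRec

variable {k : Type u} [Field k] [Algebra k A] [Algebra k B] [Module k M]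

instance : SMul k (TriangularMatrix A B M) := ⟨fun c x => ⟨c • x.a, c • x.m, c • x.b⟩⟩

@[simp] theorem smul_a (c : k) (x : TriangularMatrix A B M) : (c • x).a = c • x.a := rfl
@[simp] theorem smul_m (c : k) (x : TriangularMatrix A B M) : (c • x).m = c • x.m := rfl
@[simp] theorem smul_b (c : k) (x : TriangularMatrix A B M) : (c • x).b = c • x.b := rfl

instance : Module k (TriangularMatrix A B M) where
  one_smul x := by ext <;> simp
  mul_smul c d x := by ext <;> simp [mul_smul]
  smul_zero c := by ext <;> simp
  smul_add c x y := by ext <;> simp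
  add_smul c d x := by ext <;> simp [add_smul]
  zero_smul x := by ext <;> simp

section Mul

variable [Module B M] [Module Aᵐᵒᵖ M]

/-- `[a 0; m b] * [a' 0; m' b'] = [a a' 0; m a' + b m' b b']`. -/
instance : Mul (TriangularMatrix A B M) :=
  ⟨fun x y => ⟨x.a * y.a, MulOpposite.op y.a • x.m + x.b • y.m, x.b * y.b⟩⟩

@[simp] theorem mul_a (x y : TriangularMatrix A B M) : (x * y).a = x.a * y.a := rfl
@[simp] theorem mul_m (x y : TriangularMatrix A B M) :
    (x * y).m = MulOpposite.op y.a • x.m + x.b • y.m := rfl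
@[simp] theorem mul_b (x y : TriangularMatrix A B M) : (x * y).b = x.b * y.b := rfl

instance [SMulCommClass B Aᵐᵒᵖ M] : Ring (TriangularMatrix A B M) where
  __ := (inferInstance : AddCommGroup (TriangularMatrix A B M))
  left_distrib x y z := by
    ext
    · simp [mul_add]
    · simp only [mul_m, add_a, add_m, MulOpposite.op_add, add_smul, smul_add]; abel
    · simp [mul_add]
  right_distrib x y z := by
    ext
    · simp [add_mul]
    · simp only [mul_m, add_b, add_m, add_smul, smul_add]; abel
    · simp [add_mul]
  zero_mul x := by ext <;> simp
  mul_zero x := by ext <;> simp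
  mul_assoc x y z := by
    ext
    · simp [mul_assoc]
    · simp only [mul_m, mul_a, mul_b, smul_add, MulOpposite.op_mul, mul_smul, add_assoc]
      rw [smul_comm x.b (MulOpposite.op z.a) y.m]
    · simp [mul_assoc]
  one_mul x := by ext <;> simp
  mul_one x := by ext <;> simp
  zsmul := zsmulRec

instance [SMulCommClass B Aᵐᵒᵖ M] [IsScalarTower k B M] [IsScalarTower k Aᵐᵒᵖ M] :
    Algebra k (TriangularMatrix A B M) :=
  Algebra.ofModule
    (fun c x y => by
      ext
      · simp
      · simp [smul_comm c]
      · simp)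
    (fun c x y => by
      ext
      · simp
      · simp [smul_comm c]
      · simp)

end Mul

end Instances

end TriangularMatrix

/-- The multiplication of a lower triangular matrix algebra of size `m` with diagonal algebras
`A i` and with an `A i`-`A j`-bimodule `M i j` in position `(i, j)` for `j < i`: bimodule
homomorphisms `M i j ⊗_{A j} M j l → M i l` for `l < j < i`, which are associative. The modules
`M i j` with `i ≤ j` play no role. -/
structure TriangularSystem (k : Type u) [Field k] {m : ℕ} (A : Fin m → Type u)
    (M : Fin m → Fin m → Type u) [∀ i, Ring (A i)] [∀ i, Algebra k (A i)]
    [∀ i j, AddCommGroup (M i j)] [∀ i j, Module k (M i j)] [∀ i j, Module (A i) (M i j)]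
    [∀ i j, Module (A j)ᵐᵒᵖ (M i j)] where
  mul : ∀ {i j l : Fin m}, l < j → j < i → M i j →ₗ[k] M j l →ₗ[k] M i l
  left_linear : ∀ {i j l : Fin m} (h : l < j) (h' : j < i) (a : A i) (x : M i j) (y : M j l),
    mul h h' (a • x) y = a • mul h h' x y
  right_linear : ∀ {i j l : Fin m} (h : l < j) (h' : j < i) (a : A l) (x : M i j) (y : M j l),
    mul h h' x (MulOpposite.op a • y) = MulOpposite.op a • mul h h' x y
  balanced : ∀ {i j l : Fin m} (h : l < j) (h' : j < i) (a : A j) (x : M i j) (y : M j l),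
    mul h h' (MulOpposite.op a • x) y = mul h h' x (a • y)
  assoc : ∀ {i j l p : Fin m} (h : p < l) (h' : l < j) (h'' : j < i)
    (x : M i j) (y : M j l) (z : M l p),
    mul h (h'.trans h'') (mul h' h'' x y) z = mul (h.trans h') h'' x (mul h h' y z)

namespace TriangularSystem

variable {k : Type u} [Field k] {m : ℕ} {A : Fin m → Type u}
  {M : Fin m → Fin m → Type u} [∀ i, Ring (A i)] [∀ i, Algebra k (A i)]
  [∀ i j, AddCommGroup (M i j)] [∀ i j, Module k (M i j)] [∀ i j, Module (A i) (M i j)]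
  [∀ i j, Module (A j)ᵐᵒᵖ (M i j)]

/-- Lower triangular matrices with diagonal entries `x.diag i ∈ A i` and entries
`x.low i j _ ∈ M i j` for `j < i`. -/
@[ext]
structure MatrixAlgebra (T : TriangularSystem k A M) where
  diag : ∀ i, A i
  low : ∀ i j : Fin m, j < i → M i j

namespace MatrixAlgebra

variable {T : TriangularSystem k A M}

instance : Zero T.MatrixAlgebra := ⟨⟨0, fun _ _ _ => 0⟩⟩
instance : One T.MatrixAlgebra := ⟨⟨1, fun _ _ _ => 0⟩⟩
instance : Add T.MatrixAlgebra :=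
  ⟨fun x y => ⟨x.diag + y.diag, fun i j h => x.low i j h + y.low i j h⟩⟩
instance : Neg T.MatrixAlgebra := ⟨fun x => ⟨-x.diag, fun i j h => -x.low i j h⟩⟩
instance : SMul k T.MatrixAlgebra := ⟨fun c x => ⟨c • x.diag, fun i j h => c • x.low i j h⟩⟩

/-- Matrix multiplication: the `(i, j)` entry of `x * y` is `∑ l, x i l * y l j`, where the terms
with `l = i` and `l = j` are given by the bimodule structure of `M i j`. -/
instance : Mul T.MatrixAlgebra :=
  ⟨fun x y => ⟨x.diag * y.diag, fun i j h =>
    x.diag i • y.low i j h + MulOpposite.op (y.diag j) • x.low i j h +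
      ∑ l : Fin m, if hl : j < l ∧ l < i then
        T.mul hl.1 hl.2 (x.low i l hl.2) (y.low l j hl.1) else 0⟩⟩

@[simp] theorem zero_diag : (0 : T.MatrixAlgebra).diag = 0 := rfl
@[simp] theorem zero_low (i j : Fin m) (h : j < i) : (0 : T.MatrixAlgebra).low i j h = 0 := rfl
@[simp] theorem one_diag : (1 : T.MatrixAlgebra).diag = 1 := rfl
@[simp] theorem one_low (i j : Fin m) (h : j < i) : (1 : T.MatrixAlgebra).low i j h = 0 := rfl
@[simp] theorem add_diag (x y : T.MatrixAlgebra) : (x + y).diag = x.diag + y.diag := rfl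
@[simp] theorem add_low (x y : T.MatrixAlgebra) (i j : Fin m) (h : j < i) :
    (x + y).low i j h = x.low i j h + y.low i j h := rfl
@[simp] theorem neg_diag (x : T.MatrixAlgebra) : (-x).diag = -x.diag := rfl
@[simp] theorem neg_low (x : T.MatrixAlgebra) (i j : Fin m) (h : j < i) :
    (-x).low i j h = -x.low i j h := rfl
@[simp] theorem smul_diag (c : k) (x : T.MatrixAlgebra) : (c • x).diag = c • x.diag := rfl
@[simp] theorem smul_low (c : k) (x : T.MatrixAlgebra) (i j : Fin m) (h : j < i) :
    (c • x).low i j h = c • x.low i j h := rfl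
@[simp] theorem mul_diag (x y : T.MatrixAlgebra) : (x * y).diag = x.diag * y.diag := rfl
theorem mul_low (x y : T.MatrixAlgebra) (i j : Fin m) (h : j < i) :
    (x * y).low i j h =
      x.diag i • y.low i j h + MulOpposite.op (y.diag j) • x.low i j h +
        ∑ l : Fin m, if hl : j < l ∧ l < i then
          T.mul hl.1 hl.2 (x.low i l hl.2) (y.low l j hl.1) else 0 := rfl

theorem ext_entries {x y : T.MatrixAlgebra} (h : ∀ i, x.diag i = y.diag i)
    (h' : ∀ i j hij, x.low i j hij = y.low i j hij) : x = y :=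
  MatrixAlgebra.ext (funext h) (funext fun i => funext fun j => funext fun hij => h' i j hij)

instance : AddCommGroup T.MatrixAlgebra where
  add_assoc x y z := ext_entries (by simp [add_assoc]) (by simp [add_assoc])
  zero_add x := ext_entries (by simp) (by simp)
  add_zero x := ext_entries (by simp) (by simp)
  add_comm x y := ext_entries (by simp [add_comm]) (by simp [add_comm])
  neg_add_cancel x := ext_entries (by simp) (by simp)
  nsmul := nsmulRec
  zsmul := zsmulRec

instance : Module k T.MatrixAlgebra where
  one_smul x := ext_entries (by simp) (by simp)
  mul_smul c d x := ext_entries (by simp [mul_smul]) (by simp [mul_smul])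
  smul_zero c := ext_entries (by simp) (by simp)
  smul_add c x y := ext_entries (by simp) (by simp)
  add_smul c d x := ext_entries (by simp [add_smul]) (by simp [add_smul])
  zero_smul x := ext_entries (by simp) (by simp)

protected theorem mul_add (x y z : T.MatrixAlgebra) : x * (y + z) = x * y + x * z := by
  refine ext_entries (by simp [mul_add]) fun i j h => ?_
  have hs : (∑ l : Fin m, if hl : j < l ∧ l < i then
        T.mul hl.1 hl.2 (x.low i l hl.2) ((y + z).low l j hl.1) else 0) =
      (∑ l : Fin m, if hl : j < l ∧ l < i then
        T.mul hl.1 hl.2 (x.low i l hl.2) (y.low l j hl.1) else 0) +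
      ∑ l : Fin m, if hl : j < l ∧ l < i then
        T.mul hl.1 hl.2 (x.low i l hl.2) (z.low l j hl.1) else 0 := by
    rw [← Finset.sum_add_distrib]
    refine Finset.sum_congr rfl fun l _ => ?_
    split_ifs <;> simp
  rw [mul_low, hs, add_low, add_low, mul_low, mul_low, add_diag, Pi.add_apply,
    MulOpposite.op_add, add_smul, smul_add]
  abel

protected theorem add_mul (x y z : T.MatrixAlgebra) : (x + y) * z = x * z + y * z := by
  refine ext_entries (by simp [add_mul]) fun i j h => ?_
  have hs : (∑ l : Fin m, if hl : j < l ∧ l < i then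
        T.mul hl.1 hl.2 ((x + y).low i l hl.2) (z.low l j hl.1) else 0) =
      (∑ l : Fin m, if hl : j < l ∧ l < i then
        T.mul hl.1 hl.2 (x.low i l hl.2) (z.low l j hl.1) else 0) +
      ∑ l : Fin m, if hl : j < l ∧ l < i then
        T.mul hl.1 hl.2 (y.low i l hl.2) (z.low l j hl.1) else 0 := by
    rw [← Finset.sum_add_distrib]
    refine Finset.sum_congr rfl fun l _ => ?_
    split_ifs <;> simp
  rw [mul_low, hs, add_low, add_low, mul_low, mul_low, add_diag, Pi.add_apply,
    add_smul, smul_add]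
  abel

protected theorem mul_assoc [∀ i j, SMulCommClass (A i) (A j)ᵐᵒᵖ (M i j)]
    (x y z : T.MatrixAlgebra) : x * y * z = x * (y * z) := by
  refine ext_entries (by simp [mul_assoc]) fun i j h => ?_
  have hL : (∑ l : Fin m, if hl : j < l ∧ l < i then
        T.mul hl.1 hl.2 ((x * y).low i l hl.2) (z.low l j hl.1) else 0) =
      x.diag i • (∑ l : Fin m, if hl : j < l ∧ l < i then
        T.mul hl.1 hl.2 (y.low i l hl.2) (z.low l j hl.1) else 0) +
      (∑ l : Fin m, if hl : j < l ∧ l < i then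
        T.mul hl.1 hl.2 (x.low i l hl.2) (y.diag l • z.low l j hl.1) else 0) +
      ∑ p : Fin m, ∑ l : Fin m, if hl : j < l ∧ l < p ∧ p < i then
        T.mul (hl.1.trans hl.2.1) hl.2.2 (x.low i p hl.2.2)
          (T.mul hl.1 hl.2.1 (y.low p l hl.2.1) (z.low l j hl.1)) else 0 := by
    rw [Finset.sum_comm (s := Finset.univ) (t := Finset.univ), Finset.smul_sum,
      ← Finset.sum_add_distrib, ← Finset.sum_add_distrib]
    refine Finset.sum_congr rfl fun l _ => ?_
    by_cases hl : j < l ∧ l < i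
    · simp only [dif_pos hl, mul_low, map_add, LinearMap.add_apply, T.left_linear, T.balanced,
        map_sum, LinearMap.sum_apply]
      congr 1
      refine Finset.sum_congr rfl fun p _ => ?_
      by_cases hp : l < p ∧ p < i
      · rw [dif_pos hp, dif_pos ⟨hl.1, hp.1, hp.2⟩, T.assoc]
      · rw [dif_neg hp, dif_neg (fun q => hp q.2)]
        simp
    · simp only [dif_neg hl, smul_zero, zero_add]
      symm
      refine Finset.sum_eq_zero fun p _ => ?_
      rw [dif_neg]
      exact fun q => hl ⟨q.1, q.2.1.trans q.2.2⟩
  have hR : (∑ l : Fin m, if hl : j < l ∧ l < i then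
        T.mul hl.1 hl.2 (x.low i l hl.2) ((y * z).low l j hl.1) else 0) =
      (∑ l : Fin m, if hl : j < l ∧ l < i then
        T.mul hl.1 hl.2 (x.low i l hl.2) (y.diag l • z.low l j hl.1) else 0) +
      MulOpposite.op (z.diag j) • (∑ l : Fin m, if hl : j < l ∧ l < i then
        T.mul hl.1 hl.2 (x.low i l hl.2) (y.low l j hl.1) else 0) +
      ∑ p : Fin m, ∑ l : Fin m, if hl : j < l ∧ l < p ∧ p < i then
        T.mul (hl.1.trans hl.2.1) hl.2.2 (x.low i p hl.2.2)
          (T.mul hl.1 hl.2.1 (y.low p l hl.2.1) (z.low l j hl.1)) else 0 := by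
    rw [Finset.smul_sum, ← Finset.sum_add_distrib, ← Finset.sum_add_distrib]
    refine Finset.sum_congr rfl fun p _ => ?_
    by_cases hp : j < p ∧ p < i
    · simp only [dif_pos hp, mul_low, map_add, T.right_linear, map_sum]
      congr 1
      refine Finset.sum_congr rfl fun l _ => ?_
      by_cases hl : j < l ∧ l < p
      · rw [dif_pos hl, dif_pos ⟨hl.1, hl.2, hp.2⟩]
      · rw [dif_neg hl, dif_neg (fun q => hl ⟨q.1, q.2.1⟩)]
        simp
    · simp only [dif_neg hp, smul_zero, zero_add]
      symm
      refine Finset.sum_eq_zero fun l _ => ?_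
      rw [dif_neg]
      exact fun q => hp ⟨q.1.trans q.2.1, q.2.2⟩
  rw [mul_low, hL, mul_low x (y * z), hR, mul_low, mul_low]
  simp only [mul_diag, Pi.mul_apply, smul_add, mul_smul, MulOpposite.op_mul]
  rw [smul_comm (x.diag i) (MulOpposite.op (z.diag j)) (y.low i j h)]
  abel

instance [∀ i j, SMulCommClass (A i) (A j)ᵐᵒᵖ (M i j)] : Ring T.MatrixAlgebra where
  __ := (inferInstance : AddCommGroup T.MatrixAlgebra)
  left_distrib := MatrixAlgebra.mul_add
  right_distrib := MatrixAlgebra.add_mul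
  zero_mul x := by
    have := MatrixAlgebra.add_mul 0 0 x
    simpa using this
  mul_zero x := by
    have := MatrixAlgebra.mul_add x 0 0
    simpa using this
  mul_assoc := MatrixAlgebra.mul_assoc
  one_mul x := ext_entries (by simp) (by simp [mul_low])
  mul_one x := ext_entries (by simp) (by simp [mul_low])
  zsmul := zsmulRec

instance [∀ i j, SMulCommClass (A i) (A j)ᵐᵒᵖ (M i j)] [∀ i j, IsScalarTower k (A i) (M i j)]
    [∀ i j, IsScalarTower k (A j)ᵐᵒᵖ (M i j)] : Algebra k T.MatrixAlgebra :=
  Algebra.ofModule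
    (fun c x y => by
      refine ext_entries (by simp) fun i j h => ?_
      rw [smul_low, mul_low, mul_low, smul_add, smul_add, Finset.smul_sum]
      congr 1
      · simp [smul_comm c]
      · refine Finset.sum_congr rfl fun l _ => ?_
        split_ifs <;> simp)
    (fun c x y => by
      refine ext_entries (by simp) fun i j h => ?_
      rw [smul_low, mul_low, mul_low, smul_add, smul_add, Finset.smul_sum]
      congr 1
      · simp [smul_comm c]
      · refine Finset.sum_congr rfl fun l _ => ?_
        split_ifs <;> simp)

end MatrixAlgebra

end TriangularSystem

/-! ### Beilinson–Green algebras -/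

/-- The Beilinson–Green algebra `Λ_m` of an `ℕ`-graded algebra `R`: the algebra of lower triangular
matrices of size `m + 1` whose `(i, j)` entry lies in `R_{i-j}` for `j ≤ i`. -/
def beilinsonGreen {k R : Type u} [Field k] [Ring R] [Algebra k R] (G : ℕ → Submodule k R)
    [GradedAlgebra G] (m : ℕ) : Subalgebra k (Matrix (Fin (m + 1)) (Fin (m + 1)) R) where
  carrier := {X | ∀ i j : Fin (m + 1), (j ≤ i → X i j ∈ G ((i : ℕ) - (j : ℕ))) ∧ (i < j → X i j = 0)}
  mul_mem' {X Y} hX hY i j := by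
    refine ⟨fun hij => ?_, fun hij => ?_⟩
    · rw [Matrix.mul_apply]
      refine Submodule.sum_mem _ fun l _ => ?_
      rcases lt_or_ge i l with h | h
      · rw [(hX i l).2 h, zero_mul]; exact zero_mem _
      rcases lt_or_ge l j with h' | h'
      · rw [(hY l j).2 h', mul_zero]; exact zero_mem _
      have := SetLike.GradedMul.mul_mem ((hX i l).1 h) ((hY l j).1 h')
      rwa [show (i : ℕ) - l + (l - j) = i - j by
        have h1 : (l : ℕ) ≤ i := h
        have h2 : (j : ℕ) ≤ l := h'
        omega] at this
    · rw [Matrix.mul_apply]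
      refine Finset.sum_eq_zero fun l _ => ?_
      rcases lt_or_ge i l with h | h
      · rw [(hX i l).2 h, zero_mul]
      · rw [(hY l j).2 (h.trans_lt hij), mul_zero]
  add_mem' {X Y} hX hY i j :=
    ⟨fun h => add_mem ((hX i j).1 h) ((hY i j).1 h), fun h => by
      rw [Matrix.add_apply, (hX i j).2 h, (hY i j).2 h, add_zero]⟩
  algebraMap_mem' c i j := by
    rw [Matrix.algebraMap_matrix_apply]
    refine ⟨fun _ => ?_, fun h => if_neg h.ne⟩
    split_ifs with h
    · subst h
      rw [Nat.sub_self]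
      exact SetLike.algebraMap_mem_graded G c
    · exact zero_mem _

end FrobFin

open FrobFin

set_option linter.unusedSectionVars false

/-! The argument replaces the idempotent `e` by all `ν`-stably projective modules at once. A
finite-dimensional algebra is Frobenius-finite exactly when the opposite endomorphism ring of every
`ν`-stably projective module has finite representation type (`IsFrobeniusFinite.isListFinite`,
`isFrobeniusFinite_of_isListFinite`). The functor `ν` is fully faithful on finitely generated
projective modules, and there are finitely many indecomposable projectives. So `ν` permutes the
indecomposable `ν`-stably projective modules (`IsNuStablyProjective.exists_period`), and every
`ν`-stably projective module is itself of the form `ν P'`.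

Two transfer principles carry the proof. By `IsFrobeniusFinite.of_quotients`, it is enough that the
`ν`-stably projective modules split, compatibly with `ν`, into modules over Frobenius-finite
quotient algebras. By `IsFrobeniusFinite.of_end`, it is enough that `End(U)` (opposite) is
Frobenius-finite for a finitely generated projective `U` whose trace ideal has zero right
annihilator. Indeed all `ν`-stably projective modules then lie in `add(U)`, and `Hom(U, -)` commutes
with the Nakayama functors there.

For a generator `M`, the second principle applies to `U = Hom(M, A)`, whose endomorphism algebra is
`A`. For an Auslander algebra, let `P` be an additive generator of the `ν`-stably projective
modules. Every `End(P)`-module has a copresentation by modules `Hom(P, (νP)^n)`, hence is `Hom(P,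
K)` with `K` the kernel of a map of projectives. Global dimension at most two makes `K` projective,
and only finitely many indecomposable `K` exist.

For triangular algebras, including the Beilinson–Green algebras, an indecomposable summand of `R
e_i` is given the type `i`. The functor `ν` cannot raise the type, and by periodicity it preserves
it on `ν`-stably projective modules. Such a module therefore lives at a single diagonal position,
and the first principle applies (`IsFrobeniusFinite.of_triangular`).

For an Auslander–Yoneda algebra, the elements without degree zero part annihilate all `ν`-stably
projective modules (`IsNuStablyProjective.smul_eq_zero`), which reduces the claim to the quotient
`End(M)`. Over a self-injective algebra `ν` permutes the indecomposable projectives, so `D(A)` is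
projective and all finitely generated modules are torsionless. -/

namespace FrobFin

/-! ### Additive closures and direct summands. -/

section Add

variable {A : Type u} [Ring A]

/-- The identity of `Y` is a sum of endomorphisms that factor through the `X i`. -/
def IsSummandOf {ι : Type} [Fintype ι] (X : ι → Type u) (Y : Type u) [∀ i, AddCommGroup (X i)]
    [∀ i, Module A (X i)] [AddCommGroup Y] [Module A Y] : Prop :=
  ∃ (s : ∀ i, Y →ₗ[A] X i) (r : ∀ i, X i →ₗ[A] Y), ∑ i, r i ∘ₗ s i = LinearMap.id

variable {X Y Z : Type u} [AddCommGroup X] [Module A X] [AddCommGroup Y] [Module A Y]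
  [AddCommGroup Z] [Module A Z]

/-- Componentwise form of membership in `add(X)`: additive functors preserve it without any
comparison of products. -/
theorem inAdd_iff : InAdd A X Y ↔ ∃ (n : ℕ) (s : Fin n → Y →ₗ[A] X) (r : Fin n → X →ₗ[A] Y),
    ∑ i, r i ∘ₗ s i = LinearMap.id := by
  constructor
  · rintro ⟨n, s, r, h⟩
    refine ⟨n, fun i => LinearMap.proj i ∘ₗ s, fun i => r ∘ₗ LinearMap.single A (fun _ => X) i, ?_⟩
    rw [← h]
    ext y
    simp only [LinearMap.sum_apply, LinearMap.comp_apply, LinearMap.proj_apply]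
    rw [← map_sum]
    congr 1
    ext i
    simp [Finset.sum_apply, Pi.single_apply]
  · rintro ⟨n, s, r, h⟩
    refine ⟨n, LinearMap.pi s, ∑ i, r i ∘ₗ LinearMap.proj i, ?_⟩
    rw [← h]
    ext y
    simp

theorem InAdd.of_sum {ι : Type} [Fintype ι] (s : ι → Y →ₗ[A] X) (r : ι → X →ₗ[A] Y)
    (h : ∑ i, r i ∘ₗ s i = LinearMap.id) : InAdd A X Y := by
  refine inAdd_iff.2 ⟨Fintype.card ι, fun i => s ((Fintype.equivFin ι).symm i),
    fun i => r ((Fintype.equivFin ι).symm i), ?_⟩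
  rw [← h]
  exact (Fintype.equivFin ι).symm.sum_comp (fun i => r i ∘ₗ s i)

theorem InAdd.of_retract (s : Y →ₗ[A] X) (r : X →ₗ[A] Y) (h : r ∘ₗ s = LinearMap.id) :
    InAdd A X Y :=
  InAdd.of_sum (ι := Unit) (fun _ => s) (fun _ => r) (by simpa using h)

theorem InAdd.of_equiv (e : Y ≃ₗ[A] X) : InAdd A X Y :=
  InAdd.of_retract e.toLinearMap e.symm.toLinearMap (by ext; simp)

theorem InAdd.refl : InAdd A X X := InAdd.of_equiv (LinearEquiv.refl A X)

theorem IsSummandOf.inAdd {ι : Type} [Fintype ι] {X : ι → Type u} [∀ i, AddCommGroup (X i)]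
    [∀ i, Module A (X i)] (h : IsSummandOf (A := A) X Y) (hX : ∀ i, InAdd A Z (X i)) :
    InAdd A Z Y := by
  obtain ⟨s, r, h⟩ := h
  choose n s' r' h' using fun i => inAdd_iff.1 (hX i)
  refine InAdd.of_sum (ι := Σ i, Fin (n i)) (fun t => s' t.1 t.2 ∘ₗ s t.1)
    (fun t => r t.1 ∘ₗ r' t.1 t.2) ?_
  rw [Fintype.sum_sigma, ← h]
  refine Finset.sum_congr rfl fun i _ => ?_
  ext y
  have := congrArg (r i) (LinearMap.congr_fun (h' i) (s i y))
  simpa only [LinearMap.sum_apply, LinearMap.comp_apply, LinearMap.id_apply, map_sum] using this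

theorem InAdd.isSummandOf (h : InAdd A X Y) : ∃ n, IsSummandOf (A := A) (fun _ : Fin n => X) Y :=
  let ⟨n, s, r, h⟩ := inAdd_iff.1 h
  ⟨n, s, r, h⟩

theorem InAdd.trans (h : InAdd A X Y) (h' : InAdd A Z X) : InAdd A Z Y :=
  let ⟨_, hn⟩ := h.isSummandOf
  hn.inAdd fun _ => h'

theorem isSummandOf_pi {ι : Type} [Fintype ι] (X : ι → Type u) [∀ i, AddCommGroup (X i)]
    [∀ i, Module A (X i)] (e : Y ≃ₗ[A] (∀ i, X i)) : IsSummandOf (A := A) X Y := by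
  classical
  refine ⟨fun i => LinearMap.proj i ∘ₗ e.toLinearMap,
    fun i => e.symm.toLinearMap ∘ₗ LinearMap.single A X i, ?_⟩
  ext y
  simp only [LinearMap.sum_apply, LinearMap.comp_apply, LinearMap.proj_apply, LinearEquiv.coe_coe]
  rw [← map_sum, LinearEquiv.symm_apply_eq]
  ext i
  rw [Finset.sum_apply, Finset.sum_eq_single i]
  · simp
  · intro j _ hj
    simp [hj.symm]
  · simp

theorem inAdd_pi {ι : Type} [Fintype ι] {X : ι → Type u} [∀ i, AddCommGroup (X i)]
    [∀ i, Module A (X i)] (h : ∀ i, InAdd A Z (X i)) : InAdd A Z (∀ i, X i) :=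
  (isSummandOf_pi X (LinearEquiv.refl A _)).inAdd h

theorem InAdd.trans' (h : InAdd A Z X) (e : X ≃ₗ[A] Y) : InAdd A Z Y :=
  (InAdd.of_equiv e.symm).trans h

theorem InAdd.prod (h : InAdd A Z X) (h' : InAdd A Z Y) : InAdd A Z (X × Y) := by
  obtain ⟨n, s, r, hsr⟩ := h
  obtain ⟨n', s', r', hsr'⟩ := h'
  refine InAdd.trans (X := (Fin n → Z) × (Fin n' → Z))
    (InAdd.of_retract (s.prodMap s') (r.prodMap r') (LinearMap.ext fun x =>
      Prod.ext (LinearMap.congr_fun hsr x.1) (LinearMap.congr_fun hsr' x.2))) ?_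
  refine InAdd.of_sum (ι := Fin n ⊕ Fin n')
    (Sum.elim (fun i => LinearMap.proj i ∘ₗ LinearMap.fst A _ _)
      fun i => LinearMap.proj i ∘ₗ LinearMap.snd A _ _)
    (Sum.elim (fun i => LinearMap.inl A _ _ ∘ₗ LinearMap.single A (fun _ => Z) i)
      fun i => LinearMap.inr A _ _ ∘ₗ LinearMap.single A (fun _ => Z) i) ?_
  rw [Fintype.sum_sum_type]
  refine LinearMap.ext fun x => Prod.ext ?_ ?_
  · ext i
    simp [Prod.fst_sum, Finset.sum_apply, Pi.single_apply]
  · ext i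
    simp [Prod.snd_sum, Finset.sum_apply, Pi.single_apply]

theorem isSummandOf_of_retract {ι : Type} [Fintype ι] {X : ι → Type u} [∀ i, AddCommGroup (X i)]
    [∀ i, Module A (X i)] (h : IsSummandOf (A := A) X Y) (s : Z →ₗ[A] Y) (r : Y →ₗ[A] Z)
    (hsr : r ∘ₗ s = LinearMap.id) : IsSummandOf (A := A) X Z := by
  obtain ⟨s', r', h⟩ := h
  refine ⟨fun i => s' i ∘ₗ s, fun i => r ∘ₗ r' i, ?_⟩
  rw [← hsr]
  ext x
  have := congrArg r (LinearMap.congr_fun h (s x))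
  simpa only [LinearMap.sum_apply, LinearMap.comp_apply, LinearMap.id_apply, map_sum] using this

theorem inAdd_pi_self (i : ℕ) : InAdd A Z (Fin i → Z) := inAdd_pi fun _ => InAdd.refl

theorem inAdd_of_finite_projective [Module.Finite A Y] [Module.Projective A Y] : InAdd A A Y := by
  obtain ⟨n, f, hf⟩ := Module.Finite.exists_fin' A Y
  obtain ⟨s, hs⟩ := Module.projective_lifting_property f LinearMap.id hf
  exact ⟨n, s, f, hs⟩

theorem InAdd.finite [Module.Finite A X] (h : InAdd A X Y) : Module.Finite A Y := by
  obtain ⟨n, s, r, h⟩ := h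
  exact Module.Finite.of_surjective r fun y => ⟨s y, LinearMap.congr_fun h y⟩

theorem InAdd.projective [Module.Projective A X] (h : InAdd A X Y) : Module.Projective A Y := by
  obtain ⟨n, s, r, h⟩ := h
  have := Module.Projective.of_equiv
    (DFinsupp.linearEquivFunOnFintype (R := A) (M := fun _ : Fin n => X))
  exact Module.Projective.of_split s r h

end Add

/-! ### Indecomposable modules of finite length. -/

section Indecomposable

variable (A : Type u) [Ring A]

/-- A nonzero module without nontrivial idempotent endomorphisms. -/
def IsIndec (N : Type u) [AddCommGroup N] [Module A N] : Prop :=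
  Nontrivial N ∧ ∀ e : N →ₗ[A] N, e ∘ₗ e = e → e = 0 ∨ e = LinearMap.id

variable {A}
variable {N N' : Type u} [AddCommGroup N] [Module A N] [AddCommGroup N'] [Module A N']

theorem subsingleton_of_isZero {X : ModuleCat.{u} A} (h : Limits.IsZero X) : Subsingleton X :=
  ModuleCat.subsingleton_of_isZero h

/-- The decomposition of a module given by an idempotent endomorphism. -/
noncomputable def idemDecomp (e : N →ₗ[A] N) (he : e ∘ₗ e = e) :
    N ≃ₗ[A] (LinearMap.range e × LinearMap.ker e) where
  toFun x := (⟨e x, x, rfl⟩, ⟨x - e x, by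
    have := LinearMap.congr_fun he x
    simp only [LinearMap.comp_apply] at this
    simp [this]⟩)
  invFun x := x.1 + x.2
  map_add' x y := by
    ext
    · simp
    · simp; abel
  map_smul' c x := by ext <;> simp [smul_sub]
  left_inv x := by simp
  right_inv := by
    rintro ⟨⟨_, x, rfl⟩, y, hy⟩
    have := LinearMap.congr_fun he x
    simp only [LinearMap.comp_apply] at this
    rw [LinearMap.mem_ker] at hy
    ext <;> simp [this, hy]

/-- An idempotent splits the module as range plus kernel, one of which must vanish. -/
theorem isIndec_of_indecomposable {X : ModuleCat.{u} A} (h : Indecomposable X) : IsIndec A X := by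
  refine ⟨?_, fun e he => ?_⟩
  · rw [← not_subsingleton_iff_nontrivial]
    intro hs
    exact h.1 (ModuleCat.isZero_of_subsingleton X)
  · have i : X ≅ ModuleCat.of A (LinearMap.range e) ⊞ ModuleCat.of A (LinearMap.ker e) :=
      (idemDecomp e he).toModuleIso ≪≫ (ModuleCat.biprodIsoProd
        (ModuleCat.of A (LinearMap.range e)) (ModuleCat.of A (LinearMap.ker e))).symm
    rcases h.2 _ _ i with h | h
    · left
      have := subsingleton_of_isZero h
      ext x
      exact congrArg Subtype.val (Subsingleton.elim (⟨e x, x, rfl⟩ : LinearMap.range e) 0)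
    · right
      have := subsingleton_of_isZero h
      ext x
      have h1 := LinearMap.congr_fun he x
      simp only [LinearMap.comp_apply] at h1
      have h2 := congrArg Subtype.val (Subsingleton.elim
        (⟨x - e x, by simp [h1]⟩ : LinearMap.ker e) 0)
      simp only [ZeroMemClass.coe_zero, sub_eq_zero] at h2
      simp [← h2]

theorem indecomposable_of_isIndec {X : ModuleCat.{u} A} (h : IsIndec A X) : Indecomposable X := by
  refine ⟨fun hz => ?_, fun Y Z i => ?_⟩
  · have := subsingleton_of_isZero hz
    exact not_subsingleton_iff_nontrivial.2 h.1 this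
  · let i' : X ≃ₗ[A] (Y × Z) := (i ≪≫ ModuleCat.biprodIsoProd _ _).toLinearEquiv
    let e : X →ₗ[A] X := i'.symm.toLinearMap ∘ₗ LinearMap.inl A Y Z ∘ₗ LinearMap.fst A Y Z ∘ₗ
      i'.toLinearMap
    rcases h.2 e (by ext; simp [e]) with h | h
    · left
      have : Subsingleton Y := ⟨fun y y' => by
        have h1 := LinearMap.congr_fun h (i'.symm (y, 0))
        have h2 := LinearMap.congr_fun h (i'.symm (y', 0))
        simp [e] at h1 h2
        rw [h1, h2]⟩
      exact ModuleCat.isZero_of_subsingleton Y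
    · right
      have : Subsingleton Z := ⟨fun y y' => by
        have h1 := LinearMap.congr_fun h (i'.symm (0, y))
        have h2 := LinearMap.congr_fun h (i'.symm (0, y'))
        simp [e] at h1 h2
        rw [← h1, ← h2]⟩
      exact ModuleCat.isZero_of_subsingleton Z

/-- Endomorphisms of an indecomposable module of finite length are bijective or nilpotent. -/
theorem IsIndec.bijective_or_nilpotent [IsArtinian A N] [IsNoetherian A N] (h : IsIndec A N)
    (f : Module.End A N) : Function.Bijective f ∨ IsNilpotent f := by
  -- Fitting's lemma: `N` is the direct sum of `ker f^n` and `im f^n` for large `n`, and the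
  -- projection onto one of them is a trivial idempotent. Positivity of `n` ensures `ker f ⊆ ker
  -- f^n`.
  obtain ⟨n, hn0, hn⟩ := ((Filter.eventually_gt_atTop 0).and
    f.eventually_isCompl_ker_pow_range_pow).exists
  have hp : LinearMap.ker (f ^ n) = ⊥ ∨ LinearMap.range (f ^ n) = ⊥ := by
    let q := (LinearMap.ker (f ^ n)).projectionOnto (LinearMap.range (f ^ n)) hn
    let p := (LinearMap.ker (f ^ n)).subtype ∘ₗ q
    have hq : ∀ x : LinearMap.ker (f ^ n), q x = x := fun x =>
      Submodule.projectionOnto_apply_left hn x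
    have hpp : p ∘ₗ p = p := by
      ext x
      simp [p, hq]
    rcases h.2 p hpp with h0 | h0
    · left
      rw [eq_bot_iff]
      intro x hx
      have := LinearMap.congr_fun h0 x
      rw [LinearMap.comp_apply, hq ⟨x, hx⟩] at this
      simpa using this
    · right
      rw [eq_bot_iff]
      intro x hx
      have := LinearMap.congr_fun h0 x
      simp only [p, LinearMap.comp_apply, LinearMap.id_apply] at this
      rw [Submodule.projectionOnto_apply_of_mem_right hn hx] at this
      simpa using this.symm
  rcases hp with hp | hp
  · left
    have hinj : Function.Injective f := by
      rw [← LinearMap.ker_eq_bot, eq_bot_iff, ← hp]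
      intro x hx
      obtain ⟨m, rfl⟩ := Nat.exists_eq_succ_of_ne_zero hn0.ne'
      simp only [LinearMap.mem_ker] at hx ⊢
      rw [pow_succ, Module.End.mul_apply, hx, map_zero]
    exact IsArtinian.bijective_of_injective_endomorphism f hinj
  · right
    exact ⟨n, LinearMap.range_eq_bot.1 hp⟩

/-- The dichotomy between bijective and nilpotent makes `End(N)` local, and in a local ring a unit
that is a finite sum has a unit among its terms. -/
theorem IsIndec.exists_bijective_of_sum [IsArtinian A N] [IsNoetherian A N] (h : IsIndec A N)
    {ι : Type*} (s : Finset ι) (f : ι → Module.End A N)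
    (hf : Function.Bijective (∑ i ∈ s, f i : Module.End A N)) :
    ∃ i ∈ s, Function.Bijective (f i) := by
  have hloc : IsLocalRing (Module.End A N) := by
    have := h.1
    refine IsLocalRing.of_isUnit_or_isUnit_one_sub_self fun a => ?_
    rcases h.bijective_or_nilpotent a with ha | ha
    · exact Or.inl ((Module.End.isUnit_iff a).2 ha)
    · exact Or.inr ha.isUnit_one_sub
  have := (Module.End.isUnit_iff _).2 hf
  classical
  induction s using Finset.induction_on with
  | empty => simp at this
  | insert a s ha ih =>
    rw [Finset.sum_insert ha] at this
    rcases IsLocalRing.isUnit_or_isUnit_of_isUnit_add this with h | h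
    · exact ⟨a, by simp, (Module.End.isUnit_iff _).1 h⟩
    · obtain ⟨i, hi, hi'⟩ := ih ((Module.End.isUnit_iff _).1 h) h
      exact ⟨i, by simp [hi], hi'⟩

/-- An indecomposable summand of a direct sum is a summand of one of the terms. -/
theorem IsIndec.exists_retract [IsArtinian A N] [IsNoetherian A N] (h : IsIndec A N)
    {ι : Type} [Fintype ι] {X : ι → Type u} [∀ i, AddCommGroup (X i)]
    [∀ i, Module A (X i)] (hN : IsSummandOf (A := A) X N) :
    ∃ (i : ι) (s : N →ₗ[A] X i) (r : X i →ₗ[A] N), r ∘ₗ s = LinearMap.id := by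
  obtain ⟨s, r, hsr⟩ := hN
  obtain ⟨i, -, hi⟩ := h.exists_bijective_of_sum Finset.univ (fun i => r i ∘ₗ s i)
    (by rw [show (∑ i, (r i ∘ₗ s i : Module.End A N)) = LinearMap.id from hsr]
        exact Function.bijective_id)
  refine ⟨i, s i, (LinearEquiv.ofBijective _ hi).symm.toLinearMap ∘ₗ r i, ?_⟩
  ext x
  exact (LinearEquiv.ofBijective (r i ∘ₗ s i) hi).symm_apply_apply x

/-- A nonzero retract of an indecomposable module is isomorphic to it. -/
theorem IsIndec.equiv_of_retract (h : IsIndec A N) [Nontrivial N'] (s : N' →ₗ[A] N)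
    (r : N →ₗ[A] N') (hrs : r ∘ₗ s = LinearMap.id) : Nonempty (N' ≃ₗ[A] N) := by
  have hrs' : ∀ x, r (s x) = x := LinearMap.congr_fun hrs
  rcases h.2 (s ∘ₗ r) (by ext x; simp [hrs']) with h0 | h0
  · obtain ⟨x, hx⟩ := exists_ne (0 : N')
    refine (hx ?_).elim
    have := LinearMap.congr_fun h0 (s x)
    simp only [LinearMap.comp_apply, hrs', LinearMap.zero_apply] at this
    rw [← hrs' x, this, map_zero]
  · exact ⟨LinearEquiv.ofLinearMap s r h0 hrs⟩

/-- Properties of modules of finite length can be checked on indecomposable modules if they are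
stable under isomorphisms and finite direct sums. -/
theorem indec_induction [IsArtinianRing A] {𝒬 : ModuleCat.{u} A → Prop}
    (iso : ∀ X Y : ModuleCat.{u} A, (X ≃ₗ[A] Y) → 𝒬 X → 𝒬 Y)
    (zero : ∀ X : ModuleCat.{u} A, Subsingleton X → 𝒬 X)
    (prod : ∀ X Y : ModuleCat.{u} A, Module.Finite A X → Module.Finite A Y → 𝒬 X → 𝒬 Y →
      𝒬 (ModuleCat.of A (X × Y)))
    (indec : ∀ X : ModuleCat.{u} A, Module.Finite A X → IsIndec A X → 𝒬 X)
    (X : ModuleCat.{u} A) [Module.Finite A X] : 𝒬 X := by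
  have key : ∀ p : Submodule A X, 𝒬 (ModuleCat.of A p) := by
    intro p
    induction p using IsArtinian.induction with
    | hgt p ih =>
    by_cases hs : Subsingleton p
    · exact zero _ hs
    by_cases hp : IsIndec A p
    · exact indec _ (inferInstanceAs (Module.Finite A p)) hp
    have : ∃ e : p →ₗ[A] p, e ∘ₗ e = e ∧ ¬(e = 0 ∨ e = LinearMap.id) := by
      by_contra hcon
      exact hp ⟨not_subsingleton_iff_nontrivial.1 hs, fun e he => by
        by_contra h; exact hcon ⟨e, he, h⟩⟩
    obtain ⟨e, he, hne⟩ := this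
    have he' : ∀ x, e (e x) = e x := LinearMap.congr_fun he
    let eqv : ∀ q : Submodule A p, q ≃ₗ[A] q.map p.subtype := fun q =>
      Submodule.equivMapOfInjective p.subtype p.injective_subtype q
    -- The induction runs over submodules of `X`, so a summand `q` of `p` is first carried into `X`
    -- along the inclusion of `p`. Neither range nor kernel of `e` is all of `p`, because `e` is
    -- neither the identity nor zero.
    have hlt : ∀ q : Submodule A p, q ≠ ⊤ → 𝒬 (ModuleCat.of A q) := by
      intro q hq
      refine iso (ModuleCat.of A (q.map p.subtype)) _ (eqv q).symm (ih _ ?_)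
      refine lt_of_le_of_ne (Submodule.map_subtype_le p q) fun h => hq ?_
      apply Submodule.map_injective_of_injective p.injective_subtype
      rw [h]; simp
    refine iso (ModuleCat.of A (LinearMap.range e × LinearMap.ker e)) _ (idemDecomp e he).symm
      (prod (ModuleCat.of A (LinearMap.range e)) (ModuleCat.of A (LinearMap.ker e))
        (inferInstanceAs (Module.Finite A (LinearMap.range e)))
        (inferInstanceAs (Module.Finite A (LinearMap.ker e))) (hlt _ fun h => ?_) (hlt _ fun h => ?_))
    · refine hne (Or.inr (LinearMap.ext fun x => ?_))
      obtain ⟨y, rfl⟩ := LinearMap.range_eq_top.1 h x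
      exact he' y
    · exact hne (Or.inl (LinearMap.ker_eq_top.1 h))
  exact iso (ModuleCat.of A (⊤ : Submodule A X)) X Submodule.topEquiv (key ⊤)

/-- Every module of finite length is a direct sum of indecomposable modules. -/
theorem exists_indec_decomposition [IsArtinianRing A] (X : ModuleCat.{u} A) [Module.Finite A X] :
    ∃ (ι : Type) (_ : Fintype ι) (N : ι → ModuleCat.{u} A),
      (∀ i, Module.Finite A (N i) ∧ IsIndec A (N i)) ∧ Nonempty (X ≃ₗ[A] (∀ i, N i)) := by
  refine indec_induction (𝒬 := fun X => ∃ (ι : Type) (_ : Fintype ι) (N : ι → ModuleCat.{u} A),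
    (∀ i, Module.Finite A (N i) ∧ IsIndec A (N i)) ∧ Nonempty (X ≃ₗ[A] (∀ i, N i))) ?_ ?_ ?_ ?_ X
  · rintro X Y e ⟨ι, hι, N, hN, ⟨f⟩⟩
    exact ⟨ι, hι, N, hN, ⟨e.symm.trans f⟩⟩
  · intro X hX
    exact ⟨Empty, inferInstance, fun i => i.elim, fun i => i.elim,
      ⟨LinearEquiv.ofBijective (0 : X →ₗ[A] _) ⟨fun _ _ _ => Subsingleton.elim _ _,
        fun y => ⟨0, Subsingleton.elim _ _⟩⟩⟩⟩
  · rintro X Y _ _ ⟨ι, _, N, hN, ⟨f⟩⟩ ⟨ι', _, N', hN', ⟨f'⟩⟩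
    refine ⟨ι ⊕ ι', inferInstance, Sum.elim N N', ?_, ⟨?_⟩⟩
    · rintro (i | i)
      exacts [hN i, hN' i]
    · let S : ι ⊕ ι' → ModuleCat.{u} A := Sum.elim N N'
      let g : (∀ i, S i) ≃ₗ[A] ((∀ i, N i) × (∀ i, N' i)) :=
        { toFun := fun x => (fun i => x (Sum.inl i), fun i => x (Sum.inr i))
          invFun := fun x i => match i with
            | Sum.inl i => x.1 i
            | Sum.inr i => x.2 i
          left_inv := fun x => by ext (i | i) <;> rfl
          right_inv := fun x => rfl
          map_add' := fun _ _ => rfl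
          map_smul' := fun _ _ => rfl }
      exact (LinearEquiv.prodCongr f f').trans g.symm
  · intro X hX hi
    exact ⟨Unit, inferInstance, fun _ => X, fun _ => ⟨hX, hi⟩,
      ⟨((LinearEquiv.funUnique Unit A X).symm : X ≃ₗ[A] (Unit → X))⟩⟩

end Indecomposable

/-! ### Finite representation type through direct sum decompositions. -/

section ListFinite

/-- Every finitely generated module is a finite direct sum of modules from a finite list. -/
def IsListFinite (R : Type u) [Ring R] : Prop :=
  ∃ (n : ℕ) (N : Fin n → ModuleCat.{u} R), ∀ X : ModuleCat.{u} R, Module.Finite R X →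
    ∃ (ι : Type) (_ : Fintype ι) (c : ι → Fin n), Nonempty (X ≃ₗ[R] (∀ t, N (c t)))

variable {R : Type u} [Ring R]

/-- The idempotents of the factors sum to the identity of `X`, so one of them is nonzero, hence
equal to the identity. Triviality of idempotents is all that enters, so no chain condition on `R` is
required. -/
theorem IsIndec.exists_equiv_of_pi {ι : Type} [Fintype ι] {X : Type u} [AddCommGroup X]
    [Module R X] (hX : IsIndec R X) (N : ι → Type u) [∀ i, AddCommGroup (N i)]
    [∀ i, Module R (N i)] (f : X ≃ₗ[R] (∀ i, N i)) : ∃ i, Nonempty (X ≃ₗ[R] N i) := by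
  classical
  let e : ι → X →ₗ[R] X := fun i =>
    f.symm.toLinearMap ∘ₗ LinearMap.single R N i ∘ₗ LinearMap.proj i ∘ₗ f.toLinearMap
  obtain ⟨s, r, hsr⟩ := isSummandOf_pi (A := R) N f
  have hsum : ∑ i, e i = LinearMap.id := by
    ext x
    simp only [LinearMap.sum_apply, LinearMap.comp_apply, LinearMap.proj_apply,
      LinearEquiv.coe_coe, e]
    rw [← map_sum, LinearEquiv.symm_apply_eq]
    ext i
    rw [Finset.sum_apply, Finset.sum_eq_single i]
    · simp
    · intro j _ hj
      simp [hj.symm]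
    · simp
  have hid : ∀ i, e i ∘ₗ e i = e i := fun i => by ext x; simp [e]
  by_cases h0 : ∀ i, e i = 0
  · have := hX.1
    obtain ⟨x, hx⟩ := exists_ne (0 : X)
    have := LinearMap.congr_fun hsum x
    simp [h0] at this
    exact (hx this.symm).elim
  push Not at h0
  obtain ⟨i, hi⟩ := h0
  have hi1 : e i = LinearMap.id := (hX.2 _ (hid i)).resolve_left hi
  refine ⟨i, ⟨LinearEquiv.ofLinearMap (LinearMap.proj i ∘ₗ f.toLinearMap)
    (f.symm.toLinearMap ∘ₗ LinearMap.single R N i) ?_ ?_⟩⟩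
  · ext x; simp
  · exact hi1

theorem IsListFinite.isRepresentationFinite (h : IsListFinite R) : IsRepresentationFinite R := by
  obtain ⟨n, N, h⟩ := h
  refine ⟨n, N, fun X hf hX => ?_⟩
  obtain ⟨ι, _, c, ⟨f⟩⟩ := h X hf
  obtain ⟨i, ⟨g⟩⟩ := (isIndec_of_indecomposable hX).exists_equiv_of_pi _ f
  exact ⟨c i, ⟨g.toModuleIso⟩⟩

theorem IsRepresentationFinite.isListFinite [IsArtinianRing R] (h : IsRepresentationFinite R) :
    IsListFinite R := by
  obtain ⟨n, N, h⟩ := h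
  refine ⟨n, N, fun X hf => ?_⟩
  obtain ⟨ι, _, Y, hY, ⟨f⟩⟩ := exists_indec_decomposition X
  choose c hc using fun i => h (Y i) (hY i).1 (indecomposable_of_isIndec (hY i).2)
  exact ⟨ι, inferInstance, c,
    ⟨f.trans (LinearEquiv.piCongrRight fun i => (hc i).some.toLinearEquiv)⟩⟩

end ListFinite

/-! ### Duality for finite-dimensional modules. -/

section Dual

variable {k A : Type u} [Field k] [Ring A] [Algebra k A]

section KDual

variable {N N' : Type u} [AddCommGroup N] [Module k N] [Module Aᵐᵒᵖ N] [SMulCommClass Aᵐᵒᵖ k N]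
  [AddCommGroup N'] [Module k N'] [Module Aᵐᵒᵖ N'] [SMulCommClass Aᵐᵒᵖ k N']

theorem KDual.hom_ext {φ ψ : KDual k N} (h : ∀ n, KDual.toHom k N φ n = KDual.toHom k N ψ n) :
    φ = ψ :=
  LinearMap.ext h

/-- The transpose of a map of right modules. -/
def KDual.map (g : N' →ₗ[k] N)
    (hg : ∀ (a : A) (n : N'), g (MulOpposite.op a • n) = MulOpposite.op a • g n) :
    KDual k N →ₗ[A] KDual k N' where
  toFun φ := KDual.of k N' (KDual.toHom k N φ ∘ₗ g)
  map_add' _ _ := rfl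
  map_smul' a φ := KDual.hom_ext fun n => congrArg (KDual.toHom k N φ) (hg a n).symm

/-- `KDual` carries only its `A`-action; scalars from `k` act through `algebraMap k A`. -/
theorem KDual.algebraMap_smul [IsScalarTower k Aᵐᵒᵖ N] (c : k) (φ : KDual k N) (n : N) :
    KDual.toHom k N (algebraMap k A c • φ) n = c * KDual.toHom k N φ n := by
  rw [KDual.smul_apply, ← MulOpposite.algebraMap_apply, IsScalarTower.algebraMap_smul, map_smul,
    smul_eq_mul]

theorem KDual.finite [IsScalarTower k Aᵐᵒᵖ N] [Module.Finite k N] :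
    Module.Finite A (KDual k N) := by
  obtain ⟨s, hs⟩ := (inferInstance : Module.Finite k (N →ₗ[k] k)).fg_top
  let t : Finset (KDual k N) := s
  refine ⟨⟨t, eq_top_iff.2 fun φ _ => ?_⟩⟩
  have : KDual.toHom k N φ ∈ Submodule.span k (s : Set (N →ₗ[k] k)) := hs ▸ Submodule.mem_top
  have key : ∀ ψ : N →ₗ[k] k, ψ ∈ Submodule.span k (s : Set (N →ₗ[k] k)) →
      KDual.of k N ψ ∈ Submodule.span A (t : Set (KDual k N)) := by
    intro ψ hψ
    induction hψ using Submodule.span_induction with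
    | mem x hx => exact Submodule.subset_span hx
    | zero => exact zero_mem _
    | add x y _ _ hx hy => exact add_mem hx hy
    | smul c x _ hx =>
      have := Submodule.smul_mem (Submodule.span A (t : Set (KDual k N))) (algebraMap k A c) hx
      rwa [show algebraMap k A c • KDual.of k N x = KDual.of k N (c • x) from
        KDual.hom_ext fun n => KDual.algebraMap_smul c (KDual.of k N x) n] at this
  exact key φ this

/-- Every map between duals of finite-dimensional modules is a transpose. -/
theorem KDual.exists_eq_map [IsScalarTower k Aᵐᵒᵖ N] [IsScalarTower k Aᵐᵒᵖ N'] [Module.Finite k N]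
    (φ : KDual k N →ₗ[A] KDual k N') :
    ∃ (g : N' →ₗ[k] N)
      (hg : ∀ (a : A) (n : N'), g (MulOpposite.op a • n) = MulOpposite.op a • g n),
      φ = KDual.map g hg := by
  let φ' : Module.Dual k N →ₗ[k] Module.Dual k N' :=
    { toFun := fun ξ => KDual.toHom k N' (φ (KDual.of k N ξ))
      map_add' := fun ξ η => by
        have : KDual.of k N (ξ + η) = KDual.of k N ξ + KDual.of k N η := rfl
        rw [this, map_add]; rfl
      map_smul' := fun c ξ => by
        have : KDual.of k N (c • ξ) = algebraMap k A c • KDual.of k N ξ :=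
          KDual.hom_ext fun n => (KDual.algebraMap_smul c (KDual.of k N ξ) n).symm
        rw [this, map_smul]
        ext n
        exact KDual.algebraMap_smul c _ n }
  -- By biduality the transpose of `φ'` is a map from `N'` to `N`.
  let g : N' →ₗ[k] N := (Module.evalEquiv k N).symm.toLinearMap ∘ₗ φ'.dualMap ∘ₗ Module.Dual.eval k N'
  have hg : ∀ (ξ : Module.Dual k N) (n : N'), ξ (g n) = φ' ξ n := by
    intro ξ n
    simp [g]
  have hsep : ∀ n n' : N, (∀ ξ : Module.Dual k N, ξ n = ξ n') → n = n' := fun n n' h =>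
    (Module.evalEquiv k N).injective (LinearMap.ext h)
  refine ⟨g, fun a n => hsep _ _ fun ξ => ?_, LinearMap.ext fun ξ => KDual.hom_ext fun n =>
    (hg ξ n).symm⟩
  rw [hg]
  have : ξ (MulOpposite.op a • g n) = KDual.toHom k N (a • KDual.of k N ξ) (g n) := rfl
  rw [this]
  refine Eq.trans ?_ (hg (KDual.toHom k N (a • KDual.of k N ξ)) n).symm
  change _ = KDual.toHom k N' (φ (a • KDual.of k N ξ)) n
  rw [map_smul φ]
  rfl

end KDual

section PreComp

variable {X Y Z : Type u} [AddCommGroup X] [Module A X] [AddCommGroup Y] [Module A Y]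
  [AddCommGroup Z] [Module A Z] [Module k Z] [SMulCommClass A k Z]

/-- Composition with a fixed map, as a `k`-linear map. -/
def preComp (k : Type u) [Field k] [Module k Z] [SMulCommClass A k Z] (f : X →ₗ[A] Y) :
    (Y →ₗ[A] Z) →ₗ[k] (X →ₗ[A] Z) where
  toFun h := h ∘ₗ f
  map_add' _ _ := rfl
  map_smul' _ _ := rfl

/-- A map is determined by its values on finitely many generators. -/
theorem finite_hom [Module.Finite A X] [Module.Finite k Z] : Module.Finite k (X →ₗ[A] Z) := by
  obtain ⟨n, f, hf⟩ := Module.Finite.exists_fin' A X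
  let F : (X →ₗ[A] Z) →ₗ[k] (Fin n → Z) :=
    { toFun := fun h i => h (f (Pi.single i 1))
      map_add' := fun _ _ => rfl
      map_smul' := fun _ _ => rfl }
  refine Module.Finite.of_injective F fun h h' hh => ?_
  have : h ∘ₗ f = h' ∘ₗ f := by
    refine LinearMap.pi_ext' fun i => LinearMap.ext_ring ?_
    exact congrFun hh i
  ext x
  obtain ⟨y, rfl⟩ := hf x
  exact LinearMap.congr_fun this y

end PreComp

end Dual

/-! ### The Nakayama functor on morphisms and its full faithfulness on projectives. -/

section Nakayama

variable {k A : Type u} [Field k] [Ring A] [Algebra k A] {P P' P'' : ModuleCat.{u} A}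

/-- An element of `ν P` as a linear form on `Hom_A(P, A)`. -/
def nakForm (ξ : nakayama k A P) : (P →ₗ[A] A) →ₗ[k] k := KDual.toHom k _ ξ

/-- A linear form on `Hom_A(P, A)` as an element of `ν P`. -/
def nakMk (ξ : (P →ₗ[A] A) →ₗ[k] k) : nakayama k A P := KDual.of k _ ξ

theorem nak_ext {ξ η : nakayama k A P} (h : ∀ f, nakForm ξ f = nakForm η f) : ξ = η :=
  LinearMap.ext h

theorem nakForm_smul (a : A) (ξ : nakayama k A P) (f : P →ₗ[A] A) :
    nakForm (a • ξ) f = nakForm ξ (MulOpposite.op a • f) := rfl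

theorem nakForm_add (ξ η : nakayama k A P) (f : P →ₗ[A] A) :
    nakForm (ξ + η) f = nakForm ξ f + nakForm η f := rfl

theorem nakForm_zero (f : P →ₗ[A] A) : nakForm (0 : nakayama k A P) f = 0 := rfl

/-- Linear forms separate the elements of `Hom_A(P, A)`. -/
theorem hom_eq_zero_of_nakForm {f : P →ₗ[A] A} (h : ∀ ξ : nakayama k A P, nakForm ξ f = 0) :
    f = 0 :=
  (Module.forall_dual_apply_eq_zero_iff k f).1 fun ξ => h (nakMk ξ)

/-- The Nakayama functor on morphisms. -/
def nakMap (k : Type u) [Field k] [Algebra k A] (f : P →ₗ[A] P') :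
    nakayama k A P →ₗ[A] nakayama k A P' :=
  KDual.map (k := k) (A := A) (preComp k f) fun _ _ => rfl

theorem nakForm_map (f : P →ₗ[A] P') (ξ : nakayama k A P) (h : P' →ₗ[A] A) :
    nakForm (nakMap k f ξ) h = nakForm ξ (h ∘ₗ f) := rfl

theorem nakMap_id : nakMap k (LinearMap.id : P →ₗ[A] P) = LinearMap.id := rfl

theorem nakMap_comp (f : P →ₗ[A] P') (g : P' →ₗ[A] P'') :
    nakMap k (g ∘ₗ f) = nakMap k g ∘ₗ nakMap k f := rfl

theorem nakMap_add (f g : P →ₗ[A] P') : nakMap k (f + g) = nakMap k f + nakMap k g := by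
  refine LinearMap.ext fun ξ => nak_ext fun h => ?_
  rw [nakForm_map, LinearMap.comp_add, map_add]
  rfl

theorem nakMap_zero : nakMap k (0 : P →ₗ[A] P') = 0 := by
  refine LinearMap.ext fun ξ => nak_ext fun h => ?_
  rw [nakForm_map, LinearMap.comp_zero, map_zero]
  rfl

theorem nakMap_sum {ι : Type*} (s : Finset ι) (f : ι → P →ₗ[A] P') :
    nakMap k (∑ i ∈ s, f i) = ∑ i ∈ s, nakMap k (f i) :=
  map_sum (AddMonoidHom.mk' (fun f : P →ₗ[A] P' => nakMap k f) nakMap_add) f s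

/-- The Nakayama functor on isomorphisms. -/
noncomputable def nakEquiv (k : Type u) [Field k] [Algebra k A] (e : P ≃ₗ[A] P') :
    nakayama k A P ≃ₗ[A] nakayama k A P' :=
  LinearEquiv.ofLinearMap (nakMap k e.toLinearMap) (nakMap k e.symm.toLinearMap)
    (by rw [← nakMap_comp, ← nakMap_id]; congr 1; ext; simp)
    (by rw [← nakMap_comp, ← nakMap_id]; congr 1; ext; simp)

/-- The Nakayama functor commutes with direct sums. -/
noncomputable def nakProd (k : Type u) [Field k] [Algebra k A] (P P' : ModuleCat.{u} A) :
    nakayama k A (ModuleCat.of A (P × P')) ≃ₗ[A] (nakayama k A P × nakayama k A P') :=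
  let f : ModuleCat.of A (P × P') →ₗ[A] P := LinearMap.fst A P P'
  let g : ModuleCat.of A (P × P') →ₗ[A] P' := LinearMap.snd A P P'
  let i : P →ₗ[A] ModuleCat.of A (P × P') := LinearMap.inl A P P'
  let j : P' →ₗ[A] ModuleCat.of A (P × P') := LinearMap.inr A P P'
  LinearEquiv.ofLinearMap ((nakMap k f).prod (nakMap k g)) ((nakMap k i).coprod (nakMap k j))
    (by
      have h1 : nakMap k f ∘ₗ nakMap k i = LinearMap.id := rfl
      have h2 : nakMap k g ∘ₗ nakMap k j = LinearMap.id := rfl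
      have h3 : nakMap k f ∘ₗ nakMap k j = 0 := by
        rw [← nakMap_comp, ← nakMap_zero]; rfl
      have h4 : nakMap k g ∘ₗ nakMap k i = 0 := by
        rw [← nakMap_comp, ← nakMap_zero]; rfl
      refine LinearMap.ext fun x => Prod.ext ?_ ?_
      · have e1 := LinearMap.congr_fun h1 x.1
        have e2 := LinearMap.congr_fun h3 x.2
        simp only [LinearMap.comp_apply, LinearMap.id_apply, LinearMap.zero_apply] at e1 e2
        simp [e1, e2]
      · have e1 := LinearMap.congr_fun h4 x.1
        have e2 := LinearMap.congr_fun h2 x.2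
        simp only [LinearMap.comp_apply, LinearMap.id_apply, LinearMap.zero_apply] at e1 e2
        simp [e1, e2])
    (by
      have : nakMap k i ∘ₗ nakMap k f + nakMap k j ∘ₗ nakMap k g = LinearMap.id := by
        rw [← nakMap_comp, ← nakMap_comp, ← nakMap_add, ← nakMap_id]
        congr 1
        refine LinearMap.ext fun x => Prod.ext ?_ ?_ <;> simp [f, g, i, j]
      exact this)

variable [Module.Finite k A]

theorem finite_nakayama [Module.Finite A P] : Module.Finite A (nakayama k A P) :=
  have : Module.Finite k (P →ₗ[A] A) := finite_hom
  KDual.finite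

/-- A map between the duals is the transpose of a right-linear map `g` from `Hom(P', A)` to `Hom(P,
A)`. A dual basis `s i`, `r i 1` of `P'` shows that `g` is composition with `θ = ∑ g(s i) · r i 1`.
-/
theorem nakMap_surjective [Module.Finite A P] [Module.Finite A P'] [Module.Projective A P']
    (φ : nakayama k A P →ₗ[A] nakayama k A P') : ∃ θ : P →ₗ[A] P', φ = nakMap k θ := by
  have : Module.Finite k (P →ₗ[A] A) := finite_hom
  obtain ⟨g, hg, rfl⟩ := KDual.exists_eq_map φ
  obtain ⟨n, s, r, hsr⟩ := inAdd_iff.1 (inAdd_of_finite_projective (A := A) (Y := P'))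
  refine ⟨∑ i, LinearMap.toSpanSingleton A P' (r i 1) ∘ₗ g (s i), ?_⟩
  have key : ∀ h : P' →ₗ[A] A,
      h ∘ₗ (∑ i, LinearMap.toSpanSingleton A P' (r i 1) ∘ₗ g (s i)) = g h := by
    intro h
    -- Dual basis expansion in the right module `Hom(P', A)`.
    have e1 : h = ∑ i, MulOpposite.op (h (r i 1)) • s i := by
      ext x
      have := congrArg h (LinearMap.congr_fun hsr x)
      simp only [LinearMap.sum_apply, LinearMap.comp_apply, LinearMap.id_apply, map_sum] at this
      rw [← this, LinearMap.sum_apply]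
      refine Finset.sum_congr rfl fun i _ => ?_
      rw [LinearMap.smul_apply, MulOpposite.smul_eq_mul_unop, MulOpposite.unop_op,
        ← smul_eq_mul, ← map_smul, ← map_smul, smul_eq_mul, mul_one]
    conv_rhs => rw [e1, map_sum]
    ext x
    simp [hg]
  refine LinearMap.ext fun ξ => nak_ext fun h => ?_
  exact congrArg (nakForm ξ) (key h).symm

omit [Module.Finite k A] in
-- Forms separate the maps `P → A`, and maps to `A` separate the points of the projective module
-- `P'`.
theorem nakMap_injective [Module.Projective A P'] {θ θ' : P →ₗ[A] P'}
    (h : nakMap k θ = nakMap k θ') : θ = θ' := by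
  obtain ⟨s, hs⟩ := (Module.projective_def (R := A) (P := P')).1 inferInstance
  have key : ∀ f : P' →ₗ[A] A, f ∘ₗ θ = f ∘ₗ θ' := by
    intro f
    rw [← sub_eq_zero]
    refine hom_eq_zero_of_nakForm (k := k) fun ξ => ?_
    rw [map_sub, ← nakForm_map, ← nakForm_map, h, sub_self]
  ext x
  apply hs.injective
  ext p
  exact LinearMap.congr_fun (key (Finsupp.lapply p ∘ₗ s)) x

/-- A fully faithful functor reflects isomorphisms. -/
theorem nonempty_equiv_of_nakayama [Module.Finite A P] [Module.Finite A P'] [Module.Projective A P]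
    [Module.Projective A P'] (e : nakayama k A P ≃ₗ[A] nakayama k A P') :
    Nonempty (P ≃ₗ[A] P') := by
  obtain ⟨f, hf⟩ := nakMap_surjective e.toLinearMap
  obtain ⟨g, hg⟩ := nakMap_surjective e.symm.toLinearMap
  refine ⟨LinearEquiv.ofLinearMap f g ?_ ?_⟩
  · apply nakMap_injective (k := k)
    rw [nakMap_comp, ← hf, ← hg]
    ext; simp [nakMap_id]
  · apply nakMap_injective (k := k)
    rw [nakMap_comp, ← hf, ← hg]
    ext; simp [nakMap_id]

/-- Full faithfulness matches the idempotents of `P` with those of `ν P`. -/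
theorem IsIndec.nakayama [Module.Finite A P] [Module.Projective A P] (h : IsIndec A P) :
    IsIndec A (nakayama k A P) := by
  refine ⟨?_, fun e he => ?_⟩
  · rw [← not_subsingleton_iff_nontrivial]
    intro hs
    have : (LinearMap.id : P →ₗ[A] P) = 0 := nakMap_injective (k := k)
      (LinearMap.ext fun _ => Subsingleton.elim _ _)
    obtain ⟨x, hx⟩ := @exists_ne _ h.1 (0 : P)
    exact hx (LinearMap.congr_fun this x)
  · obtain ⟨θ, rfl⟩ := nakMap_surjective e
    rw [← nakMap_comp] at he
    rcases h.2 θ (nakMap_injective he) with rfl | rfl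
    · exact Or.inl nakMap_zero
    · exact Or.inr nakMap_id

end Nakayama

/-! ### Modules all of whose Nakayama iterates are projective. -/

section NuStable

variable {k A : Type u} [Field k] [Ring A] [Algebra k A] {P P' : ModuleCat.{u} A}

theorem IsNuStablyProjective.finite (h : IsNuStablyProjective k A P) : Module.Finite A P := h.1

theorem IsNuStablyProjective.projective (h : IsNuStablyProjective k A P) :
    Module.Projective A P := h.2 0

theorem isSummandOf_nakayama {ι : Type} [Fintype ι] {X : ι → ModuleCat.{u} A}
    (h : IsSummandOf (A := A) (fun i => X i) P) :
    IsSummandOf (A := A) (fun i => nakayama k A (X i)) (nakayama k A P) := by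
  obtain ⟨s, r, h⟩ := h
  refine ⟨fun i => nakMap k (s i), fun i => nakMap k (r i), ?_⟩
  rw [← nakMap_id, ← h, nakMap_sum]
  rfl

theorem isSummandOf_nakayama_iterate (n : ℕ) {ι : Type} [Fintype ι] {X : ι → ModuleCat.{u} A}
    (h : IsSummandOf (A := A) (fun i => X i) P) :
    IsSummandOf (A := A) (fun i => ((nakayama k A)^[n] (X i) : ModuleCat.{u} A))
      ((nakayama k A)^[n] P : ModuleCat.{u} A) := by
  induction n generalizing X P with
  | zero => exact h
  | succ n ih => exact ih (isSummandOf_nakayama h)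

theorem IsSummandOf.finite_projective {ι : Type} [Fintype ι] {X : ι → Type u}
    [∀ i, AddCommGroup (X i)] [∀ i, Module A (X i)] {Y : Type u} [AddCommGroup Y] [Module A Y]
    (h : IsSummandOf (A := A) X Y) (hX : ∀ i, Module.Finite A (X i) ∧ Module.Projective A (X i)) :
    Module.Finite A Y ∧ Module.Projective A Y := by
  have := h.inAdd (Z := A) fun i =>
    have := (hX i).1
    have := (hX i).2
    inAdd_of_finite_projective
  exact ⟨this.finite, this.projective⟩

variable [Module.Finite k A]

theorem finite_nakayama_iterate [Module.Finite A P] (n : ℕ) :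
    Module.Finite A ((nakayama k A)^[n] P : ModuleCat.{u} A) := by
  induction n with
  | zero => assumption
  | succ n ih =>
    rw [Function.iterate_succ_apply']
    exact finite_nakayama

theorem IsNuStablyProjective.nakayama (h : IsNuStablyProjective k A P) :
    IsNuStablyProjective k A (nakayama k A P) :=
  have := h.1
  ⟨finite_nakayama, fun i => h.2 (i + 1)⟩

theorem IsNuStablyProjective.iterate (h : IsNuStablyProjective k A P) (n : ℕ) :
    IsNuStablyProjective k A ((FrobFin.nakayama k A)^[n] P) := by
  induction n with
  | zero => exact h
  | succ n ih =>
    rw [Function.iterate_succ_apply']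
    exact ih.nakayama

theorem IsNuStablyProjective.of_summand {ι : Type} [Fintype ι] {X : ι → ModuleCat.{u} A}
    (hX : ∀ i, IsNuStablyProjective k A (X i)) (h : IsSummandOf (A := A) (fun i => X i) P) :
    IsNuStablyProjective k A P := by
  refine ⟨(h.finite_projective fun i => ⟨(hX i).1, (hX i).2 0⟩).1, fun n => ?_⟩
  exact ((isSummandOf_nakayama_iterate n h).finite_projective fun i =>
    have := (hX i).1
    ⟨finite_nakayama_iterate n, (hX i).2 n⟩).2

theorem IsNuStablyProjective.of_inAdd (h : IsNuStablyProjective k A P) (h' : InAdd A P P') :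
    IsNuStablyProjective k A P' :=
  let ⟨_, hn⟩ := h'.isSummandOf
  .of_summand (fun _ => h) hn

theorem IsNuStablyProjective.of_equiv (h : IsNuStablyProjective k A P) (e : P ≃ₗ[A] P') :
    IsNuStablyProjective k A P' :=
  h.of_inAdd (InAdd.of_equiv e.symm)

theorem IsNuStablyProjective.prod (h : IsNuStablyProjective k A P)
    (h' : IsNuStablyProjective k A P') : IsNuStablyProjective k A (ModuleCat.of A (P × P')) := by
  let X : Bool → ModuleCat.{u} A := fun b => if b then P else P'
  refine .of_summand (X := X) (fun b => by cases b <;> assumption)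
    ⟨fun b => match b with
      | true => LinearMap.fst A P P'
      | false => LinearMap.snd A P P', fun b => match b with
      | true => LinearMap.inl A P P'
      | false => LinearMap.inr A P P', ?_⟩
  rw [Fintype.sum_bool]
  refine LinearMap.ext fun x => Prod.ext ?_ ?_
  · exact add_zero x.1
  · exact zero_add x.2

omit [Module.Finite k A] in
/-- A class of finitely generated projective modules that is stable under the Nakayama functor
consists of `ν`-stably projective modules. -/
theorem IsNuStablyProjective.of_class (W : ModuleCat.{u} A → Prop)
    (hW : ∀ N, W N → Module.Finite A N ∧ Module.Projective A N)
    (hν : ∀ N, W N → ∃ N', W N' ∧ Nonempty (FrobFin.nakayama k A N ≃ₗ[A] N')) (hP : W P) :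
    IsNuStablyProjective k A P := by
  refine ⟨(hW P hP).1, fun n => ?_⟩
  -- The class is stable under `ν` only up to isomorphism, so the iterates are tracked up to
  -- isomorphism.
  suffices ∃ N', W N' ∧ Nonempty (((FrobFin.nakayama k A)^[n] P : ModuleCat.{u} A) ≃ₗ[A] N') by
    obtain ⟨N', h, ⟨e⟩⟩ := this
    have := (hW N' h).2
    exact Module.Projective.of_equiv e.symm
  induction n with
  | zero => exact ⟨P, hP, ⟨LinearEquiv.refl A P⟩⟩
  | succ n ih =>
    obtain ⟨N', h, ⟨e⟩⟩ := ih
    obtain ⟨N'', h', ⟨e'⟩⟩ := hν N' h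
    refine ⟨N'', h', ⟨?_⟩⟩
    rw [Function.iterate_succ_apply']
    exact (nakEquiv k e).trans e'

/-- A finite-dimensional algebra has finitely many indecomposable projective modules. -/
theorem exists_finite_indec_projective (A : Type u) [Ring A] [IsArtinianRing A] :
    ∃ (ι : Type) (_ : Finite ι) (N : ι → ModuleCat.{u} A), ∀ P : ModuleCat.{u} A,
      Module.Finite A P → Module.Projective A P → IsIndec A P → ∃ i, Nonempty (P ≃ₗ[A] N i) := by
  obtain ⟨ι, _, N, hN, ⟨f⟩⟩ := exists_indec_decomposition (ModuleCat.of A A)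
  refine ⟨ι, inferInstance, N, fun P _ _ hi => ?_⟩
  obtain ⟨n, hn⟩ := (inAdd_of_finite_projective (A := A) (Y := P)).isSummandOf
  obtain ⟨-, s, r, hsr⟩ := hi.exists_retract hn
  obtain ⟨i, t, w, htw⟩ := hi.exists_retract
    (isSummandOf_of_retract (isSummandOf_pi (A := A) (fun i => N i) f) s r hsr)
  have := hi.1
  exact ⟨i, (hN i).2.equiv_of_retract t w htw⟩

/-- One application of `ν` is cancelled at a time; stability keeps every intermediate module
projective, as this cancellation requires. -/
theorem nonempty_equiv_of_iterate (hP : IsNuStablyProjective k A P)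
    (hP' : IsNuStablyProjective k A P') (n : ℕ)
    (h : Nonempty (((FrobFin.nakayama k A)^[n] P : ModuleCat.{u} A) ≃ₗ[A]
      ((FrobFin.nakayama k A)^[n] P' : ModuleCat.{u} A))) : Nonempty (P ≃ₗ[A] P') := by
  induction n generalizing P P' with
  | zero => exact h
  | succ n ih =>
    obtain ⟨e⟩ := ih hP.nakayama hP'.nakayama h
    have := hP.1
    have := hP'.1
    have := hP.projective
    have := hP'.projective
    exact nonempty_equiv_of_nakayama e

theorem IsIndec.iterate (hP : IsNuStablyProjective k A P) (hi : IsIndec A P) (n : ℕ) :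
    IsIndec A ((FrobFin.nakayama k A)^[n] P : ModuleCat.{u} A) := by
  induction n with
  | zero => exact hi
  | succ n ih =>
    rw [Function.iterate_succ_apply']
    have := (hP.iterate n).1
    have := (hP.iterate n).projective
    exact ih.nakayama

/-- The Nakayama functor permutes the indecomposable `ν`-stably projective modules. -/
theorem IsNuStablyProjective.exists_period (hP : IsNuStablyProjective k A P) (hi : IsIndec A P) :
    ∃ n, Nonempty (((FrobFin.nakayama k A)^[n + 1] P : ModuleCat.{u} A) ≃ₗ[A] P) := by
  have : IsArtinianRing A := IsArtinianRing.of_finite k A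
  obtain ⟨ι, _, N, hN⟩ := exists_finite_indec_projective A
  choose c hc using fun n => hN _ (hP.iterate n).1 (hP.iterate n).projective (hi.iterate hP n)
  -- All iterates are indecomposable projective, and there are finitely many classes of those, so
  -- two iterates agree. Cancelling the common power of `ν` gives the period.
  obtain ⟨i, j, hij, h⟩ := Finite.exists_ne_map_eq_of_infinite c
  wlog hlt : i < j generalizing i j
  · exact this j i hij.symm h.symm (lt_of_le_of_ne (not_lt.1 hlt) hij.symm)
  obtain ⟨n, rfl⟩ := Nat.exists_eq_add_of_lt hlt
  have e : Nonempty (((FrobFin.nakayama k A)^[i + n + 1] P : ModuleCat.{u} A) ≃ₗ[A]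
      ((FrobFin.nakayama k A)^[i] P : ModuleCat.{u} A)) := by
    obtain ⟨e1⟩ := hc (i + n + 1)
    obtain ⟨e2⟩ := hc i
    rw [← h] at e1
    exact ⟨e1.trans e2.symm⟩
  rw [add_assoc, Function.iterate_add_apply] at e
  exact ⟨n, nonempty_equiv_of_iterate (hP.iterate (n + 1)) hP i e⟩

theorem IsNuStablyProjective.fst (h : IsNuStablyProjective k A (ModuleCat.of A (P × P'))) :
    IsNuStablyProjective k A P :=
  h.of_inAdd (InAdd.of_retract (LinearMap.inl A P P') (LinearMap.fst A P P') rfl)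

theorem IsNuStablyProjective.snd (h : IsNuStablyProjective k A (ModuleCat.of A (P × P'))) :
    IsNuStablyProjective k A P' :=
  h.of_inAdd (InAdd.of_retract (LinearMap.inr A P P') (LinearMap.snd A P P') rfl)

/-- Every `ν`-stably projective module is of the form `ν P'` with `P'` `ν`-stably projective. -/
theorem IsNuStablyProjective.exists_nakayama_equiv (hP : IsNuStablyProjective k A P) :
    ∃ P', IsNuStablyProjective k A P' ∧ Nonempty (FrobFin.nakayama k A P' ≃ₗ[A] P) := by
  have : IsArtinianRing A := IsArtinianRing.of_finite k A
  have := hP.1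
  revert hP
  refine indec_induction (𝒬 := fun P => IsNuStablyProjective k A P →
    ∃ P', IsNuStablyProjective k A P' ∧ Nonempty (FrobFin.nakayama k A P' ≃ₗ[A] P)) ?_ ?_ ?_ ?_ P
  · rintro X Y e h hY
    obtain ⟨P', h1, ⟨f⟩⟩ := h (hY.of_equiv e.symm)
    exact ⟨P', h1, ⟨f.trans e⟩⟩
  · intro X hX h
    have : Subsingleton (FrobFin.nakayama k A X) := by
      refine ⟨fun ξ η => nak_ext fun f => ?_⟩
      rw [show f = 0 from LinearMap.ext fun x => by rw [Subsingleton.elim x 0]; simp, map_zero,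
        map_zero]
    exact ⟨X, h, ⟨LinearEquiv.ofBijective (0 : _ →ₗ[A] X)
      ⟨fun _ _ _ => Subsingleton.elim _ _, fun y => ⟨0, Subsingleton.elim _ _⟩⟩⟩⟩
  · rintro X Y _ _ h1 h2 h
    obtain ⟨P1, hP1, ⟨e1⟩⟩ := h1 h.fst
    obtain ⟨P2, hP2, ⟨e2⟩⟩ := h2 h.snd
    exact ⟨_, hP1.prod hP2, ⟨(nakProd k P1 P2).trans (LinearEquiv.prodCongr e1 e2)⟩⟩
  · intro X _ hi h
    -- If `ν^(n+1) X ≅ X`, then `ν^n X` is the required preimage.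
    obtain ⟨n, hn⟩ := h.exists_period hi
    rw [Function.iterate_succ_apply'] at hn
    exact ⟨_, h.iterate n, hn⟩

end NuStable

/-! ### Modules over quotient rings. -/

section Descend

variable {R S : Type u} [Ring R] [Ring S] (φ : R →+* S)

/-- Restriction of scalars. -/
abbrev pullback (N : ModuleCat.{u} S) : ModuleCat.{u} R :=
  letI := Module.compHom N φ
  ModuleCat.of R N

variable (hφ : Function.Surjective φ) (N : ModuleCat.{u} R)
  (hN : ∀ r, φ r = 0 → ∀ x : N, r • x = 0)

include hN in
theorem smul_eq_of_map_eq {r s : R} (h : φ r = φ s) (x : N) : r • x = s • x := by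
  rw [← sub_eq_zero, ← sub_smul]
  exact hN _ (by rw [map_sub, h, sub_self]) x

/-- A module over `R` that is annihilated by the kernel of the surjection `R → S`, as a module
over `S`. -/
noncomputable abbrev descendModule : Module S N where
  smul s x := Function.surjInv hφ s • x
  one_smul x := by
    refine (smul_eq_of_map_eq φ N hN ?_ x).trans (one_smul R x)
    rw [Function.surjInv_eq hφ, map_one]
  mul_smul s t x := by
    refine (smul_eq_of_map_eq φ N hN ?_ x).trans (mul_smul _ _ x)
    rw [map_mul, Function.surjInv_eq hφ, Function.surjInv_eq hφ, Function.surjInv_eq hφ]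
  smul_zero s := smul_zero _
  smul_add s x y := smul_add _ x y
  add_smul s t x := by
    refine (smul_eq_of_map_eq φ N hN ?_ x).trans (add_smul _ _ x)
    rw [map_add, Function.surjInv_eq hφ, Function.surjInv_eq hφ, Function.surjInv_eq hφ]
  zero_smul x := by
    refine (smul_eq_of_map_eq φ N hN ?_ x).trans (zero_smul R x)
    rw [Function.surjInv_eq hφ, map_zero]

/-- The `S`-module `descendModule` as an object of the category of `S`-modules. -/
noncomputable def descend : ModuleCat.{u} S :=
  letI := descendModule φ hφ N hN
  ModuleCat.of S N

/-- The identity, from an `R`-module to the `S`-module it defines. -/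
noncomputable def toDescend : N ≃+ descend φ hφ N hN := AddEquiv.refl N

theorem toDescend_smul (r : R) (x : N) :
    toDescend φ hφ N hN (r • x) = φ r • toDescend φ hφ N hN x := by
  change r • x = Function.surjInv hφ (φ r) • x
  exact smul_eq_of_map_eq φ N hN (Function.surjInv_eq hφ (φ r)).symm x

theorem toDescend_symm_smul (r : R) (x : descend φ hφ N hN) :
    (toDescend φ hφ N hN).symm (φ r • x) = r • (toDescend φ hφ N hN).symm x := by
  rw [AddEquiv.symm_apply_eq, toDescend_smul, AddEquiv.apply_symm_apply]

theorem finite_descend [Module.Finite R N] : Module.Finite S (descend φ hφ N hN) := by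
  classical
  obtain ⟨s, hs⟩ := (inferInstance : Module.Finite R N).fg_top
  refine ⟨⟨s.image (toDescend φ hφ N hN), eq_top_iff.2 fun x _ => ?_⟩⟩
  obtain ⟨y, rfl⟩ := (toDescend φ hφ N hN).surjective x
  have : y ∈ Submodule.span R (s : Set N) := hs ▸ Submodule.mem_top
  induction this using Submodule.span_induction with
  | mem z hz => exact Submodule.subset_span (by simpa using hz)
  | zero => rw [map_zero]; exact zero_mem _
  | add z w _ _ hz hw => rw [map_add]; exact add_mem (hz trivial) (hw trivial)
  | smul r z _ hz => rw [toDescend_smul]; exact Submodule.smul_mem _ _ (hz trivial)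

/-- Finite decomposition into a list of modules lifts from quotient rings. -/
theorem IsListFinite.of_surjections {ι : Type} [Fintype ι] (S : ι → Type u) [∀ i, Ring (S i)]
    (φ : ∀ i, R →+* S i) (hφ : ∀ i, Function.Surjective (φ i)) (ε : ι → R)
    (hc : ∀ i r, ε i * r = r * ε i) (ho : ∀ i j, i ≠ j → ε i * ε j = 0) (hsum : ∑ i, ε i = 1)
    (hk : ∀ i r, φ i r = 0 → ε i * r = 0) (h : ∀ i, IsListFinite (S i)) : IsListFinite R := by
  classical
  choose n N hN using h
  let κ := Σ i, Fin (n i)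
  let M : κ → ModuleCat.{u} R := fun t => pullback (φ t.1) (N t.1 t.2)
  refine ⟨Fintype.card κ, fun j => M ((Fintype.equivFin κ).symm j), fun X _ => ?_⟩
  let m : ι → X →ₗ[R] X := fun i =>
    { toFun := fun x => ε i • x
      map_add' := fun x y => smul_add _ x y
      map_smul' := fun r x => by rw [RingHom.id_apply, ← mul_smul, hc, mul_smul] }
  -- Idempotency follows from orthogonality and from the sum being `1`.
  have hid : ∀ i, ε i * ε i = ε i := by
    intro i
    conv_rhs => rw [← mul_one (ε i), ← hsum, Finset.mul_sum, Finset.sum_eq_single i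
      (fun j _ hj => ho i j hj.symm) (by simp)]
  let Y : ι → ModuleCat.{u} R := fun i => ModuleCat.of R (LinearMap.range (m i))
  -- The kernel of `φ i` is killed by `ε i`, so the piece `ε i X` is a module over `S i` and
  -- decomposes there.
  have hY : ∀ i r, φ i r = 0 → ∀ x : Y i, r • x = 0 := by
    rintro i r hr ⟨_, x, rfl⟩
    refine Subtype.ext ?_
    change r • ε i • x = 0
    rw [← mul_smul, ← hc, hk i r hr, zero_smul]
  let e : X ≃ₗ[R] (∀ i, Y i) :=
    { toFun := fun x i => ⟨m i x, x, rfl⟩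
      map_add' := fun x y => funext fun i => Subtype.ext (map_add (m i) x y)
      map_smul' := fun r x => funext fun i => Subtype.ext (map_smul (m i) r x)
      invFun := fun y => ∑ i, (y i).1
      left_inv := fun x => by
        change ∑ i, ε i • x = x
        rw [← Finset.sum_smul, hsum, one_smul]
      right_inv := fun y => by
        funext i
        refine Subtype.ext ?_
        change ε i • ∑ j, (y j).1 = (y i).1
        rw [Finset.smul_sum, Finset.sum_eq_single i]
        · obtain ⟨x, hx⟩ := (y i).2
          rw [← hx]
          change ε i • ε i • x = ε i • x
          rw [← mul_smul, hid]
        · intro j _ hj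
          obtain ⟨x, hx⟩ := (y j).2
          rw [← hx]
          change ε i • ε j • x = 0
          rw [← mul_smul, ho i j hj.symm, zero_smul]
        · simp }
  have hfin : ∀ i, Module.Finite (S i) (descend (φ i) (hφ i) (Y i) (hY i)) := fun i =>
    have : Module.Finite R (Y i) := inferInstanceAs (Module.Finite R (LinearMap.range (m i)))
    finite_descend _ _ _ _
  choose τ hτ c f using fun i => hN i _ (hfin i)
  refine ⟨Σ i, τ i, inferInstance, fun t => Fintype.equivFin κ ⟨t.1, c t.1 t.2⟩, ⟨?_⟩⟩
  have g : ∀ i, Y i ≃ₗ[R] (∀ t : τ i, M ⟨i, c i t⟩) := fun i =>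
    { (toDescend (φ i) (hφ i) (Y i) (hY i)).trans (f i).some.toAddEquiv with
      map_smul' := fun r x => by
        change (f i).some (toDescend (φ i) (hφ i) (Y i) (hY i) (r • x)) = _
        rw [toDescend_smul, map_smul]
        rfl }
  have g' : (∀ i, Y i) ≃ₗ[R] (∀ t : Σ i, τ i, M ⟨t.1, c t.1 t.2⟩) :=
    (LinearEquiv.piCongrRight g).trans
      { toFun := fun x t => x t.1 t.2
        invFun := fun x i t => x ⟨i, t⟩
        left_inv := fun _ => rfl
        right_inv := fun _ => rfl
        map_add' := fun _ _ => rfl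
        map_smul' := fun _ _ => rfl }
  have key : ∀ a b : κ, a = b → Nonempty (M a ≃ₗ[R] M b) := by
    rintro a _ rfl
    exact ⟨LinearEquiv.refl R _⟩
  exact (e.trans g').trans (LinearEquiv.piCongrRight fun t =>
    (key _ _ (Equiv.symm_apply_apply (Fintype.equivFin κ) ⟨t.1, c t.1 t.2⟩).symm).some)

theorem IsListFinite.of_ringEquiv (e : R ≃+* S) (h : IsListFinite S) : IsListFinite R :=
  .of_surjections (ι := Unit) (fun _ => S) (fun _ => e.toRingHom) (fun _ => e.surjective)
    (fun _ => 1) (by simp) (by simp) (by simp)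
    (fun _ r hr => by
      have : e r = 0 := hr
      rw [(map_eq_zero_iff e e.injective).1 this, mul_zero]) fun _ => h

end Descend

/-! ### Modules of homomorphisms over endomorphism rings. -/

section HomFrom

/-- The group `Hom_R(W, X)`, as a left module over the opposite of a ring that acts on `W`. -/
def HomFrom (R W X : Type u) [Ring R] [AddCommGroup W] [Module R W] [AddCommGroup X]
    [Module R X] : Type u := W →ₗ[R] X

variable {R T W X Y : Type u} [Ring R] [Ring T] [AddCommGroup W] [Module R W] [AddCommGroup X]
  [Module R X] [AddCommGroup Y] [Module R Y]

instance : AddCommGroup (HomFrom R W X) := inferInstanceAs (AddCommGroup (W →ₗ[R] X))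

instance : FunLike (HomFrom R W X) W X := inferInstanceAs (FunLike (W →ₗ[R] X) W X)

/-- An element of `HomFrom` as a linear map. -/
def HomFrom.lin (g : HomFrom R W X) : W →ₗ[R] X := g

/-- A linear map as an element of `HomFrom`. -/
def HomFrom.mk (g : W →ₗ[R] X) : HomFrom R W X := g

theorem HomFrom.ext {g h : HomFrom R W X} (H : ∀ w, g w = h w) : g = h := LinearMap.ext H

theorem HomFrom.add_apply (g h : HomFrom R W X) (w : W) : (g + h) w = g w + h w := rfl

theorem HomFrom.map_add (g : HomFrom R W X) (v w : W) : g (v + w) = g v + g w :=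
  LinearMap.map_add g v w

theorem HomFrom.map_smul (g : HomFrom R W X) (r : R) (w : W) : g (r • w) = r • g w :=
  LinearMap.map_smul g r w

theorem HomFrom.map_sum (g : HomFrom R W X) {ι : Type*} (s : Finset ι) (w : ι → W) :
    g (∑ i ∈ s, w i) = ∑ i ∈ s, g (w i) :=
  _root_.map_sum g.lin w s

theorem HomFrom.sum_apply {ι : Type*} (s : Finset ι) (g : ι → HomFrom R W X) (w : W) :
    (∑ i ∈ s, g i) w = ∑ i ∈ s, g i w :=
  LinearMap.sum_apply s g w

section Action

variable [Module T W] [SMulCommClass R T W]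

instance : Module Tᵐᵒᵖ (HomFrom R W X) where
  smul t g :=
    { toFun := fun w => g (t.unop • w)
      map_add' := fun v w => by rw [smul_add]; exact LinearMap.map_add g _ _
      map_smul' := fun r w => by rw [← smul_comm]; exact LinearMap.map_smul g _ _ }
  one_smul g := HomFrom.ext fun w => congrArg g (one_smul T w)
  mul_smul s t g := HomFrom.ext fun w => congrArg g (mul_smul t.unop s.unop w)
  smul_zero _ := rfl
  smul_add _ _ _ := rfl
  add_smul s t g := HomFrom.ext fun w =>
    (congrArg g (add_smul s.unop t.unop w)).trans (LinearMap.map_add g _ _)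
  zero_smul g := HomFrom.ext fun w => (congrArg g (zero_smul T w)).trans (LinearMap.map_zero g)

theorem HomFrom.op_smul_apply (t : Tᵐᵒᵖ) (g : HomFrom R W X) (w : W) :
    (t • g) w = g (t.unop • w) := rfl

/-- Functoriality of `HomFrom`. -/
def HomFrom.map (T : Type u) [Ring T] [Module T W] [SMulCommClass R T W] (f : X →ₗ[R] Y) :
    HomFrom R W X →ₗ[Tᵐᵒᵖ] HomFrom R W Y where
  toFun g := HomFrom.mk (f ∘ₗ g.lin)
  map_add' g h := HomFrom.ext fun w => _root_.map_add f (g w) (h w)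
  map_smul' _ _ := rfl

theorem HomFrom.map_apply (f : X →ₗ[R] Y) (g : HomFrom R W X) (w : W) :
    HomFrom.map T f g w = f (g w) := rfl

/-- `HomFrom` respects isomorphisms. -/
def HomFrom.congr (T : Type u) [Ring T] [Module T W] [SMulCommClass R T W] (f : X ≃ₗ[R] Y) :
    HomFrom R W X ≃ₗ[Tᵐᵒᵖ] HomFrom R W Y :=
  LinearEquiv.ofLinearMap (HomFrom.map T f.toLinearMap) (HomFrom.map T f.symm.toLinearMap)
    (LinearMap.ext fun g => HomFrom.ext fun w => f.apply_symm_apply (g w))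
    (LinearMap.ext fun g => HomFrom.ext fun w => f.symm_apply_apply (g w))

/-- `HomFrom` respects products. -/
def HomFrom.pi (T : Type u) [Ring T] [Module T W] [SMulCommClass R T W] {ι : Type}
    (Z : ι → Type u) [∀ i, AddCommGroup (Z i)] [∀ i, Module R (Z i)] :
    HomFrom R W (∀ i, Z i) ≃ₗ[Tᵐᵒᵖ] (∀ i, HomFrom R W (Z i)) where
  toFun g i := HomFrom.mk (LinearMap.proj i ∘ₗ g.lin)
  invFun g := HomFrom.mk (LinearMap.pi fun i => (g i).lin)
  left_inv _ := rfl
  right_inv _ := rfl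
  map_add' _ _ := rfl
  map_smul' _ _ := rfl

end Action

section PostAction

variable [Module T X] [SMulCommClass R T X]

instance : Module T (HomFrom R W X) := inferInstanceAs (Module T (W →ₗ[R] X))

variable {S : Type u} [Ring S] [Module S W] [SMulCommClass R S W]

instance : SMulCommClass Sᵐᵒᵖ T (HomFrom R W X) := ⟨fun _ _ _ => rfl⟩

end PostAction

/-- Finite generation of `Hom` modules over finite-dimensional algebras. -/
theorem HomFrom.finite (k : Type u) [Field k] [Algebra k R] [Algebra k T] [Module T W]
    [SMulCommClass R T W] [Module k W] [IsScalarTower k R W] [IsScalarTower k T W]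
    [Module.Finite k R] [Module.Finite R W] [Module.Finite R X] :
    Module.Finite Tᵐᵒᵖ (HomFrom R W X) := by
  let _ : Module k X := Module.compHom X (algebraMap k R)
  have : IsScalarTower k R X := ⟨fun c r x => by
    rw [Algebra.smul_def, mul_smul]; rfl⟩
  have : Module.Finite k X := Module.Finite.trans R X
  have : Module.Finite k (W →ₗ[R] X) := finite_hom
  have : Module.Finite k (HomFrom R W X) := this
  have : IsScalarTower k Tᵐᵒᵖ (HomFrom R W X) := ⟨fun c t g => HomFrom.ext fun w => by
    change g ((c • t.unop) • w) = c • g (t.unop • w)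
    rw [smul_assoc, ← algebraMap_smul R c (t.unop • w), HomFrom.map_smul, algebraMap_smul]⟩
  exact Module.Finite.of_restrictScalars_finite k Tᵐᵒᵖ _

end HomFrom

/-! ### Passing from `End(Q)` to `End(P)` for `P` in `add(Q)`. -/

section Retract

variable {A P Q : Type u} [Ring A] [AddCommGroup P] [Module A P] [AddCommGroup Q] [Module A Q]

/-- If `P ∈ add(Q)`, then modules over `End(P)` are recovered from modules over `End(Q)`. -/
theorem exists_homFrom_equiv (h : InAdd A Q P) (X : Type u) [AddCommGroup X]
    [Module (Module.End A P)ᵐᵒᵖ X] :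
    Nonempty (X ≃ₗ[(Module.End A P)ᵐᵒᵖ] HomFrom (Module.End A Q)ᵐᵒᵖ (HomFrom A Q P)
      (HomFrom (Module.End A P)ᵐᵒᵖ (HomFrom A P Q) X)) := by
  obtain ⟨n, s, r, hsr⟩ := inAdd_iff.1 h
  -- The natural map takes `x` to the pairing `(g, h) ↦ (g ∘ h) · x` for `g : Q → P` and `h : P →
  -- Q`. It can be inverted because such composites sum to the identity of `P`.
  let F : X →ₗ[(Module.End A P)ᵐᵒᵖ] HomFrom (Module.End A Q)ᵐᵒᵖ (HomFrom A Q P)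
      (HomFrom (Module.End A P)ᵐᵒᵖ (HomFrom A P Q) X) :=
    { toFun := fun x => HomFrom.mk
        { toFun := fun g => HomFrom.mk
            { toFun := fun h => MulOpposite.op (g.lin ∘ₗ h.lin : Module.End A P) • x
              map_add' := fun h h' => by
                rw [← add_smul, ← MulOpposite.op_add]
                congr 2
                exact LinearMap.comp_add _ _ _
              map_smul' := fun a h => by
                rw [RingHom.id_apply, ← mul_smul]
                rfl }
          map_add' := fun g g' => HomFrom.ext fun h => by
            change MulOpposite.op ((g.lin + g'.lin) ∘ₗ h.lin : Module.End A P) • x =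
              MulOpposite.op (g.lin ∘ₗ h.lin : Module.End A P) • x +
              MulOpposite.op (g'.lin ∘ₗ h.lin : Module.End A P) • x
            rw [← add_smul, ← MulOpposite.op_add, LinearMap.add_comp]
          map_smul' := fun b g => HomFrom.ext fun h => rfl }
      map_add' := fun x y => HomFrom.ext fun g => HomFrom.ext fun h => smul_add _ x y
      map_smul' := fun a x => HomFrom.ext fun g => HomFrom.ext fun h => by
        change MulOpposite.op (g.lin ∘ₗ h.lin : Module.End A P) • a • x = _
        rw [← mul_smul]
        rfl }
  have hF : ∀ x g h, F x g h = MulOpposite.op (g.lin ∘ₗ h.lin : Module.End A P) • x :=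
    fun x g h => rfl
  have hleft : ∀ x, ∑ i, F x (HomFrom.mk (r i)) (HomFrom.mk (s i)) = x := fun x => by
    simp only [hF]
    rw [← Finset.sum_smul, ← Finset.op_sum]
    change MulOpposite.op (∑ i, r i ∘ₗ s i : Module.End A P) • x = x
    rw [hsr]
    exact one_smul _ x
  refine ⟨LinearEquiv.ofBijective F ⟨fun x y hxy => ?_, fun y => ?_⟩⟩
  · rw [← hleft x, ← hleft y, hxy]
  -- The linearity of `y` over `End(Q)` moves the factor `s i ∘ g` across, after which `∑ r i ∘ s i
  -- = 1` restores `g`.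
  · refine ⟨∑ i, y (HomFrom.mk (r i)) (HomFrom.mk (s i)), HomFrom.ext fun g =>
      HomFrom.ext fun h => ?_⟩
    rw [hF, Finset.smul_sum]
    have h1 : ∀ i, MulOpposite.op (g.lin ∘ₗ h.lin : Module.End A P) •
        y (HomFrom.mk (r i)) (HomFrom.mk (s i)) = y (HomFrom.mk (r i ∘ₗ s i ∘ₗ g.lin)) h := by
      intro i
      have h2 : (HomFrom.mk (r i ∘ₗ s i ∘ₗ g.lin) : HomFrom A Q P) =
        MulOpposite.op (s i ∘ₗ g.lin : Module.End A Q) • HomFrom.mk (r i) := rfl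
      rw [h2, HomFrom.map_smul y]
      exact (HomFrom.map_smul (y (HomFrom.mk (r i))) _ _).symm
    rw [Finset.sum_congr rfl fun i _ => h1 i, ← HomFrom.sum_apply, ← HomFrom.map_sum]
    congr 2
    refine HomFrom.ext fun w => ?_
    rw [HomFrom.sum_apply]
    have := LinearMap.congr_fun hsr (g w)
    rwa [LinearMap.sum_apply] at this

/-- Each module over `End(P)` has the form `Hom(Hom(Q, P), Y)` with `Y` finitely generated over
`End(Q)`. Decomposing `Y` decomposes it, since `Hom` commutes with finite products. -/
theorem IsListFinite.end_of_inAdd (k : Type u) [Field k] [Algebra k A] [Module.Finite k A]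
    [Module.Finite A P] [Module.Finite A Q] (h : InAdd A Q P)
    (hQ : IsListFinite (Module.End A Q)ᵐᵒᵖ) : IsListFinite (Module.End A P)ᵐᵒᵖ := by
  let _ : Module k P := Module.compHom P (algebraMap k A)
  let _ : Module k Q := Module.compHom Q (algebraMap k A)
  have : IsScalarTower k A P := ⟨fun c r x => by rw [Algebra.smul_def, mul_smul]; rfl⟩
  have : IsScalarTower k A Q := ⟨fun c r x => by rw [Algebra.smul_def, mul_smul]; rfl⟩
  have : Module.Finite k P := Module.Finite.trans A P
  have : Module.Finite k Q := Module.Finite.trans A Q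
  have : Module.Finite k (Module.End A P) := finite_hom
  have : Module.Finite k (HomFrom A P Q) := (finite_hom : Module.Finite k (P →ₗ[A] Q))
  have : IsScalarTower k (Module.End A P)ᵐᵒᵖ (HomFrom A P Q) := ⟨fun c t g => HomFrom.ext fun w => by
    change g ((c • t.unop) w) = c • g (t.unop w)
    rw [LinearMap.smul_apply, ← algebraMap_smul A c (t.unop w), HomFrom.map_smul, algebraMap_smul]⟩
  have : IsScalarTower k (Module.End A Q) (HomFrom A P Q) := ⟨fun c t g => rfl⟩
  have : Module.Finite (Module.End A P)ᵐᵒᵖ (HomFrom A P Q) :=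
    Module.Finite.of_restrictScalars_finite k _ _
  obtain ⟨n, N, hN⟩ := hQ
  refine ⟨n, fun i => ModuleCat.of _ (HomFrom (Module.End A Q)ᵐᵒᵖ (HomFrom A Q P) (N i)),
    fun X _ => ?_⟩
  obtain ⟨e⟩ := exists_homFrom_equiv h X
  have hfin : Module.Finite (Module.End A Q)ᵐᵒᵖ
    (HomFrom (Module.End A P)ᵐᵒᵖ (HomFrom A P Q) X) := HomFrom.finite k
  obtain ⟨ι, hι, c, ⟨f⟩⟩ := hN (ModuleCat.of _ (HomFrom (Module.End A P)ᵐᵒᵖ (HomFrom A P Q) X)) hfin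
  exact ⟨ι, hι, c, ⟨(e.trans (HomFrom.congr (Module.End A P) f)).trans
    (HomFrom.pi (Module.End A P) fun t => N (c t))⟩⟩

end Retract

/-! ### Frobenius-finiteness in terms of `ν`-stably projective modules. -/

section FrobeniusFinite

variable {k A : Type u} [Field k] [Ring A] [Algebra k A]

/-- The endomorphism algebra of `Ae` is `eAe`. -/
noncomputable def endSpanEquivCorner {e : A} (he : IsIdempotentElem e) :
    (Module.End A (Ideal.span {e}))ᵐᵒᵖ ≃+* he.Corner := by
  have hmem : e ∈ Ideal.span {e} := Ideal.subset_span rfl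
  have hmul : ∀ x : Ideal.span {e}, (x : A) * e = x := by
    rintro ⟨x, hx⟩
    obtain ⟨a, rfl⟩ := Ideal.mem_span_singleton'.1 hx
    change a * e * e = a * e
    rw [mul_assoc, he.eq]
  have hx : ∀ x : Ideal.span {e}, x = (x : A) • (⟨e, hmem⟩ : Ideal.span {e}) := fun x =>
    Subtype.ext (hmul x).symm
  have hemul : ∀ f : Module.End A (Ideal.span {e}), e * (f ⟨e, hmem⟩ : A) = f ⟨e, hmem⟩ := by
    intro f
    have : (⟨e, hmem⟩ : Ideal.span {e}) = e • ⟨e, hmem⟩ := Subtype.ext he.eq.symm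
    conv_rhs => rw [this, map_smul]
    rfl
  exact
    { toFun := fun f => ⟨f.unop ⟨e, hmem⟩,
        (Subsemigroup.mem_corner_iff he).2 ⟨hemul _, hmul _⟩⟩
      invFun := fun a => MulOpposite.op
        { toFun := fun x => ⟨x * a.1, by
            rw [← ((Subsemigroup.mem_corner_iff he).1 a.2).2, ← mul_assoc]
            exact Ideal.mul_mem_left _ _ hmem⟩
          map_add' := fun x y => Subtype.ext (add_mul _ _ _)
          map_smul' := fun b x => Subtype.ext (mul_assoc _ _ _) }
      left_inv := fun f => MulOpposite.unop_injective <| LinearMap.ext fun x => by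
        conv_rhs => rw [hx x, map_smul]
        rfl
      right_inv := fun a => Subtype.ext ((Subsemigroup.mem_corner_iff he).1 a.2).1
      map_add' := fun f g => rfl
      map_mul' := fun f g => Subtype.ext <| by
        have := congrArg g.unop (hx (f.unop ⟨e, hmem⟩))
        rw [map_smul] at this
        have h2 := congrArg Subtype.val this
        exact h2 }

theorem isArtinianRing_end (k : Type u) [Field k] [Algebra k A] [Module.Finite k A]
    (P : Type u) [AddCommGroup P] [Module A P] [Module.Finite A P] :
    IsArtinianRing (Module.End A P)ᵐᵒᵖ := by
  let _ : Module k P := Module.compHom P (algebraMap k A)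
  have : IsScalarTower k A P := ⟨fun c r x => by rw [Algebra.smul_def, mul_smul]; rfl⟩
  have : Module.Finite k P := Module.Finite.trans A P
  have : Module.Finite k (Module.End A P) := finite_hom
  exact IsArtinianRing.of_finite k _

/-- Every such `P` lies in `add(Ae)` and `End(Ae)` is the corner ring up to opposite, so finiteness
passes from the corner to `End(P)`. -/
theorem IsFrobeniusFinite.isListFinite (h : IsFrobeniusFinite k A) {P : ModuleCat.{u} A}
    (hP : IsNuStablyProjective k A P) : IsListFinite (Module.End A P)ᵐᵒᵖ := by
  obtain ⟨_, e, he, hr⟩ := h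
  have : Module.Finite A (Ideal.span {e}) := ⟨⟨{⟨e, Ideal.subset_span rfl⟩}, by
    rw [eq_top_iff]
    rintro ⟨x, hx⟩ -
    obtain ⟨a, rfl⟩ := Ideal.mem_span_singleton'.1 hx
    rw [Finset.coe_singleton]
    exact Submodule.mem_span_singleton.2 ⟨a, rfl⟩⟩⟩
  have := hP.1
  have : IsArtinianRing (Module.End A (Ideal.span {e}))ᵐᵒᵖ := isArtinianRing_end k _
  have : IsArtinianRing he.idem.Corner :=
    (endSpanEquivCorner he.idem).surjective.isArtinianRing
  exact .end_of_inAdd k ((he.add_eq P).2 hP)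
    (hr.isListFinite.of_ringEquiv (endSpanEquivCorner he.idem))

/-- The Frobenius part exists. -/
theorem exists_isFrobeniusIdempotent (k A : Type u) [Field k] [Ring A] [Algebra k A]
    [Module.Finite k A] : ∃ e : A, IsFrobeniusIdempotent k e := by
  classical
  have : IsArtinianRing A := IsArtinianRing.of_finite k A
  obtain ⟨ι, _, N, hN, ⟨f⟩⟩ := exists_indec_decomposition (ModuleCat.of A A)
  let f' : A ≃ₗ[A] (∀ i, N i) := f
  -- The idempotent is `p 1`, where `p` projects `A` onto those indecomposable summands that are
  -- `ν`-stably projective; `p` is right multiplication by `p 1`.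
  let S : Set ι := {i | IsNuStablyProjective k A (N i)}
  let q : (∀ i, N i) →ₗ[A] (∀ i, N i) :=
    { toFun := fun x i => if i ∈ S then x i else 0
      map_add' := fun x y => by ext i; by_cases h : i ∈ S <;> simp [h]
      map_smul' := fun a x => by ext i; by_cases h : i ∈ S <;> simp [h] }
  have hq : ∀ x i, q x i = if i ∈ S then x i else 0 := fun _ _ => rfl
  let p : A →ₗ[A] A := f'.symm.toLinearMap ∘ₗ q ∘ₗ f'.toLinearMap
  have hfp : ∀ a, f' (p a) = q (f' a) := fun a => by simp [p]
  have hp1 : ∀ a, p a = a * p 1 := fun a => by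
    conv_lhs => rw [← mul_one a, ← smul_eq_mul, map_smul]
    rfl
  have hpp : ∀ a, p (p a) = p a := fun a => f'.injective <| by
    ext i
    rw [hfp, hfp, hq, hq]
    split_ifs <;> rfl
  have he : IsIdempotentElem (p 1) := by
    have := hpp 1
    rwa [hp1 (p 1)] at this
  have hmem : ∀ x, x ∈ Ideal.span {p 1} ↔ p x = x := fun x => by
    rw [Ideal.mem_span_singleton']
    constructor
    · rintro ⟨a, rfl⟩
      rw [← hp1, hpp]
    · intro h
      exact ⟨x, by rw [← hp1, h]⟩
  let r : ∀ i, Ideal.span {p 1} →ₗ[A] N i := fun i =>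
    LinearMap.proj i ∘ₗ f'.toLinearMap ∘ₗ (Ideal.span {p 1}).subtype
  let s : ∀ i, i ∈ S → (N i →ₗ[A] Ideal.span {p 1}) := fun i hi =>
    (f'.symm.toLinearMap ∘ₗ LinearMap.single A (fun i => N i) i).codRestrict (Ideal.span {p 1})
      fun x => by
        rw [hmem]
        apply f'.injective
        rw [hfp]
        ext j
        rw [hq]
        by_cases hj : j = i
        · subst hj; simp [hi]
        · simp [hj]
  have hrs : ∀ i (hi : i ∈ S), r i ∘ₗ s i hi = LinearMap.id := fun i hi => by
    ext x; simp [r, s]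
  have hV : IsNuStablyProjective k A (ModuleCat.of A (Ideal.span {p 1})) := by
    refine .of_summand (ι := S) (X := fun i => N i) (fun i => i.2)
      ⟨fun i => r i, fun i => s i i.2, ?_⟩
    refine LinearMap.ext fun x => Subtype.ext (f'.injective ?_)
    ext j
    have hx := congrFun (congrArg f' ((hmem x).1 x.2)) j
    rw [hfp, hq] at hx
    rw [LinearMap.sum_apply, AddSubmonoidClass.coe_finsetSum, map_sum, Finset.sum_apply]
    have hterm : ∀ i : S, f' ((s i i.2 ∘ₗ r i) x).1 j =
        (Pi.single (M := fun i => (N i : Type u)) i.1 (f' x i.1)) j := fun i => by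
      simp [s, r]
    refine (Finset.sum_congr rfl fun i _ => hterm i).trans ?_
    refine Eq.trans ?_ hx
    split_ifs with hj
    · rw [Finset.sum_eq_single (⟨j, hj⟩ : S)]
      · simp
      · intro i _ hi
        rw [Pi.single_eq_of_ne]
        rintro rfl
        exact hi rfl
      · simp
    · refine Finset.sum_eq_zero fun i _ => ?_
      rw [Pi.single_eq_of_ne]
      rintro rfl
      exact hj i.2
  refine ⟨p 1, he, fun P => ⟨fun h => hV.of_inAdd h, fun h => ?_⟩⟩
  have := h.1
  revert h
  refine indec_induction (𝒬 := fun P => IsNuStablyProjective k A P →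
    InAdd A (Ideal.span {p 1}) P) ?_ ?_ ?_ ?_ P
  · rintro X Y e h hY
    exact (h (hY.of_equiv e.symm)).trans' e
  · intro X hX h
    exact InAdd.of_retract 0 0 (LinearMap.ext fun _ => Subsingleton.elim _ _)
  · rintro X Y _ _ h1 h2 h
    exact (h1 h.fst).prod (h2 h.snd)
  · intro X _ hi h
    have := h.projective
    -- An indecomposable projective is isomorphic to some `N i`, and stability is invariant under
    -- isomorphism, so `i` belongs to `S`.
    obtain ⟨n, hn⟩ := (inAdd_of_finite_projective (A := A) (Y := X)).isSummandOf
    obtain ⟨-, t, w, htw⟩ := hi.exists_retract hn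
    obtain ⟨i, t', w', htw'⟩ := hi.exists_retract (isSummandOf_of_retract
      (isSummandOf_pi (A := A) (fun i => N i) f') t w htw)
    have := hi.1
    obtain ⟨e⟩ := (hN i).2.equiv_of_retract t' w' htw'
    exact InAdd.trans (InAdd.of_equiv e) (InAdd.of_retract _ _ (hrs i (h.of_equiv e)))

/-- Only `P = Ae` is tested, so `P` may moreover be taken to generate all `ν`-stably projective
modules additively. -/
theorem isFrobeniusFinite_of_isListFinite [Module.Finite k A]
    (h : ∀ P : ModuleCat.{u} A, IsNuStablyProjective k A P →
      (∀ P', IsNuStablyProjective k A P' → InAdd A P P') →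
      IsListFinite (Module.End A P)ᵐᵒᵖ) : IsFrobeniusFinite k A := by
  obtain ⟨e, he⟩ := exists_isFrobeniusIdempotent k A
  refine ⟨inferInstance, e, he, IsListFinite.isRepresentationFinite ?_⟩
  exact IsListFinite.of_ringEquiv (endSpanEquivCorner he.idem).symm
    (h (ModuleCat.of A (Ideal.span {e})) ((he.add_eq _).1 InAdd.refl)
      fun P' hP' => (he.add_eq P').2 hP')

end FrobeniusFinite

/-! ### The Nakayama functor of a quotient algebra. -/

section Quotient

variable {k R S : Type u} [Field k] [Ring R] [Algebra k R] [Ring S] [Algebra k S] (π : R →ₐ[k] S)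
  (hπ : Function.Surjective π) (N : ModuleCat.{u} R)
  (hN : ∀ r, π.toRingHom r = 0 → ∀ x : N, r • x = 0)

/-- The endomorphisms of a module do not change if it is considered over a quotient ring. -/
noncomputable def endDescend :
    (Module.End R N)ᵐᵒᵖ ≃+* (Module.End S (descend π.toRingHom hπ N hN))ᵐᵒᵖ :=
  let τ := toDescend π.toRingHom hπ N hN
  RingEquiv.op
    { toFun := fun f =>
        { toFun := fun x => τ (f (τ.symm x))
          map_add' := fun x y => by rw [map_add, map_add, map_add]
          map_smul' := fun s x => by
            obtain ⟨r, rfl⟩ := hπ s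
            change τ (f (τ.symm (π.toRingHom r • x))) = π.toRingHom r • τ (f (τ.symm x))
            rw [toDescend_symm_smul, map_smul, toDescend_smul] }
      invFun := fun f =>
        { toFun := fun x => τ.symm (f (τ x))
          map_add' := fun x y => by rw [map_add, map_add, map_add]
          map_smul' := fun r x => by
            rw [toDescend_smul, map_smul, toDescend_symm_smul]
            rfl }
      left_inv := fun f => rfl
      right_inv := fun f => rfl
      map_mul' := fun f g => rfl
      map_add' := fun f g => rfl }

variable [Module.Finite R N] [Module.Projective R N]

/-- A dual basis over `R` becomes one over `S` when its coordinate maps are composed with `π`. -/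
theorem inAdd_descend : InAdd S S (descend π.toRingHom hπ N hN) := by
  obtain ⟨n, s, r, hsr⟩ := inAdd_iff.1 (inAdd_of_finite_projective (A := R) (Y := N))
  let τ := toDescend π.toRingHom hπ N hN
  refine InAdd.of_sum
    (fun i =>
      { toFun := fun x => π (s i (τ.symm x))
        map_add' := fun x y => by rw [map_add, map_add, map_add]
        map_smul' := fun t x => by
          obtain ⟨t, rfl⟩ := hπ t
          change π (s i (τ.symm (π.toRingHom t • x))) = _
          rw [toDescend_symm_smul, map_smul, smul_eq_mul, map_mul]
          rfl })
    (fun i => LinearMap.toSpanSingleton S _ (τ (r i 1))) ?_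
  refine LinearMap.ext fun x => ?_
  have h := congrArg τ (LinearMap.congr_fun hsr (τ.symm x))
  rw [LinearMap.sum_apply, map_sum] at h
  rw [LinearMap.sum_apply]
  refine Eq.trans (Finset.sum_congr rfl fun i _ => ?_) (h.trans (τ.apply_symm_apply x))
  change π.toRingHom (s i (τ.symm x)) • τ (r i 1) = τ (r i (s i (τ.symm x)))
  rw [← toDescend_smul, ← map_smul, smul_eq_mul, mul_one]

/-- The Nakayama functor of a quotient algebra on a module `N` such that both `N` and `ν N` are
modules over the quotient. -/
theorem nonempty_nakayama_descend
    (hN' : ∀ r, π.toRingHom r = 0 → ∀ x : nakayama k R N, r • x = 0) :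
    Nonempty (nakayama k S (descend π.toRingHom hπ N hN) ≃ₗ[S]
      descend π.toRingHom hπ (nakayama k R N) hN') := by
  obtain ⟨n, s, r, hsr⟩ := inAdd_iff.1 (inAdd_of_finite_projective (A := R) (Y := N))
  have hx : ∀ x : N, ∑ i, s i x • r i 1 = x := fun x => by
    have := LinearMap.congr_fun hsr x
    rw [LinearMap.sum_apply] at this
    refine Eq.trans (Finset.sum_congr rfl fun i _ => ?_) this
    rw [LinearMap.comp_apply, ← map_smul, smul_eq_mul, mul_one]
  let τ := toDescend π.toRingHom hπ N hN
  -- Reduction modulo the kernel of `π`. Once it is bijective, its transpose is the desired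
  -- isomorphism of Nakayama transforms.
  let γ : (N →ₗ[R] R) →ₗ[k] (descend π.toRingHom hπ N hN →ₗ[S] S) :=
    { toFun := fun f =>
        { toFun := fun x => π (f (τ.symm x))
          map_add' := fun x y => by rw [map_add, map_add, map_add]
          map_smul' := fun t x => by
            obtain ⟨t, rfl⟩ := hπ t
            change π (f (τ.symm (π.toRingHom t • x))) = _
            rw [toDescend_symm_smul, map_smul, smul_eq_mul, map_mul]
            rfl }
      map_add' := fun f g => LinearMap.ext fun x => map_add π _ _
      map_smul' := fun c f => LinearMap.ext fun x => map_smul π c _ }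
  have hγ : ∀ f x, γ f (τ x) = π (f x) := fun f x => rfl
  have hγi : Function.Injective γ := by
    rw [injective_iff_map_eq_zero]
    intro f hf
    have h1 : ∀ x, π (f x) = 0 := fun x => by rw [← hγ, hf]; rfl
    ext x
    -- Here `f` takes values in `ker π`, which annihilates `ν N`. Every form thus vanishes on `s i ·
    -- f(r i 1)`, and these products make up `f` by the dual basis.
    have h2 : ∀ i, (MulOpposite.op (f (r i 1)) • s i : N →ₗ[R] R) = 0 := fun i =>
      hom_eq_zero_of_nakForm (k := k) fun ξ => by
        rw [← nakForm_smul, hN' _ (h1 _) ξ, nakForm_zero]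
    have h3 : ∀ i, s i x * f (r i 1) = 0 := fun i => LinearMap.congr_fun (h2 i) x
    rw [← hx x, map_sum]
    simp [h3]
  have hγs : Function.Surjective γ := by
    intro g
    -- A preimage is obtained by lifting the values of `g` on the dual basis.
    choose t ht using fun i => hπ (g (τ (r i 1)))
    refine ⟨∑ i, MulOpposite.op (t i) • s i, LinearMap.ext fun x => ?_⟩
    obtain ⟨x, rfl⟩ := τ.surjective x
    rw [hγ, LinearMap.sum_apply, map_sum]
    have : τ x = ∑ i, π.toRingHom (s i x) • τ (r i 1) := by
      conv_lhs => rw [← hx x, map_sum]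
      exact Finset.sum_congr rfl fun i _ => toDescend_smul _ _ _ _ _ _
    rw [this, map_sum]
    refine Finset.sum_congr rfl fun i _ => ?_
    rw [map_smul, ← ht]
    exact map_mul π _ _
  let G := LinearEquiv.ofBijective γ ⟨hγi, hγs⟩
  let F : nakayama k S (descend π.toRingHom hπ N hN) →ₗ[S]
      descend π.toRingHom hπ (nakayama k R N) hN' :=
    { toFun := fun ξ => toDescend π.toRingHom hπ (nakayama k R N) hN' (nakMk (nakForm ξ ∘ₗ γ))
      map_add' := fun ξ η => rfl
      map_smul' := fun t ξ => by
        obtain ⟨t, rfl⟩ := hπ t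
        refine Eq.trans ?_ (toDescend_smul π.toRingHom hπ (nakayama k R N) hN' t _)
        refine congrArg _ (nak_ext fun f => ?_)
        change nakForm (π t • ξ) (γ f) = nakForm ξ (γ (MulOpposite.op t • f))
        rw [nakForm_smul]
        congr 1
        exact LinearMap.ext fun x => (map_mul π _ _).symm }
  refine ⟨LinearEquiv.ofBijective F ⟨fun ξ η h => ?_, fun ξ => ?_⟩⟩
  · have h' := (toDescend π.toRingHom hπ (nakayama k R N) hN').injective h
    refine nak_ext fun f => ?_
    obtain ⟨f, rfl⟩ := hγs f
    exact congrArg (fun ζ => nakForm ζ f) h'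
  · obtain ⟨ξ, rfl⟩ := (toDescend π.toRingHom hπ (nakayama k R N) hN').surjective ξ
    refine ⟨nakMk (nakForm ξ ∘ₗ G.symm.toLinearMap),
      congrArg (toDescend π.toRingHom hπ (nakayama k R N) hN') (nak_ext fun f => ?_)⟩
    change nakForm ξ (G.symm (G f)) = nakForm ξ f
    rw [LinearEquiv.symm_apply_apply]

end Quotient

/-! ### Transfer of Frobenius-finiteness from quotient algebras. -/

section Transfer

variable {k R : Type u} [Field k] [Ring R] [Algebra k R] [Module.Finite k R]

/-- If the `ν`-stably projective modules of an algebra `R` decompose, compatibly with the Nakayama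
functor, into modules over Frobenius-finite quotient algebras, then `R` is Frobenius-finite. -/
theorem IsFrobeniusFinite.of_quotients {ι : Type} [Fintype ι] (c : ι → R)
    (hsum : ∀ P : ModuleCat.{u} R, IsNuStablyProjective k R P → ∀ p : P, ∑ i, c i • p = p)
    (hcomm : ∀ P : ModuleCat.{u} R, IsNuStablyProjective k R P →
      ∀ i (r : R) (p : P), c i • r • p = r • c i • p)
    (horth : ∀ P : ModuleCat.{u} R, IsNuStablyProjective k R P →
      ∀ i j, i ≠ j → ∀ p : P, c i • c j • p = 0)
    (hdual : ∀ P : ModuleCat.{u} R, IsNuStablyProjective k R P →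
      ∀ i j, i ≠ j → ∀ (f : P →ₗ[R] R) (p : P), f (c i • p) * c j = 0)
    (hquot : ∀ i, ∃ (S : Type u) (_ : Ring S) (_ : Algebra k S) (π : R →ₐ[k] S),
      Function.Surjective π ∧ IsFrobeniusFinite k S ∧
      ∀ P : ModuleCat.{u} R, IsNuStablyProjective k R P → ∀ r, π r = 0 →
        ∀ p : P, c i • r • p = 0) : IsFrobeniusFinite k R := by
  classical
  refine isFrobeniusFinite_of_isListFinite fun P hP _ => ?_
  have key : ∀ i (N : ModuleCat.{u} R), IsNuStablyProjective k R N → (∀ x : N, c i • x = x) →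
      IsListFinite (Module.End R N)ᵐᵒᵖ := by
    intro i N hNV hNi
    obtain ⟨S, _, _, π, hπ, hS, hker⟩ := hquot i
    have hkill : ∀ N : ModuleCat.{u} R, IsNuStablyProjective k R N → (∀ x : N, c i • x = x) →
        ∀ r, π.toRingHom r = 0 → ∀ x : N, r • x = 0 := by
      intro N hNV hNi r hr x
      rw [← hNi x, ← hcomm N hNV]
      exact hker N hNV r hr x
    -- `c j` acts on `ν N` through `f ↦ f · c j`, which is zero for `j ≠ i` by `hdual`. As the `c j`
    -- sum to the identity on `ν N`, only `c i` remains.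
    have hν : ∀ N : ModuleCat.{u} R, IsNuStablyProjective k R N → (∀ x : N, c i • x = x) →
        ∀ x : nakayama k R N, c i • x = x := by
      intro N hNV hNi ξ
      have h0 : ∀ j, j ≠ i → c j • ξ = 0 := fun j hj => by
        refine nak_ext fun f => ?_
        rw [nakForm_smul, nakForm_zero]
        have : (MulOpposite.op (c j) • f : N →ₗ[R] R) = 0 := by
          refine LinearMap.ext fun x => ?_
          change f x * c j = 0
          rw [← hNi x, hdual N hNV i j hj.symm]
        rw [this, map_zero]
      have h1 := hsum _ hNV.nakayama ξ
      rwa [Finset.sum_eq_single i (fun j _ hj => h0 j hj) (by simp)] at h1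
    have hV : IsNuStablyProjective k S (descend π.toRingHom hπ N (hkill N hNV hNi)) := by
      -- The descents of the `ν`-stably projective modules on which `c i` is the identity form a
      -- class of projective `S`-modules closed under `ν_S`.
      refine .of_class (fun M => ∃ (N : ModuleCat.{u} R) (h1 : IsNuStablyProjective k R N)
        (h2 : ∀ x : N, c i • x = x),
        Nonempty (M ≃ₗ[S] descend π.toRingHom hπ N (hkill N h1 h2))) ?_ ?_
        ⟨N, hNV, hNi, ⟨LinearEquiv.refl S _⟩⟩
      · rintro M ⟨N, h1, h2, ⟨e⟩⟩
        have := h1.1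
        have := h1.projective
        have := (inAdd_descend π hπ N (hkill N h1 h2)).trans' e.symm
        exact ⟨this.finite, this.projective⟩
      · rintro M ⟨N, h1, h2, ⟨e⟩⟩
        have := h1.1
        have := h1.projective
        obtain ⟨e'⟩ := nonempty_nakayama_descend π hπ N (hkill N h1 h2)
          (hkill _ h1.nakayama (hν N h1 h2))
        exact ⟨_, ⟨_, h1.nakayama, hν N h1 h2, ⟨LinearEquiv.refl S _⟩⟩,
          ⟨(nakEquiv k e).trans e'⟩⟩
    exact (hS.isListFinite hV).of_ringEquiv (endDescend π hπ N (hkill N hNV hNi))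
  let m : ι → P →ₗ[R] P := fun i =>
    { toFun := fun x => c i • x
      map_add' := fun x y => smul_add _ x y
      map_smul' := fun r x => hcomm P hP i r x }
  have hm : ∀ i x, m i x = c i • x := fun _ _ => rfl
  have hmm : ∀ i x, m i (m i x) = m i x := fun i x => by
    have := hsum P hP (c i • x)
    rwa [Finset.sum_eq_single i (fun j _ hj => horth P hP j i hj x) (by simp)] at this
  let X : ι → ModuleCat.{u} R := fun i => ModuleCat.of R (LinearMap.range (m i))
  let σ : ∀ i, X i →ₗ[R] P := fun i => (LinearMap.range (m i)).subtype
  let ρ : ∀ i, P →ₗ[R] X i := fun i => (m i).rangeRestrict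
  have hρσ : ∀ i x, ρ i (σ i x) = x := by
    rintro i ⟨_, x, rfl⟩
    exact Subtype.ext (hmm i x)
  have hσρ : ∀ i x, σ i (ρ i x) = c i • x := fun i x => rfl
  have hcσ : ∀ i (x : X i), c i • σ i x = σ i x := fun i x => by
    rw [← hσρ, hρσ]
  -- The `m i` are central orthogonal idempotents of `End(P)` with sum one, and compression to `X i
  -- = c i P` maps `End(P)` onto `End(X i)`.
  refine .of_surjections (fun i => (Module.End R (X i))ᵐᵒᵖ)
    (fun i => RingHom.op
      { toFun := fun f => ρ i ∘ₗ f ∘ₗ σ i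
        map_one' := LinearMap.ext fun x => hρσ i x
        map_mul' := fun f g => LinearMap.ext fun x => by
          change ρ i (f (g (σ i x))) = ρ i (f (σ i (ρ i (g (σ i x)))))
          rw [hσρ, ← map_smul, hcσ]
        map_zero' := LinearMap.ext fun x => map_zero (ρ i)
        map_add' := fun f g => LinearMap.ext fun x => map_add (ρ i) _ _ })
    (fun i g => ⟨MulOpposite.op (σ i ∘ₗ g.unop ∘ₗ ρ i), MulOpposite.unop_injective <|
      LinearMap.ext fun x => by
        change ρ i (σ i (g.unop (ρ i (σ i x)))) = g.unop x
        rw [hρσ, hρσ]⟩)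
    (fun i => MulOpposite.op (m i))
    (fun i f => MulOpposite.unop_injective <| LinearMap.ext fun x => map_smul f.unop (c i) x)
    (fun i j hij => MulOpposite.unop_injective <| LinearMap.ext fun x => horth P hP j i hij.symm x)
    (MulOpposite.unop_injective ?_) (fun i f hf => MulOpposite.unop_injective <|
      LinearMap.ext fun x => ?_) fun i => key i (X i) ?_ ?_
  · rw [← Finset.op_sum]
    refine LinearMap.ext fun x => ?_
    rw [MulOpposite.unop_op, LinearMap.sum_apply]
    exact hsum P hP x
  · change f.unop (c i • x) = 0
    have h1 : ∀ y, ρ i (f.unop (σ i y)) = 0 := fun y =>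
      LinearMap.congr_fun (congrArg MulOpposite.unop hf) y
    rw [← hm, ← hmm i x, hm, hm, map_smul, ← hσρ i x, ← hσρ, h1, map_zero]
  · exact hP.of_inAdd (InAdd.of_retract (σ i) (ρ i) (LinearMap.ext (hρσ i)))
  · exact fun x => Subtype.ext (hcσ i x)

/-- The case of a single piece with `c = 1`: an ideal that kills all `ν`-stably projective modules
may be factored out. -/
theorem IsFrobeniusFinite.of_quotient {S : Type u} [Ring S] [Algebra k S] (π : R →ₐ[k] S)
    (hπ : Function.Surjective π) (hS : IsFrobeniusFinite k S)
    (h : ∀ P : ModuleCat.{u} R, IsNuStablyProjective k R P → ∀ r, π r = 0 → ∀ p : P, r • p = 0) :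
    IsFrobeniusFinite k R :=
  .of_quotients (ι := Unit) (fun _ => 1) (by simp) (by simp) (by simp) (by simp)
    fun _ => ⟨S, _, _, π, hπ, hS, by simpa using h⟩

omit [Module.Finite k R] in
theorem IsFrobeniusFinite.of_algEquiv {S : Type u} [Ring S] [Algebra k S] (e : R ≃ₐ[k] S)
    (hS : IsFrobeniusFinite k S) : IsFrobeniusFinite k R := by
  have := hS.1
  have : Module.Finite k R := Module.Finite.equiv e.symm.toLinearEquiv
  refine .of_quotient e.toAlgHom e.surjective hS fun P _ r hr p => ?_
  have hr' : e r = 0 := hr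
  rw [(map_eq_zero_iff e e.injective).1 hr', zero_smul]

end Transfer

/-! ### Algebras triangular with respect to orthogonal idempotents. -/

section Triangular

variable {k R : Type u} [Field k] [Ring R] [Algebra k R] {m : ℕ}

/-- The properties of the indecomposable summands of the projective module `R e_i` over a
triangular algebra that determine `i`. -/
structure HasType (e : Fin m → R) (P : ModuleCat.{u} R) (i : Fin m) : Prop where
  smul_eq_zero : ∀ j < i, ∀ p : P, e j • p = 0
  mul_eq_zero : ∀ j, i < j → ∀ (f : P →ₗ[R] R) (p : P), f p * e j = 0
  exists_ne : ∃ p : P, e i • p ≠ 0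

variable {e : Fin m → R}

/-- An indecomposable projective is a retract of some `R e_i`, hence generated by one element fixed
by `e_i`. Both vanishing statements follow from `e_a R e_b = 0` for `a < b`. -/
theorem exists_hasType [IsArtinianRing R] (he : ∀ i, e i * e i = e i)
    (hsum : ∑ i, e i = 1) (ht : ∀ i j, i < j → ∀ r, e i * r * e j = 0) (P : ModuleCat.{u} R)
    [Module.Finite R P] [Module.Projective R P] (hi : IsIndec R P) : ∃ i, HasType e P i := by
  let s : ∀ i, R →ₗ[R] Ideal.span {e i} := fun i =>
    LinearMap.toSpanSingleton R _ ⟨e i, Ideal.subset_span rfl⟩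
  have hR : IsSummandOf (A := R) (fun i => Ideal.span {e i}) R := by
    refine ⟨s, fun i => (Ideal.span {e i}).subtype, ?_⟩
    ext
    simp [s, hsum]
  obtain ⟨n, hn⟩ := (inAdd_of_finite_projective (A := R) (Y := P)).isSummandOf
  obtain ⟨-, t, w, htw⟩ := hi.exists_retract hn
  obtain ⟨i, t', w', htw'⟩ := hi.exists_retract (isSummandOf_of_retract hR t w htw)
  have hmul : ∀ x : Ideal.span {e i}, (x : R) * e i = x := by
    rintro ⟨x, hx⟩
    obtain ⟨a, rfl⟩ := Ideal.mem_span_singleton'.1 hx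
    change a * e i * e i = a * e i
    rw [mul_assoc, he]
  let z : Ideal.span {e i} := ⟨e i, Ideal.subset_span rfl⟩
  have hz : e i • w' z = w' z := by
    rw [← map_smul]
    exact congrArg w' (Subtype.ext (he i))
  have hp : ∀ p, p = (t' p : R) • w' z := fun p => by
    rw [← map_smul]
    conv_lhs => rw [← LinearMap.id_apply (R := R) p, ← htw']
    exact congrArg w' (Subtype.ext (hmul _).symm)
  refine ⟨i, fun j hj p => ?_, fun j hj f p => ?_, ⟨w' z, fun h => ?_⟩⟩
  · rw [hp p, ← hmul, ← mul_smul, ← mul_assoc, ht j i hj, zero_smul]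
  · rw [hp p, ← hz, map_smul, map_smul, smul_eq_mul, smul_eq_mul, mul_assoc, ht i j hj, mul_zero]
  · obtain ⟨p, hp0⟩ := @_root_.exists_ne _ hi.1 (0 : P)
    apply hp0
    rw [hp p, ← hz, h, smul_zero]

/-- For `j > i`, `e_j` acts on `ν P` through `Hom(P, R) e_j`, which is zero. -/
theorem HasType.nakayama_le {P : ModuleCat.{u} R} {i j : Fin m} (h : HasType e P i)
    (h' : HasType e (nakayama k R P) j) : j ≤ i := by
  by_contra! hij
  obtain ⟨ξ, hξ⟩ := h'.exists_ne
  refine hξ (nak_ext fun f => ?_)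
  have : (MulOpposite.op (e j) • f : P →ₗ[R] R) = 0 :=
    LinearMap.ext fun x => h.mul_eq_zero j hij f x
  rw [nakForm_smul, this, map_zero, nakForm_zero]

/-- Algebras that are triangular with respect to orthogonal idempotents and whose diagonal
algebras are Frobenius-finite are Frobenius-finite. -/
theorem IsFrobeniusFinite.of_triangular [Module.Finite k R] (e : Fin m → R)
    (he : ∀ i, e i * e i = e i) (horth : ∀ i j, i ≠ j → e i * e j = 0)
    (hsum : ∑ i, e i = 1) (ht : ∀ i j, i < j → ∀ r, e i * r * e j = 0)
    (hquot : ∀ i, ∃ (S : Type u) (_ : Ring S) (_ : Algebra k S) (π : R →ₐ[k] S),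
      Function.Surjective π ∧ IsFrobeniusFinite k S ∧ ∀ r, π r = 0 → e i * r * e i = 0) :
    IsFrobeniusFinite k R := by
  have : IsArtinianRing R := IsArtinianRing.of_finite k R
  -- Both `P` and `Hom(P, R)` have no off-diagonal part. The indecomposable case follows the types
  -- along the iterates of `ν`.
  have key : ∀ P : ModuleCat.{u} R, IsNuStablyProjective k R P →
      (∀ a b, a ≠ b → ∀ (r : R) (p : P), e a • r • e b • p = 0) ∧
      (∀ a b, a ≠ b → ∀ (f : P →ₗ[R] R) (p : P), e a * f p * e b = 0) := by
    intro P hP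
    have := hP.1
    revert hP
    refine indec_induction (𝒬 := fun P => IsNuStablyProjective k R P →
      (∀ a b, a ≠ b → ∀ (r : R) (p : P), e a • r • e b • p = 0) ∧
      (∀ a b, a ≠ b → ∀ (f : P →ₗ[R] R) (p : P), e a * f p * e b = 0)) ?_ ?_ ?_ ?_ P
    · rintro X Y g h hY
      obtain ⟨h1, h2⟩ := h (hY.of_equiv g.symm)
      refine ⟨fun a b hab r p => g.symm.injective ?_, fun a b hab f p => ?_⟩
      · simp only [map_smul, map_zero]
        exact h1 a b hab r _
      · have := h2 a b hab (f ∘ₗ g.toLinearMap) (g.symm p)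
        simpa using this
    · intro X hX h
      refine ⟨fun a b hab r p => Subsingleton.elim _ _, fun a b hab f p => ?_⟩
      rw [Subsingleton.elim p 0, map_zero, mul_zero, zero_mul]
    · rintro X Y _ _ h1 h2 h
      obtain ⟨h1, h1'⟩ := h1 h.fst
      obtain ⟨h2, h2'⟩ := h2 h.snd
      refine ⟨fun a b hab r p => Prod.ext (h1 a b hab r p.1) (h2 a b hab r p.2),
        fun a b hab f p => ?_⟩
      have e1 : p = LinearMap.inl R X Y p.1 + LinearMap.inr R X Y p.2 :=
        Prod.ext (add_zero _).symm (zero_add _).symm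
      have e2 := h1' a b hab (f ∘ₗ LinearMap.inl R X Y) p.1
      have e3 := h2' a b hab (f ∘ₗ LinearMap.inr R X Y) p.2
      rw [LinearMap.comp_apply] at e2 e3
      rw [e1, map_add, mul_add, add_mul]
      exact (congrArg₂ _ e2 e3).trans (add_zero 0)
    · intro X _ hi h
      choose t ht using fun n =>
        have := (h.iterate n).1
        have := (h.iterate n).projective
        exists_hasType he hsum ht _ (hi.iterate h n)
      have hle : ∀ n, t (n + 1) ≤ t n := fun n => by
        have h1 := ht (n + 1)
        rw [Function.iterate_succ_apply'] at h1
        exact (ht n).nakayama_le h1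
      have hanti : Antitone t := antitone_nat_of_succ_le hle
      obtain ⟨N, ⟨g⟩⟩ := h.exists_period hi
      -- If the type had dropped, `e_{t(N+1)}` would kill `X`, yet it does not kill `ν^(N+1) X ≅ X`.
      have h0 : t 0 ≤ t (N + 1) := by
        by_contra! hlt
        obtain ⟨p, hp⟩ := (ht (N + 1)).exists_ne
        apply hp
        apply g.injective
        rw [map_smul, map_zero]
        exact (ht 0).smul_eq_zero _ hlt _
      have h1 : t 1 = t 0 := le_antisymm (hle 0) (h0.trans (hanti (by omega)))
      have hs : ∀ j, j ≠ t 0 → ∀ p : X, e j • p = 0 := by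
        intro j hj p
        rcases lt_or_gt_of_ne hj with hj | hj
        · exact (ht 0).smul_eq_zero j hj p
        -- For `j` above the type, `X` is viewed as `ν` of `ν^N X`; the type of the latter is at
        -- most `t 0`, so its maps to `R` are killed by `e_j`.
        · rw [Function.iterate_succ_apply'] at g
          obtain ⟨ξ, rfl⟩ := g.surjective p
          rw [← map_smul]
          convert map_zero g
          refine nak_ext fun f => ?_
          have : (MulOpposite.op (e j) • f : _ →ₗ[R] R) = 0 := LinearMap.ext fun x =>
            (ht N).mul_eq_zero j ((hanti (Nat.zero_le N)).trans_lt hj) f x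
          rw [nakForm_smul, this, map_zero, nakForm_zero]
      have hm : ∀ j, j ≠ t 0 → ∀ (f : X →ₗ[R] R) (p : X), f p * e j = 0 := by
        intro j hj f p
        rcases lt_or_gt_of_ne hj with hj | hj
        -- For `j` below the type, `ν X` has the same type as `X`, so `e_j` kills `ν X`; as forms
        -- separate maps, `f · e_j = 0`.
        · have : (MulOpposite.op (e j) • f : X →ₗ[R] R) = 0 :=
            hom_eq_zero_of_nakForm (k := k) fun ξ => by
              have h2 := (ht 1).smul_eq_zero j (h1 ▸ hj) ξ
              rw [← nakForm_smul]
              exact (congrArg (fun η => nakForm η f) h2).trans (nakForm_zero f)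
          exact LinearMap.congr_fun this p
        · exact (ht 0).mul_eq_zero j hj f p
      refine ⟨fun a b hab r p => ?_, fun a b hab f p => ?_⟩
      · by_cases hb : b = t 0
        · exact hs a (fun ha => hab (ha.trans hb.symm)) _
        · rw [hs b hb, smul_zero, smul_zero]
      · by_cases hb : b = t 0
        · rw [← smul_eq_mul (e a), ← map_smul, hs a (fun ha => hab (ha.trans hb.symm)), map_zero,
            zero_mul]
        · rw [mul_assoc, hm b hb, mul_zero]
  have hone : ∀ (P : ModuleCat.{u} R) (p : P), ∑ i, e i • p = p := fun P p => by
    rw [← Finset.sum_smul, hsum, one_smul]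
  refine .of_quotients e (fun P _ p => hone P p) (fun P hP i r p => ?_) (fun P _ i j hij p => ?_)
    (fun P hP i j hij f p => ?_) fun i => ?_
  -- Without off-diagonal action, both sides reduce to `e_i r e_i p`.
  · trans e i • r • e i • p
    · conv_lhs => rw [← hone P p, Finset.smul_sum, Finset.smul_sum, Finset.sum_eq_single i
        (fun j _ hj => (key P hP).1 i j hj.symm r p) (by simp)]
    · conv_rhs => rw [← hone P (r • e i • p), Finset.sum_eq_single i
        (fun j _ hj => (key P hP).1 j i hj r p) (by simp)]
  · rw [← mul_smul, horth i j hij, zero_smul]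
  · rw [map_smul]
    exact (key P hP).2 i j hij f p
  · obtain ⟨S, hS, hS', π, hπ, hF, hr⟩ := hquot i
    refine ⟨S, hS, hS', π, hπ, hF, fun P hP r h p => ?_⟩
    conv_lhs => rw [← hone P p, Finset.smul_sum, Finset.smul_sum, Finset.sum_eq_single i
      (fun j _ hj => (key P hP).1 i j hj.symm r p) (by simp)]
    rw [← mul_smul, ← mul_smul, hr r h, zero_smul]

end Triangular

/-! ### Triangular matrix algebras and Beilinson–Green algebras. -/

section Applications

variable (k : Type u) [Field k]

/-- The triangular criterion for the two diagonal idempotents, with the diagonal entries as quotient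
maps. -/
theorem isFrobeniusFinite_triangularMatrix (A B M : Type u) [Ring A] [Algebra k A] [Ring B]
    [Algebra k B] [AddCommGroup M] [Module k M] [Module B M] [Module Aᵐᵒᵖ M]
    [SMulCommClass B Aᵐᵒᵖ M] [IsScalarTower k B M] [IsScalarTower k Aᵐᵒᵖ M]
    (hA : IsFrobeniusFinite k A) (hB : IsFrobeniusFinite k B) (hM : Module.Finite k M) :
    IsFrobeniusFinite k (TriangularMatrix A B M) := by
  have := hA.1
  have := hB.1
  have : Module.Finite k (TriangularMatrix A B M) := by
    let f : (A × M × B) →ₗ[k] TriangularMatrix A B M :=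
      { toFun := fun x => ⟨x.1, x.2.1, x.2.2⟩
        map_add' := fun _ _ => rfl
        map_smul' := fun _ _ => rfl }
    exact Module.Finite.of_surjective f fun x => ⟨(x.a, x.m, x.b), rfl⟩
  let e : Fin 2 → TriangularMatrix A B M := ![⟨1, 0, 0⟩, ⟨0, 0, 1⟩]
  have he0 : e 0 = ⟨1, 0, 0⟩ := rfl
  have he1 : e 1 = ⟨0, 0, 1⟩ := rfl
  refine .of_triangular e ?_ ?_ ?_ ?_ ?_
  · rw [Fin.forall_fin_two, he0, he1]
    constructor <;> ext <;> simp
  · simp only [Fin.forall_fin_two, he0, he1]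
    refine ⟨⟨by simp, fun _ => ?_⟩, fun _ => ?_, by simp⟩ <;> ext <;> simp
  · rw [Fin.sum_univ_two, he0, he1]
    ext <;> simp
  · simp only [Fin.forall_fin_two, he0, he1]
    refine ⟨⟨by simp, fun _ r => ?_⟩, by simp, by simp⟩
    ext <;> simp
  · rw [Fin.forall_fin_two]
    refine ⟨⟨A, _, _, AlgHom.ofLinearMap
      { toFun := fun x : TriangularMatrix A B M => x.a
        map_add' := fun _ _ => rfl
        map_smul' := fun _ _ => rfl } rfl fun _ _ => rfl, fun a => ⟨⟨a, 0, 0⟩, rfl⟩, hA,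
        fun r hr => ?_⟩, ⟨B, _, _, AlgHom.ofLinearMap
      { toFun := fun x : TriangularMatrix A B M => x.b
        map_add' := fun _ _ => rfl
        map_smul' := fun _ _ => rfl } rfl fun _ _ => rfl, fun b => ⟨⟨0, 0, b⟩, rfl⟩, hB,
        fun r hr => ?_⟩⟩
    · have hr' : r.a = 0 := hr
      rw [he0]
      ext <;> simp [hr']
    · have hr' : r.b = 0 := hr
      rw [he1]
      ext <;> simp [hr']

theorem isFrobeniusFinite_matrixAlgebra {m : ℕ} {A : Fin m → Type u} {M : Fin m → Fin m → Type u}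
    [∀ i, Ring (A i)] [∀ i, Algebra k (A i)]
    [∀ i j, AddCommGroup (M i j)] [∀ i j, Module k (M i j)]
    [∀ i j, Module (A i) (M i j)] [∀ i j, Module (A j)ᵐᵒᵖ (M i j)]
    [∀ i j, SMulCommClass (A i) (A j)ᵐᵒᵖ (M i j)]
    [∀ i j, IsScalarTower k (A i) (M i j)] [∀ i j, IsScalarTower k (A j)ᵐᵒᵖ (M i j)]
    (T : TriangularSystem k A M) (hA : ∀ i, IsFrobeniusFinite k (A i))
    (hM : ∀ i j, j < i → Module.Finite k (M i j)) : IsFrobeniusFinite k T.MatrixAlgebra := by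
  classical
  have : ∀ i, Module.Finite k (A i) := fun i => (hA i).1
  have : Module.Finite k T.MatrixAlgebra := by
    let I := {p : Fin m × Fin m // p.2 < p.1}
    have : ∀ p : I, Module.Finite k (M p.1.1 p.1.2) := fun p => hM _ _ p.2
    let f : ((∀ i, A i) × (∀ p : I, M p.1.1 p.1.2)) →ₗ[k] T.MatrixAlgebra :=
      { toFun := fun x => ⟨x.1, fun i j h => x.2 ⟨(i, j), h⟩⟩
        map_add' := fun _ _ => rfl
        map_smul' := fun _ _ => rfl }
    exact Module.Finite.of_surjective f fun x => ⟨(x.diag, fun p => x.low p.1.1 p.1.2 p.2), rfl⟩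
  let e : Fin m → T.MatrixAlgebra := fun i => ⟨Pi.single i 1, fun _ _ _ => 0⟩
  have hd : ∀ i, (e i).diag = Pi.single i 1 := fun _ => rfl
  have hl : ∀ i a b h, (e i).low a b h = 0 := fun _ _ _ _ => rfl
  -- Additive entry maps, used to evaluate the sum of the idempotents entrywise.
  let d : T.MatrixAlgebra →+ ∀ i, A i :=
    { toFun := fun x => x.diag
      map_zero' := rfl
      map_add' := fun _ _ => rfl }
  let l : ∀ a b, b < a → (T.MatrixAlgebra →+ M a b) := fun a b h =>
    { toFun := fun x => x.low a b h
      map_zero' := rfl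
      map_add' := fun _ _ => rfl }
  have hlow : ∀ i r j a b h, ((e i * r) * e j).low a b h =
      MulOpposite.op ((Pi.single j 1 : ∀ i, A i) b) • (Pi.single i 1 : ∀ i, A i) a • r.low a b h := by
    intro i r j a b h
    simp [TriangularSystem.MatrixAlgebra.mul_low, hd, hl]
  refine .of_triangular e ?_ ?_ ?_ ?_ ?_
  · intro i
    refine TriangularSystem.MatrixAlgebra.ext_entries (fun a => ?_) fun a b h => ?_
    · rw [TriangularSystem.MatrixAlgebra.mul_diag, hd, ← Pi.single_mul, mul_one]
    · simp [TriangularSystem.MatrixAlgebra.mul_low, hl]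
  · intro i j hij
    refine TriangularSystem.MatrixAlgebra.ext_entries (fun a => ?_) fun a b h => ?_
    · rw [TriangularSystem.MatrixAlgebra.mul_diag, hd, hd]
      by_cases ha : a = i
      · subst ha; simp [hij]
      · simp [ha]
    · simp [TriangularSystem.MatrixAlgebra.mul_low, hl]
  · refine TriangularSystem.MatrixAlgebra.ext_entries (fun a => ?_) fun a b h => ?_
    · change d (∑ i, e i) a = 1
      rw [map_sum, Finset.sum_apply]
      change ∑ i, (Pi.single i 1 : ∀ i, A i) a = 1
      rw [Finset.sum_eq_single a]
      · simp
      · intro j _ hj; simp [hj.symm]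
      · simp
    · change l a b h (∑ i, e i) = 0
      rw [map_sum]
      exact Finset.sum_eq_zero fun i _ => rfl
  · intro i j hij r
    refine TriangularSystem.MatrixAlgebra.ext_entries (fun a => ?_) fun a b h => ?_
    · simp only [TriangularSystem.MatrixAlgebra.mul_diag, hd, Pi.mul_apply]
      by_cases ha : a = i
      · subst ha; simp [hij.ne]
      · simp [ha]
    · rw [hlow]
      by_cases ha : a = i
      · subst ha
        by_cases hb : b = j
        · subst hb; exact (lt_asymm h hij).elim
        · simp [hb]
      · simp [ha]
  · intro i
    refine ⟨A i, _, _, AlgHom.ofLinearMap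
      { toFun := fun x : T.MatrixAlgebra => x.diag i
        map_add' := fun _ _ => rfl
        map_smul' := fun _ _ => rfl } rfl fun _ _ => rfl, fun a => ⟨⟨Pi.single i a, fun _ _ _ => 0⟩,
          Pi.single_eq_same i a⟩, hA i, fun r hr => ?_⟩
    have hr' : r.diag i = 0 := hr
    refine TriangularSystem.MatrixAlgebra.ext_entries (fun a => ?_) fun a b h => ?_
    · simp only [TriangularSystem.MatrixAlgebra.mul_diag, hd, Pi.mul_apply]
      by_cases ha : a = i
      · subst ha; simp [hr']
      · simp [ha]
    · rw [hlow]
      by_cases ha : a = i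
      · subst ha
        simp [h.ne]
      · simp [ha]

/-- All diagonal entries lie in `G 0`, and triangularity makes each of them a multiplicative
function of the matrix; the triangular criterion applies with every quotient equal to `G 0`. -/
theorem isFrobeniusFinite_beilinsonGreen {R : Type u} [Ring R] [Algebra k R]
    (G : ℕ → Submodule k R) [GradedAlgebra G] [Module.Finite k R]
    (hG : IsFrobeniusFinite k (G 0)) (m : ℕ) : IsFrobeniusFinite k (beilinsonGreen G m) := by
  have : Module.Finite k (beilinsonGreen G m) :=
    inferInstanceAs (Module.Finite k (Subalgebra.toSubmodule (beilinsonGreen G m)))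
  let e : Fin (m + 1) → beilinsonGreen G m := fun i => ⟨Matrix.single i i 1, fun a b => by
    refine ⟨fun h => ?_, fun h => ?_⟩
    · by_cases hab : a = b
      · subst hab
        rw [Nat.sub_self, Matrix.single_apply]
        split_ifs
        · exact SetLike.GradedOne.one_mem
        · exact zero_mem _
      · rw [Matrix.single_apply_of_ne _ _ _ _ _ (fun h => hab (h.1.symm.trans h.2))]
        exact zero_mem _
    · rw [Matrix.single_apply_of_ne _ _ _ _ _ (fun h' => h.ne (h'.1.symm.trans h'.2))]⟩
  have hval : ∀ i, (e i).1 = Matrix.single i i 1 := fun _ => rfl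
  have hmul : ∀ i r j, (e i * r * e j).1 = Matrix.single i j (r.1 i j) := fun i r j => by
    change Matrix.single i i 1 * r.1 * Matrix.single j j 1 = _
    rw [Matrix.single_mul_mul_single, one_mul, mul_one]
  refine .of_triangular e (fun i => Subtype.ext ?_) (fun i j hij => Subtype.ext ?_) (Subtype.ext ?_)
    (fun i j hij r => Subtype.ext ?_) fun i => ?_
  · change Matrix.single i i (1 : R) * Matrix.single i i 1 = Matrix.single i i 1
    rw [Matrix.single_mul_single_same, one_mul]
  · exact Matrix.single_mul_single_of_ne _ _ _ _ hij _
  · rw [AddSubmonoidClass.coe_finsetSum]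
    change ∑ i, Matrix.single i i (1 : R) = 1
    ext a b
    rw [Matrix.sum_apply, Matrix.one_apply]
    simp only [Matrix.single_apply]
    by_cases hab : a = b
    · subst hab; simp
    · rw [if_neg hab]
      exact Finset.sum_eq_zero fun x _ => if_neg fun h => hab (h.1.symm.trans h.2)
  · rw [hmul, (r.2 i j).2 hij, Matrix.single_zero]
    rfl
  · have hmem : ∀ X : beilinsonGreen G m, X.1 i i ∈ G 0 := fun X => by
      have := (X.2 i i).1 le_rfl
      rwa [Nat.sub_self] at this
    refine ⟨G 0, _, _, AlgHom.ofLinearMap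
      { toFun := fun X : beilinsonGreen G m => (⟨X.1 i i, hmem X⟩ : G 0)
        map_add' := fun _ _ => rfl
        map_smul' := fun _ _ => rfl } (Subtype.ext (Matrix.one_apply_eq i)) fun X Y => ?_,
        fun a => ?_, hG, fun r hr => Subtype.ext ?_⟩
    · refine Subtype.ext ?_
      change (X.1 * Y.1) i i = X.1 i i * Y.1 i i
      rw [Matrix.mul_apply, Finset.sum_eq_single i]
      · intro j _ hj
        rcases lt_or_gt_of_ne hj with h | h
        · rw [(Y.2 j i).2 h, mul_zero]
        · rw [(X.2 i j).2 h, zero_mul]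
      · simp
    · refine ⟨⟨Matrix.single i i a.1, fun p q => ⟨fun h => ?_, fun h => ?_⟩⟩,
        Subtype.ext (Matrix.single_apply_same _ _ _)⟩
      · by_cases hab : p = q
        · subst hab
          rw [Nat.sub_self, Matrix.single_apply]
          split_ifs
          · exact a.2
          · exact zero_mem _
        · rw [Matrix.single_apply_of_ne _ _ _ _ _ (fun h => hab (h.1.symm.trans h.2))]
          exact zero_mem _
      · rw [Matrix.single_apply_of_ne _ _ _ _ _ (fun h' => h.ne (h'.1.symm.trans h'.2))]
    · have hr' : r.1 i i = 0 := congrArg Subtype.val hr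
      rw [hmul, hr', Matrix.single_zero]
      rfl

end Applications

/-! ### The functor `Hom(U, -)` on `add(U)`. -/

section HomFunctor

variable {R U P X : Type u} [Ring R] [AddCommGroup U] [Module R U] [AddCommGroup P] [Module R P]
  [AddCommGroup X] [Module R X]

/-- The functor `Hom(U, -)` is fully faithful on `add(U)`. -/
theorem HomFrom.map_bijective (h : InAdd R U P) :
    Function.Bijective fun f : P →ₗ[R] X => HomFrom.map (W := U) (Module.End R U) f := by
  obtain ⟨n, s, r, hsr⟩ := inAdd_iff.1 h
  have hx : ∀ x, ∑ i, r i (s i x) = x := fun x => by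
    simpa [LinearMap.sum_apply] using LinearMap.congr_fun hsr x
  refine ⟨fun f f' hf => LinearMap.ext fun x => ?_, fun φ => ⟨∑ i, (φ (HomFrom.mk (r i))).lin ∘ₗ s i,
    LinearMap.ext fun g => HomFrom.ext fun w => ?_⟩⟩
  · rw [← hx x, _root_.map_sum, _root_.map_sum]
    exact Finset.sum_congr rfl fun i _ =>
      DFunLike.congr_fun (LinearMap.congr_fun hf (HomFrom.mk (r i))) (s i x)
  · have hg : g = ∑ i, MulOpposite.op (s i ∘ₗ g.lin) • HomFrom.mk (r i) :=
      HomFrom.ext fun w => by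
        rw [HomFrom.sum_apply]
        exact (hx (g w)).symm
    conv_rhs => rw [hg, _root_.map_sum, HomFrom.sum_apply]
    rw [HomFrom.map_apply, LinearMap.sum_apply]
    refine Finset.sum_congr rfl fun i _ => ?_
    rw [_root_.map_smul]
    rfl

theorem InAdd.homFrom (h : InAdd R X P) :
    InAdd (Module.End R U)ᵐᵒᵖ (HomFrom R U X) (HomFrom R U P) := by
  obtain ⟨n, s, r, hsr⟩ := inAdd_iff.1 h
  refine inAdd_iff.2 ⟨n, fun i => HomFrom.map _ (s i), fun i => HomFrom.map _ (r i), ?_⟩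
  refine LinearMap.ext fun g => HomFrom.ext fun w => ?_
  rw [LinearMap.sum_apply, HomFrom.sum_apply]
  have := LinearMap.congr_fun hsr (g w)
  rw [LinearMap.sum_apply] at this
  exact this

/-- Endomorphisms of `U`, as elements of `Hom(U, U)`. -/
def HomFrom.endEquiv (R U : Type u) [Ring R] [AddCommGroup U] [Module R U] :
    HomFrom R U U ≃ₗ[(Module.End R U)ᵐᵒᵖ] (Module.End R U)ᵐᵒᵖ where
  toFun g := MulOpposite.op g.lin
  invFun t := HomFrom.mk t.unop
  map_add' _ _ := rfl
  map_smul' _ _ := rfl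

/-- `Hom(U, -)` sends `add(U)` to projective modules. -/
theorem InAdd.homFrom_self (h : InAdd R U P) :
    InAdd (Module.End R U)ᵐᵒᵖ (Module.End R U)ᵐᵒᵖ (HomFrom R U P) :=
  h.homFrom.trans (InAdd.of_equiv (HomFrom.endEquiv R U))

/-- The functor `Hom(U, -)` induces isomorphisms of endomorphism rings on `add(U)`. -/
noncomputable def HomFrom.endRingEquiv (h : InAdd R U P) :
    Module.End R P ≃+* Module.End (Module.End R U)ᵐᵒᵖ (HomFrom R U P) :=
  RingEquiv.ofBijective
    (show Module.End R P →+* Module.End (Module.End R U)ᵐᵒᵖ (HomFrom R U P) from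
    { toFun := fun f => HomFrom.map (Module.End R U) f
      map_one' := rfl
      map_mul' := fun _ _ => rfl
      map_zero' := rfl
      map_add' := fun _ _ => rfl })
    (HomFrom.map_bijective h)

end HomFunctor

/-! ### Corner algebras at a projective module with faithful trace ideal. -/

section Corner

variable {k R : Type u} [Field k] [Ring R] [Algebra k R] [Module.Finite k R]

/-- If the trace ideal of the projective module `U` has no right annihilator, then projective
modules with a projective Nakayama transform lie in `add(U)`. -/
theorem InAdd.of_projective_nakayama {U : Type u} [AddCommGroup U] [Module R U]
    [Module.Finite R U] [Module.Projective R U]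
    (hU : ∀ z : R, (∀ (c : U →ₗ[R] R) (t : U), c t * z = 0) → z = 0) {P : ModuleCat.{u} R}
    [Module.Finite R P] [Module.Projective R P] [Module.Projective R (nakayama k R P)] :
    InAdd R U P := by
  have : Module.Finite k (U →ₗ[R] R) := finite_hom
  obtain ⟨n, c, hc⟩ := Module.Finite.exists_fin (R := k) (M := U →ₗ[R] R)
  obtain ⟨m, p, hp⟩ := Module.Finite.exists_fin (R := R) (M := P)
  let U' : ModuleCat.{u} R := ModuleCat.of R (Fin m → Fin n → U)
  have hU' : InAdd R U (Fin m → Fin n → U) :=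
    (inAdd_pi_self (A := R) (Z := Fin n → U) m).trans (inAdd_pi_self n)
  have : Module.Projective R U' := hU'.projective
  have : Module.Finite R U' := inferInstanceAs (Module.Finite R (Fin m → Fin n → U))
  -- The image of `γ` is the trace ideal of `U` times `P`: the maps `c i` span `Hom(U, R)` and the
  -- `p j` generate `P`. The scalars `ℕ` serve because `R` need not be commutative.
  let γ : U' →ₗ[R] P := LinearMap.lsum R (fun _ => Fin n → U) ℕ fun j =>
    LinearMap.lsum R (fun _ => U) ℕ fun i => LinearMap.toSpanSingleton R P (p j) ∘ₗ c i
  have hγ : ∀ i j u, γ (Pi.single j (Pi.single i u)) = c i u • p j := by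
    intro i j u
    simp only [γ]
    rw [LinearMap.lsum_piSingle, LinearMap.lsum_piSingle]
    rfl
  -- If `h ∘ γ = 0`, the trace ideal annihilates each `h (p j)`, so `h = 0`. Dually, `ν γ` is
  -- surjective.
  have hinj : Function.Injective (preComp (Z := R) k γ) := by
    refine (injective_iff_map_eq_zero _).2 fun h hh => ?_
    have h1 : ∀ j i u, c i u * h (p j) = 0 := fun j i u => by
      have := LinearMap.congr_fun hh (Pi.single j (Pi.single i u))
      rw [← smul_eq_mul, ← map_smul, ← hγ]
      exact this
    have h2 : ∀ j, h (p j) = 0 := fun j => hU _ fun f t => by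
      have hf : f ∈ Submodule.span k (Set.range c) := hc ▸ Submodule.mem_top
      induction hf using Submodule.span_induction with
      | mem x hx =>
        obtain ⟨i, rfl⟩ := hx
        exact h1 j i t
      | zero => simp
      | add x y _ _ hx hy => rw [LinearMap.add_apply, add_mul, hx, hy, add_zero]
      | smul a x _ hx => rw [LinearMap.smul_apply, smul_mul_assoc, hx, smul_zero]
    refine LinearMap.ext fun x => ?_
    have hx : x ∈ Submodule.span R (Set.range p) := hp ▸ Submodule.mem_top
    induction hx using Submodule.span_induction with
    | mem x hx =>
      obtain ⟨i, rfl⟩ := hx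
      exact h2 i
    | zero => simp
    | add x y _ _ hx hy => rw [map_add, hx, hy, map_add]
    | smul a x _ hx => rw [map_smul, hx, map_smul]
  have hsurj : Function.Surjective (nakMap k γ) := fun η => by
    obtain ⟨ξ, hξ⟩ := LinearMap.dualMap_surjective_of_injective hinj (nakForm η)
    exact ⟨nakMk ξ, nak_ext fun f => LinearMap.congr_fun hξ f⟩
  -- Projectivity of `ν P` splits `ν γ`; fullness and faithfulness of `ν` turn the splitting into
  -- one of `γ`.
  obtain ⟨σ, hσ⟩ := Module.projective_lifting_property (nakMap k γ) LinearMap.id hsurj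
  obtain ⟨θ, rfl⟩ := nakMap_surjective σ
  refine (InAdd.of_retract θ γ (nakMap_injective (k := k) ?_)).trans hU'
  rw [nakMap_comp, hσ, nakMap_id]

variable {U : ModuleCat.{u} R} [Module k U] [IsScalarTower k R U]

/-- The functor `Hom(U, -)` commutes with the Nakayama functors on `add(U)`. -/
theorem nonempty_nakayama_homFrom {P : ModuleCat.{u} R} [Module.Finite R P]
    [Module.Projective R P] (h : InAdd R U P) :
    Nonempty (nakayama k (Module.End R U)ᵐᵒᵖ
      (ModuleCat.of (Module.End R U)ᵐᵒᵖ (HomFrom R U P)) ≃ₗ[(Module.End R U)ᵐᵒᵖ]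
      HomFrom R U (nakayama k R P)) := by
  let B := (Module.End R U)ᵐᵒᵖ
  let G : ModuleCat.{u} B := ModuleCat.of B (HomFrom R U P)
  let α₀ : (P →ₗ[R] U) →ₗ[k] (G →ₗ[B] B) :=
    { toFun := fun f => (HomFrom.endEquiv R U).toLinearMap ∘ₗ HomFrom.map (W := U) _ f
      map_add' := fun _ _ => rfl
      map_smul' := fun _ _ => rfl }
  have hα : Function.Bijective α₀ := by
    refine ⟨fun f f' hf => (HomFrom.map_bijective h).1 ?_, fun φ => ?_⟩
    · refine LinearMap.ext fun g => (HomFrom.endEquiv R U).injective ?_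
      exact LinearMap.congr_fun hf g
    · obtain ⟨f, hf⟩ := (HomFrom.map_bijective h).2 ((HomFrom.endEquiv R U).symm.toLinearMap ∘ₗ φ)
      exact ⟨f, LinearMap.ext fun g => congrArg (HomFrom.endEquiv R U) (LinearMap.congr_fun hf g)⟩
  let α : (P →ₗ[R] U) ≃ₗ[k] (G →ₗ[B] B) := LinearEquiv.ofBijective α₀ hα
  -- Behind `Φ` is the adjunction `D(Hom(P, R) ⊗ U) = Hom(U, D Hom(P, R))`. Here `β` is the
  -- evaluation of tensors in `Hom(P, U)`, whose image spans since `P` is finitely generated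
  -- projective.
  let β : (P →ₗ[R] R) → U → (P →ₗ[R] U) := fun f u => LinearMap.toSpanSingleton R U u ∘ₗ f
  let Φ : nakayama k B G →ₗ[B] HomFrom R U (nakayama k R P) :=
    { toFun := fun ξ => HomFrom.mk
        { toFun := fun u => nakMk
            { toFun := fun f => nakForm ξ (α (β f u))
              map_add' := fun f f' => by
                rw [← map_add, ← map_add]
                congr 2
                exact LinearMap.ext fun p => add_smul _ _ _
              map_smul' := fun c f => by
                rw [← map_smul, ← map_smul]
                congr 2
                exact LinearMap.ext fun p => smul_assoc _ _ _ }
          map_add' := fun u v => nak_ext fun f => by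
            change nakForm ξ (α (β f (u + v))) = nakForm ξ (α (β f u)) + nakForm ξ (α (β f v))
            rw [← map_add, ← map_add]
            congr 2
            exact LinearMap.ext fun p => smul_add _ _ _
          map_smul' := fun r u => nak_ext fun f => by
            change nakForm ξ (α (β f (r • u))) = nakForm ξ (α (β (MulOpposite.op r • f) u))
            congr 2
            exact LinearMap.ext fun p => smul_smul _ _ _ }
      map_add' := fun ξ η => rfl
      map_smul' := fun t ξ => HomFrom.ext fun u => nak_ext fun f => by
        change nakForm ξ (MulOpposite.op t • α (β f u)) = nakForm ξ (α (β f (t.unop • u)))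
        congr 1
        refine LinearMap.ext fun g => MulOpposite.unop_injective <| LinearMap.ext fun x => ?_
        exact map_smul t.unop (f (g x)) u }
  have hΦ : ∀ ξ u f, nakForm (Φ ξ u) f = nakForm ξ (α (β f u)) := fun _ _ _ => rfl
  obtain ⟨n, s, r, hsr⟩ := inAdd_iff.1 (inAdd_of_finite_projective (A := R) (Y := P))
  have hx : ∀ x, ∑ i, s i x • r i 1 = x := fun x => by
    have := LinearMap.congr_fun hsr x
    rw [LinearMap.sum_apply] at this
    refine Eq.trans (Finset.sum_congr rfl fun i _ => ?_) this
    rw [← map_smul, smul_eq_mul, mul_one, LinearMap.comp_apply]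
  have hβ : ∀ f : P →ₗ[R] U, ∑ i, β (s i) (f (r i 1)) = f := fun f => LinearMap.ext fun x => by
    rw [LinearMap.sum_apply]
    conv_rhs => rw [← hx x, map_sum]
    exact Finset.sum_congr rfl fun i _ => (map_smul f _ _).symm
  refine ⟨LinearEquiv.ofBijective Φ ⟨(injective_iff_map_eq_zero Φ).2 fun ξ hξ => ?_, fun g => ?_⟩⟩
  · refine nak_ext fun φ => ?_
    obtain ⟨f, rfl⟩ := α.surjective φ
    rw [← hβ f, map_sum, map_sum, map_sum]
    refine Finset.sum_congr rfl fun i _ => ?_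
    rw [← hΦ, hξ]
    rfl
  -- The inverse of `Φ`, written with the dual basis of `P`.
  · let ω : (P →ₗ[R] U) →ₗ[k] k :=
      { toFun := fun f => ∑ i, nakForm (g (f (r i 1))) (s i)
        map_add' := fun f f' => by
          rw [← Finset.sum_add_distrib]
          refine Finset.sum_congr rfl fun i _ => ?_
          rw [LinearMap.add_apply, HomFrom.map_add, nakForm_add]
        map_smul' := fun c f => by
          rw [RingHom.id_apply, Finset.smul_sum]
          refine Finset.sum_congr rfl fun i _ => ?_
          rw [LinearMap.smul_apply, ← IsScalarTower.algebraMap_smul R, HomFrom.map_smul]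
          exact KDual.algebraMap_smul (A := R) c _ _ }
    refine ⟨nakMk (ω ∘ₗ α.symm.toLinearMap), HomFrom.ext fun u => nak_ext fun f => ?_⟩
    rw [hΦ]
    change ω (α.symm (α (β f u))) = _
    rw [LinearEquiv.symm_apply_apply]
    change ∑ i, nakForm (g (f (r i 1) • u)) (s i) = _
    conv_lhs =>
      enter [2, i]
      rw [HomFrom.map_smul, nakForm_smul]
    rw [← map_sum]
    congr 1
    refine LinearMap.ext fun x => ?_
    rw [LinearMap.sum_apply]
    conv_rhs => rw [← hx x, map_sum]
    exact Finset.sum_congr rfl fun i _ => (map_smul f _ _).symm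

/-- A finite-dimensional algebra is Frobenius-finite if the endomorphism algebra of a projective
module whose trace ideal has no right annihilator is. -/
theorem IsFrobeniusFinite.of_end [Module.Finite R U] [Module.Projective R U]
    (hU : ∀ z : R, (∀ (c : U →ₗ[R] R) (t : U), c t * z = 0) → z = 0)
    (h : IsFrobeniusFinite k (Module.End R U)ᵐᵒᵖ) : IsFrobeniusFinite k R := by
  have hadd : ∀ P : ModuleCat.{u} R, IsNuStablyProjective k R P → InAdd R U P := fun P hP =>
    have := hP.finite
    have := hP.projective
    have : Module.Projective R (nakayama k R P) := hP.2 1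
    .of_projective_nakayama (k := k) hU
  refine isFrobeniusFinite_of_isListFinite fun P hP _ => ?_
  have hadd' := hadd P hP
  refine .of_ringEquiv (RingEquiv.op (HomFrom.endRingEquiv hadd')) (h.isListFinite
    (P := ModuleCat.of (Module.End R U)ᵐᵒᵖ (HomFrom R U P)) ?_)
  -- The modules `Hom(U, P)` with `P` `ν`-stably projective form a class closed under the Nakayama
  -- functor of `End(U)`.
  refine .of_class (fun N => ∃ P, IsNuStablyProjective k R P ∧
    Nonempty (HomFrom R U P ≃ₗ[(Module.End R U)ᵐᵒᵖ] N)) ?_ ?_ ⟨P, hP, ⟨LinearEquiv.refl _ _⟩⟩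
  · rintro N ⟨P, hP, ⟨e⟩⟩
    have := (hadd P hP).homFrom_self.trans' e
    exact ⟨this.finite, this.projective⟩
  · rintro N ⟨P, hP, ⟨e⟩⟩
    have := hP.finite
    have := hP.projective
    obtain ⟨e'⟩ := nonempty_nakayama_homFrom (k := k) (hadd P hP)
    exact ⟨ModuleCat.of _ (HomFrom R U (nakayama k R P)), ⟨nakayama k R P, hP.nakayama, ⟨LinearEquiv.refl _ _⟩⟩,
      ⟨(nakEquiv k (P := N) (P' := ModuleCat.of _ (HomFrom R U P)) e.symm).trans e'⟩⟩

end Corner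

/-! ### Endomorphism algebras of generators. -/

section Generator

variable {k A : Type u} [Field k] [Ring A] [Algebra k A] {M : Type u} [AddCommGroup M] [Module A M]
  [Module k M] [IsScalarTower k A M]

instance : IsScalarTower k (Module.End A M)ᵐᵒᵖ (HomFrom A M A) :=
  ⟨fun c t g => HomFrom.ext fun m => by
    change g (c • t.unop m) = c • g (t.unop m)
    rw [← algebraMap_smul A, HomFrom.map_smul, algebraMap_smul]⟩

/-- The right multiplications are the endomorphisms of `Hom(M, A)` over `End(M)`, for a
generator `M`. -/
noncomputable def endHomFromEquiv (k : Type u) [Field k] [Algebra k A] [Module k M]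
    [IsScalarTower k A M] (h : IsGeneratorModule A M) :
    (Module.End (Module.End A M)ᵐᵒᵖ (HomFrom A M A))ᵐᵒᵖ ≃ₐ[k] A :=
  AlgEquiv.symm <| AlgEquiv.ofBijective
    { toFun := fun a => MulOpposite.op
        (HomFrom.map (Module.End A M) (LinearMap.toSpanSingleton A A a))
      map_one' := MulOpposite.unop_injective <| LinearMap.ext fun g => HomFrom.ext fun m =>
        mul_one (g m)
      map_mul' := fun a b => MulOpposite.unop_injective <| LinearMap.ext fun g =>
        HomFrom.ext fun m => (mul_assoc (g m) a b).symm
      map_zero' := MulOpposite.unop_injective <| LinearMap.ext fun g => HomFrom.ext fun m =>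
        mul_zero (g m)
      map_add' := fun a b => MulOpposite.unop_injective <| LinearMap.ext fun g =>
        HomFrom.ext fun m => mul_add (g m) a b
      commutes' := fun c => MulOpposite.unop_injective <| LinearMap.ext fun g =>
        HomFrom.ext fun m => by
          change g m * algebraMap k A c = c • g m
          rw [← Algebra.commutes, Algebra.smul_def] } (by
    refine ⟨fun a b hab => ?_, fun φ => ?_⟩
    · have := LinearMap.congr_fun ((HomFrom.map_bijective h).1 (MulOpposite.op_injective hab)) 1
      simpa using this
    · obtain ⟨f, hf⟩ := (HomFrom.map_bijective h).2 φ.unop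
      refine ⟨f 1, MulOpposite.unop_injective <| Eq.trans ?_ hf⟩
      change HomFrom.map (Module.End A M) (LinearMap.toSpanSingleton A A (f 1)) =
        HomFrom.map (Module.End A M) f
      congr 1
      ext
      simp)

/-- The endomorphism algebra of a generator over a Frobenius-finite algebra is
Frobenius-finite. -/
theorem IsFrobeniusFinite.end_of_generator (hA : IsFrobeniusFinite k A) [Module.Finite A M]
    (h : IsGeneratorModule A M) : IsFrobeniusFinite k (Module.End A M)ᵐᵒᵖ := by
  have := hA.1
  have : Module.Finite k M := Module.Finite.trans A M
  have : Module.Finite k (Module.End A M) := finite_hom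
  have : Module.Finite k (Module.End A M)ᵐᵒᵖ :=
    Module.Finite.equiv (MulOpposite.opLinearEquiv k)
  let U : ModuleCat.{u} (Module.End A M)ᵐᵒᵖ := ModuleCat.of _ (HomFrom A M A)
  have hU : InAdd (Module.End A M)ᵐᵒᵖ (Module.End A M)ᵐᵒᵖ U := h.homFrom_self
  have : Module.Finite (Module.End A M)ᵐᵒᵖ U := hU.finite
  have : Module.Projective (Module.End A M)ᵐᵒᵖ U := hU.projective
  let _ : Module k U := inferInstanceAs (Module k (HomFrom A M A))
  have : IsScalarTower k (Module.End A M)ᵐᵒᵖ U :=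
    inferInstanceAs (IsScalarTower k (Module.End A M)ᵐᵒᵖ (HomFrom A M A))
  refine .of_end (U := U) (fun z hz => MulOpposite.unop_injective <| LinearMap.ext fun m => ?_)
    (.of_algEquiv (endHomFromEquiv k h) hA)
  obtain ⟨n, s, r, hsr⟩ := inAdd_iff.1 h
  have h1 : ∑ i, r i (s i 1) = 1 := by
    have := LinearMap.congr_fun hsr 1
    rwa [LinearMap.sum_apply] at this
  change z.unop m = 0
  rw [← one_smul A (z.unop m), ← h1, Finset.sum_smul]
  refine Finset.sum_eq_zero fun i _ => ?_
  -- The endomorphism `x ↦ r i x · m` lies in the trace ideal of `Hom(M, A)`, so `z` kills its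
  -- values. At `x = s i 1`, where `∑ r i (s i 1) = 1`, this gives `z m = 0`.
  have := hz ((HomFrom.endEquiv A M).toLinearMap ∘ₗ
    HomFrom.map (Module.End A M) (LinearMap.toSpanSingleton A M m)) (HomFrom.mk (r i))
  have := LinearMap.congr_fun (congrArg MulOpposite.unop this) (s i 1)
  rw [← map_smul]
  exact this

end Generator

/-! ### Embeddings into powers of `D(B)`. -/

section Embedding

variable (k : Type u) {B : Type u} [Field k] [Ring B] [Algebra k B] [Module.Finite k B]

/-- Finitely generated modules embed into finite powers of `ν_B B`, which is the dual of `B`. -/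
theorem exists_injective_nakayama (X : ModuleCat.{u} B) [Module.Finite B X] :
    ∃ (n : ℕ) (f : X →ₗ[B] (Fin n → nakayama k B (ModuleCat.of B B))), Function.Injective f := by
  let _ : Module k X := Module.compHom X (algebraMap k B)
  have : IsScalarTower k B X := ⟨fun c r x => by rw [Algebra.smul_def, mul_smul]; rfl⟩
  have : Module.Finite k X := Module.Finite.trans B X
  obtain ⟨n, l, hl⟩ := Module.Finite.exists_fin (R := k) (M := Module.Dual k X)
  -- The element `x` goes to the form `g ↦ l i (g(1) x)`; its value at the identity is `l i x`, and
  -- the `l i` span the dual of `X`.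
  let f : Fin n → X →ₗ[B] nakayama k B (ModuleCat.of B B) := fun i =>
    { toFun := fun x => nakMk
        { toFun := fun g => l i (g (1 : B) • x)
          map_add' := fun g h => by rw [LinearMap.add_apply, add_smul, map_add]
          map_smul' := fun c g => by
            rw [LinearMap.smul_apply, smul_assoc, map_smul, RingHom.id_apply] }
      map_add' := fun x y => nak_ext fun g => by
        change l i (g (1 : B) • (x + y)) = l i (g (1 : B) • x) + l i (g (1 : B) • y)
        rw [smul_add, map_add]
      map_smul' := fun b x => nak_ext fun g => by
        change l i (g (1 : B) • b • x) = l i ((g (1 : B) * b) • x)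
        rw [mul_smul] }
  refine ⟨n, LinearMap.pi f, (injective_iff_map_eq_zero _).2 fun x hx => ?_⟩
  have h1 : ∀ i, l i x = 0 := fun i => by
    have : l i ((1 : B) • x) = 0 :=
      congrArg (fun ξ => nakForm (k := k) (ξ : nakayama k B (ModuleCat.of B B)) LinearMap.id) (congrFun hx i)
    rwa [one_smul] at this
  refine (Module.forall_dual_apply_eq_zero_iff k x).1 fun φ => ?_
  have hφ : φ ∈ Submodule.span k (Set.range l) := hl ▸ Submodule.mem_top
  induction hφ using Submodule.span_induction with
  | mem _ hx =>
    obtain ⟨i, rfl⟩ := hx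
    exact h1 i
  | zero => rfl
  | add φ ψ _ _ hφ hψ => rw [LinearMap.add_apply, hφ, hψ, add_zero]
  | smul c φ _ hφ => rw [LinearMap.smul_apply, hφ, smul_zero]

end Embedding

/-! ### Algebras of global dimension at most two. -/

section GlobalDimension

variable {k A : Type u} [Field k] [Ring A] [Algebra k A] [Module.Finite k A]

/-- Over an algebra of global dimension at most two, kernels of maps between projective modules
are projective. -/
theorem projective_ker_of_gldim_le_two {A : Type u} [Ring A]
    (hA : ∀ X : ModuleCat.{u} A, Module.Finite A X → HasProjectiveDimensionLE X 2)
    {X Y : Type u} [AddCommGroup X] [Module A X] [AddCommGroup Y] [Module A Y]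
    [Module.Projective A X] [Module.Projective A Y] [Module.Finite A Y] (θ : X →ₗ[A] Y) :
    Module.Projective A (LinearMap.ker θ) := by
  have hX : Projective (ModuleCat.of A X) := (IsProjective.iff_projective X).1 inferInstance
  have hY : Projective (ModuleCat.of A Y) := (IsProjective.iff_projective Y).1 inferInstance
  -- Dimension shift along kernel, image and cokernel of `θ`: the strict bounds `3`, `2`, `1` mean
  -- projective dimension at most `2`, `1`, `0`.
  have h3 : HasProjectiveDimensionLT (ModuleCat.of A (Y ⧸ LinearMap.range θ)) 3 :=
    hA (ModuleCat.of A (Y ⧸ LinearMap.range θ)) inferInstance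
  have h2 : HasProjectiveDimensionLT (ModuleCat.of A (LinearMap.ker (LinearMap.range θ).mkQ)) 2 :=
    (LinearMap.shortExact_shortComplexKer
      (Submodule.mkQ_surjective (LinearMap.range θ))).hasProjectiveDimensionLT_X₁ 2
      (inferInstanceAs (HasProjectiveDimensionLT (ModuleCat.of A Y) 2)) h3
  rw [Submodule.ker_mkQ] at h2
  have h1 : HasProjectiveDimensionLT (ModuleCat.of A (LinearMap.ker θ.rangeRestrict)) 1 :=
    (LinearMap.shortExact_shortComplexKer θ.surjective_rangeRestrict).hasProjectiveDimensionLT_X₁ 1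
      (inferInstanceAs (HasProjectiveDimensionLT (ModuleCat.of A X) 1)) h2
  rw [LinearMap.ker_rangeRestrict] at h1
  exact (IsProjective.iff_projective _).2 inferInstance

/-- Over a finite-dimensional algebra of global dimension at most two, every module over `End(P)`
is of the form `Hom(P, K)` with a projective module `K`, if `add(P)` contains `ν P`. -/
theorem exists_homFrom_projective_equiv
    (hA : ∀ X : ModuleCat.{u} A, Module.Finite A X → HasProjectiveDimensionLE X 2)
    {P : ModuleCat.{u} A} [Module.Finite A P] [Module.Projective A P]
    (h : InAdd A P (nakayama k A P)) (X : ModuleCat.{u} (Module.End A P)ᵐᵒᵖ)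
    [Module.Finite (Module.End A P)ᵐᵒᵖ X] :
    ∃ K : ModuleCat.{u} A, Module.Finite A K ∧ Module.Projective A K ∧
      Nonempty (X ≃ₗ[(Module.End A P)ᵐᵒᵖ] HomFrom A P K) := by
  let B := (Module.End A P)ᵐᵒᵖ
  let _ : Module k P := Module.compHom P (algebraMap k A)
  have : IsScalarTower k A P := ⟨fun c r x => by rw [Algebra.smul_def, mul_smul]; rfl⟩
  have : Module.Finite k P := Module.Finite.trans A P
  have : Module.Finite k (Module.End A P) := finite_hom
  have : Module.Finite k B := Module.Finite.equiv (MulOpposite.opLinearEquiv k)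
  have : IsNoetherianRing A := IsNoetherianRing.of_finite k A
  have : IsNoetherianRing B := IsNoetherianRing.of_finite k B
  have := h.projective
  have := h.finite
  obtain ⟨e⟩ := nonempty_nakayama_homFrom (k := k) (U := P) (P := P) InAdd.refl
  have hpow : ∀ n, InAdd A P (Fin n → nakayama k A P) := fun n => (inAdd_pi_self n).trans h
  -- `ν_B B`, the dual of `B`, is `Hom(P, ν P)`, so every finitely generated `B`-module embeds into
  -- some `Hom(P, (ν P)^n)`.
  have emb : ∀ (Y : ModuleCat.{u} B) [Module.Finite B Y], ∃ (n : ℕ)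
      (f : Y →ₗ[B] HomFrom A P (Fin n → nakayama k A P)), Function.Injective f := by
    intro Y _
    obtain ⟨n, f, hf⟩ := exists_injective_nakayama k Y
    let e₁ : nakayama k B (ModuleCat.of B B) ≃ₗ[B] HomFrom A P (nakayama k A P) :=
      (nakEquiv k (P := ModuleCat.of B B) (P' := ModuleCat.of B (HomFrom A P P))
        (HomFrom.endEquiv A P).symm).trans e
    let e₂ : (Fin n → nakayama k B (ModuleCat.of B B)) ≃ₗ[B] (Fin n → HomFrom A P (nakayama k A P)) :=
      LinearEquiv.piCongrRight fun _ => e₁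
    let e₃ := (HomFrom.pi (R := A) (W := P) (Module.End A P) fun _ : Fin n => nakayama k A P).symm
    exact ⟨n, (e₂.trans e₃).toLinearMap ∘ₗ f, (e₂.trans e₃).injective.comp hf⟩
  obtain ⟨n, f, hf⟩ := emb X
  have : Module.Finite B (HomFrom A P (Fin n → nakayama k A P)) := (hpow n).homFrom_self.finite
  obtain ⟨m, g, hg⟩ := emb (ModuleCat.of B
    (HomFrom A P (Fin n → nakayama k A P) ⧸ LinearMap.range f))
  -- The second map of the copresentation of `X` comes from a map `θ` because `(ν P)^n` lies in
  -- `add(P)`. Left exactness of `Hom(P, -)` then identifies `X` with `Hom(P, ker θ)`.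
  obtain ⟨θ, hθ⟩ := (HomFrom.map_bijective (hpow n)).2 (g ∘ₗ (LinearMap.range f).mkQ)
  have := (hpow n).projective
  have := (hpow m).projective
  have hker : ∀ y : HomFrom A P (Fin n → nakayama k A P), (∀ p, θ (y p) = 0) ↔ ∃ x, f x = y := by
    intro y
    rw [← LinearMap.mem_range, ← Submodule.Quotient.mk_eq_zero, ← Submodule.mkQ_apply,
      ← map_eq_zero_iff g hg, ← LinearMap.comp_apply, ← hθ]
    exact ⟨fun H => HomFrom.ext H, fun H p => DFunLike.congr_fun H p⟩
  let K : ModuleCat.{u} A := ModuleCat.of A (LinearMap.ker θ)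
  refine ⟨K, inferInstanceAs (Module.Finite A (LinearMap.ker θ)),
    projective_ker_of_gldim_le_two hA θ, ⟨LinearEquiv.ofBijective
    { toFun := fun x => HomFrom.mk ((f x).lin.codRestrict (LinearMap.ker θ)
        ((hker (f x)).2 ⟨x, rfl⟩))
      map_add' := fun x y => HomFrom.ext fun p => Subtype.ext <| by
        change f (x + y) p = f x p + f y p
        rw [_root_.map_add, HomFrom.add_apply]
      map_smul' := fun t x => HomFrom.ext fun p => Subtype.ext <| by
        change f (t • x) p = f x (t.unop • p)
        rw [_root_.map_smul, HomFrom.op_smul_apply] } ⟨fun x y hxy => hf (HomFrom.ext fun p => ?_),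
      fun y => ?_⟩⟩⟩
  · exact congrArg Subtype.val (DFunLike.congr_fun hxy p)
  · obtain ⟨x, hx⟩ := (hker (HomFrom.mk ((LinearMap.ker θ).subtype ∘ₗ y.lin))).1 fun p => (y p).2
    exact ⟨x, HomFrom.ext fun p => Subtype.ext (DFunLike.congr_fun hx p)⟩

/-- A finite-dimensional algebra of global dimension at most two is Frobenius-finite. -/
theorem isFrobeniusFinite_of_gldim_le_two
    (hA : ∀ X : ModuleCat.{u} A, Module.Finite A X → HasProjectiveDimensionLE X 2) :
    IsFrobeniusFinite k A := by
  classical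
  have : IsArtinianRing A := IsArtinianRing.of_finite k A
  refine isFrobeniusFinite_of_isListFinite fun P hP hadd => ?_
  have := hP.finite
  have := hP.projective
  obtain ⟨ι, _, N, hN⟩ := exists_finite_indec_projective A
  obtain ⟨n, ⟨e⟩⟩ := Finite.exists_equiv_fin ι
  refine ⟨n, fun i => ModuleCat.of _ (HomFrom A P (N (e.symm i))), fun X _ => ?_⟩
  obtain ⟨K, _, _, ⟨f⟩⟩ := exists_homFrom_projective_equiv (k := k) hA (hadd _ hP.nakayama) X
  -- The indecomposable summands of the projective module `K` belong to the finite list `N`, so `X`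
  -- is a sum of modules `Hom(P, N i)`.
  obtain ⟨κ, _, L, hL, ⟨g⟩⟩ := exists_indec_decomposition K
  have hproj : ∀ j, Module.Projective A (L j) := fun j =>
    Module.Projective.of_split (g.symm.toLinearMap ∘ₗ LinearMap.single A (fun j => L j) j)
      (LinearMap.proj j ∘ₗ g.toLinearMap) (by ext; simp)
  choose c hc using fun j => hN (L j) (hL j).1 (hproj j) (hL j).2
  refine ⟨κ, inferInstance, fun j => e (c j), ⟨?_⟩⟩
  refine (f.trans (HomFrom.congr (Module.End A P) (g.trans (LinearEquiv.piCongrRight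
    fun j => (hc j).some)))).trans
    ((HomFrom.pi (Module.End A P) fun j => N (c j)).trans (LinearEquiv.piCongrRight fun j => ?_))
  change HomFrom A P (N (c j)) ≃ₗ[(Module.End A P)ᵐᵒᵖ] HomFrom A P (N (e.symm (e (c j))))
  rw [e.symm_apply_apply]

end GlobalDimension

/-! ### Ideals annihilating `ν`-stably projective modules. -/

section Annihilation

variable {k R : Type u} [Field k] [Ring R] [Algebra k R] [Module.Finite k R]

/-- A form on `Hom(P, R)` that vanishes on the maps with `f x = 0` for all `x ∈ 𝔭` is in the span
of the forms `x • φ` with `x ∈ 𝔭`. -/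
theorem mem_of_forall_mul_eq_zero {P : ModuleCat.{u} R} [Module.Finite R P] (𝔭 : Set R)
    (V : Submodule k R) (h : nakayama k R P →ₗ[R] R) (ξ : nakayama k R P)
    (hξ : ∀ f : P →ₗ[R] R, (∀ x ∈ 𝔭, MulOpposite.op x • f = 0) → nakForm ξ f = 0)
    (hV : ∀ x ∈ 𝔭, ∀ y, x * y ∈ V) : h ξ ∈ V := by
  have : Module.Finite k (P →ₗ[R] R) := finite_hom
  let S : Set (Module.Dual k (P →ₗ[R] R)) := {η | ∃ x ∈ 𝔭, ∃ φ : nakayama k R P, η = nakForm (x • φ)}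
  -- In finite dimension the span of `S` is its own double annihilator, and `ξ` vanishes on the
  -- annihilator of `S`.
  have hmem : nakForm ξ ∈ Submodule.span k S := by
    rw [← Subspace.dualCoannihilator_dualAnnihilator_eq (W := Submodule.span k S),
      Submodule.mem_dualAnnihilator]
    intro f hf
    refine hξ f fun x hx => hom_eq_zero_of_nakForm (k := k) fun φ => ?_
    exact (Submodule.mem_dualCoannihilator f).1 hf _ (Submodule.subset_span ⟨x, hx, φ, rfl⟩)
  have key : ∀ η ∈ Submodule.span k S, h (nakMk η) ∈ V := by
    intro η hη
    induction hη using Submodule.span_induction with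
    | mem η hη =>
      obtain ⟨x, hx, φ, rfl⟩ := hη
      rw [show (nakMk (nakForm (x • φ)) : nakayama k R P) = x • φ from rfl, map_smul]
      exact hV x hx _
    | zero =>
      rw [show (nakMk 0 : nakayama k R P) = 0 from rfl, map_zero]
      exact zero_mem V
    | add η ζ _ _ h1 h2 =>
      rw [show (nakMk (η + ζ) : nakayama k R P) = nakMk η + nakMk ζ from rfl, map_add]
      exact add_mem h1 h2
    | smul c η _ h1 =>
      rw [show (nakMk (c • η) : nakayama k R P) = algebraMap k R c • nakMk η from
        nak_ext fun f => (KDual.algebraMap_smul c (nakMk η : nakayama k R P) f).symm, map_smul,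
        algebraMap_smul]
      exact V.smul_mem c h1
  exact key _ hmem

/-- A criterion for a nilpotent ideal `J` to annihilate all `ν`-stably projective modules. -/
theorem IsNuStablyProjective.smul_eq_zero (J C : Submodule k R) (𝔭 : Set R)
    (hJ : ∀ x ∈ J, ∀ y, x * y ∈ J) (h𝔭 : ∀ x ∈ 𝔭, ∀ y, x * y ∈ C) (hCJ : ∀ x ∈ C, x ∈ J → x = 0)
    (hz : ∀ z, (∀ x ∈ 𝔭, z * x = 0) → z ∈ J) (F : ℕ → Submodule k R) (hF₀ : F 0 = ⊤)
    (hF : ∀ n, ∀ x ∈ F n, ∀ y ∈ J, x * y ∈ F (n + 1)) (N : ℕ) (hN : F N = ⊥)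
    {P : ModuleCat.{u} R} (hP : IsNuStablyProjective k R P) {j : R} (hj : j ∈ J) (p : P) :
    j • p = 0 := by
  obtain ⟨P', hP', ⟨e⟩⟩ := hP.exists_nakayama_equiv
  have := hP.projective
  have := hP'.finite
  have := hP'.projective
  have : Module.Projective R (FrobFin.nakayama k R P') := hP'.2 1
  have : Module.Finite k (P' →ₗ[R] R) := finite_hom
  let act : R → Module.End k (P' →ₗ[R] R) := fun x =>
    { toFun := fun f => MulOpposite.op x • f
      map_add' := fun f g => smul_add _ _ _
      map_smul' := fun c f => smul_comm _ _ _ }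
  let ann : Set R → Submodule k (P' →ₗ[R] R) := fun T => ⨅ x ∈ T, LinearMap.ker (act x)
  have hann : ∀ T f, f ∈ ann T ↔ ∀ x ∈ T, MulOpposite.op x • f = 0 := fun T f => by
    simp [ann, Submodule.mem_iInf, act]
  -- If a form vanishes on both annihilators, each map `ν P' → R` sends it into `C` and into `J`,
  -- hence to zero. Since `ν P'` is projective, the form is zero.
  have hsup : ann 𝔭 ⊔ ann J = ⊤ := by
    rw [← Subspace.dualAnnihilator_inj, Submodule.dualAnnihilator_top, eq_bot_iff]
    intro ξ hξ
    rw [Submodule.dualAnnihilator_sup_eq, Submodule.mem_inf, Submodule.mem_dualAnnihilator,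
      Submodule.mem_dualAnnihilator] at hξ
    obtain ⟨s, hs⟩ := (Module.projective_def (R := R) (P := FrobFin.nakayama k R P')).1 inferInstance
    have : (nakMk ξ : FrobFin.nakayama k R P') = 0 := by
      refine hs.injective ?_
      ext p
      rw [map_zero]
      refine hCJ _ (mem_of_forall_mul_eq_zero 𝔭 C (Finsupp.lapply p ∘ₗ s) (nakMk ξ)
        (fun f hf => hξ.1 f ((hann _ _).2 hf)) h𝔭) ?_
      exact mem_of_forall_mul_eq_zero J J (Finsupp.lapply p ∘ₗ s) (nakMk ξ)
        (fun f hf => hξ.2 f ((hann _ _).2 hf)) hJ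
    exact (Submodule.mem_bot k).2 this
  obtain ⟨n, s, r, hsr⟩ := inAdd_iff.1 (inAdd_of_finite_projective (A := R) (Y := P'))
  have hx : ∀ x, ∑ i, s i x • r i 1 = x := fun x => by
    have := LinearMap.congr_fun hsr x
    rw [LinearMap.sum_apply] at this
    refine Eq.trans (Finset.sum_congr rfl fun i _ => ?_) this
    rw [← map_smul, smul_eq_mul, mul_one, LinearMap.comp_apply]
  -- In `f = f₁ + f₂` the part `f₂` is killed by `J`, while `f₁` has values in `J` by `hz`. The dual
  -- basis writes `f₁ x * j` as a sum of `s i x * f₁ (r i 1) * j`, so right multiplication by `j`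
  -- moves one step further down the filtration.
  have key : ∀ d, ∀ f : P' →ₗ[R] R, ∀ j ∈ J, ∀ x, f x * j ∈ F d := by
    intro d
    induction d with
    | zero => intro f j _ x; rw [hF₀]; exact Submodule.mem_top
    | succ d ih =>
      intro f j hj x
      obtain ⟨f₁, hf₁, f₂, hf₂, rfl⟩ := Submodule.mem_sup.1 (hsup ▸ Submodule.mem_top : f ∈ ann 𝔭 ⊔ ann J)
      have h2 : f₂ x * j = 0 := LinearMap.congr_fun ((hann _ _).1 hf₂ j hj) x
      have h1 : ∀ y, f₁ y ∈ J := fun y => hz _ fun z hz =>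
        LinearMap.congr_fun ((hann _ _).1 hf₁ z hz) y
      rw [LinearMap.add_apply, add_mul, h2, add_zero, ← hx x, map_sum, Finset.sum_mul]
      refine Submodule.sum_mem _ fun i _ => ?_
      rw [map_smul, smul_eq_mul]
      exact hF d _ (ih (s i) _ (h1 _) x) j hj
  obtain ⟨ξ, rfl⟩ := e.surjective p
  rw [← map_smul, show j • ξ = 0 from nak_ext fun f => ?_, map_zero]
  rw [nakForm_smul, show MulOpposite.op j • f = 0 from LinearMap.ext fun x => ?_, map_zero]
  · rfl
  · have := key N f j hj x
    rw [hN] at this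
    exact (Submodule.mem_bot k).1 this

end Annihilation

/-! ### Finite-dimensionality of `Ext`. -/

section ExtFinite

variable {k A : Type u} [Field k] [Ring A] [Algebra k A] [Module.Finite k A]

open Abelian in
/-- `Ext` groups between finitely generated modules are finite-dimensional. -/
theorem finite_ext (X Y : ModuleCat.{u} A) [Module.Finite A X] [Module.Finite A Y] (n : ℕ) :
    Module.Finite k (Ext.{u} X Y n) := by
  have : IsNoetherianRing A := IsNoetherianRing.of_finite k A
  induction n generalizing X with
  | zero =>
    let _ : Module k Y := ModuleCat.moduleOfAlgebraModule Y
    have : IsScalarTower k A Y := ModuleCat.isScalarTower_of_algebra_moduleCat Y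
    have : Module.Finite k Y := Module.Finite.trans A Y
    have h : Module.Finite k (X →ₗ[A] Y) := finite_hom
    let e : (X →ₗ[A] Y) ≃ₗ[k] (X ⟶ Y) :=
      { toFun := ModuleCat.ofHom
        invFun := fun f => f.hom
        map_add' := fun _ _ => rfl
        map_smul' := fun _ _ => rfl
        left_inv := fun _ => rfl
        right_inv := fun _ => rfl }
    exact Module.Finite.equiv (e.trans Ext.linearEquiv₀.symm)
  | succ n ih =>
    -- Dimension shift: `Ext^n` of the first syzygy surjects onto `Ext^(n+1)` of `X`.
    obtain ⟨m, f, hf⟩ := Module.Finite.exists_fin' A X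
    let h := LinearMap.shortExact_shortComplexKer (M := Fin m → A) (N := X) hf
    have : Projective (LinearMap.shortComplexKer (M := Fin m → A) (N := X) f).X₂ :=
      (IsProjective.iff_projective (Fin m → A)).1 inferInstance
    have := ih (ModuleCat.of A (LinearMap.ker f))
    exact Module.Finite.of_surjective (h.extClass.precompOfLinear k Y (add_comm 1 n))
      (precomp_extClass_surjective_of_projective_X₂ Y h n)

end ExtFinite

/-! ### Frobenius-finiteness of Auslander–Yoneda algebras. -/

namespace AuslanderYoneda

open Abelian

section Basic

variable {C : Type*} [Category C] [Abelian C] [HasExt.{u} C] {Θ : Finset ℕ}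
  {hΘ : IsAdmissible (Θ : Set ℕ)} {M : C}

/-- The degree zero component. -/
noncomputable def degZero (x : AuslanderYoneda Θ hΘ M) : M ⟶ M :=
  Ext.addEquiv₀ (x ⟨0, hΘ.zero_mem⟩)

theorem mk₀_degZero (x : AuslanderYoneda Θ hΘ M) :
    Ext.mk₀ x.degZero = x ⟨0, hΘ.zero_mem⟩ :=
  Ext.mk₀_addEquiv₀_apply _

/-- The elements of degree zero. -/
noncomputable def ofHom (Θ : Finset ℕ) (hΘ : IsAdmissible (Θ : Set ℕ)) (f : M ⟶ M) :
    AuslanderYoneda Θ hΘ M :=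
  fun n => if h : (0 : ℕ) = (n : ℕ) then h ▸ Ext.mk₀ f else 0

theorem ofHom_apply_zero (f : M ⟶ M) : ofHom Θ hΘ f ⟨0, hΘ.zero_mem⟩ = Ext.mk₀ f := by
  change (if h : (0 : ℕ) = 0 then h ▸ Ext.mk₀ f else 0) = _
  simp

theorem ofHom_apply_of_ne (f : M ⟶ M) (n : Θ) (hn : (n : ℕ) ≠ 0) : ofHom Θ hΘ f n = 0 :=
  dif_neg hn.symm

theorem degZero_ofHom (f : M ⟶ M) : (ofHom Θ hΘ f).degZero = f := by
  rw [degZero, ofHom_apply_zero]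
  exact Ext.addEquiv₀.apply_symm_apply f

theorem ofHom_mul_apply (f : M ⟶ M) (y : AuslanderYoneda Θ hΘ M) (n : Θ) :
    (ofHom Θ hΘ f * y) n = (Ext.mk₀ f).comp (y n) (zero_add _) := by
  rw [mul_apply, Finset.sum_eq_single ⟨0, hΘ.zero_mem⟩, Finset.sum_eq_single n]
  · rw [dif_pos (by simp), ofHom_apply_zero]
  · intro j _ hj
    rw [dif_neg]
    exact fun h => hj (Subtype.ext (by simpa using h))
  · simp
  · intro i _ hi
    refine Finset.sum_eq_zero fun j _ => ?_
    rw [ofHom_apply_of_ne f i fun h => hi (Subtype.ext h)]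
    simp
  · simp

theorem mul_apply_eq_zero {a b : ℕ} {x y : AuslanderYoneda Θ hΘ M}
    (hx : ∀ i : Θ, (i : ℕ) < a → x i = 0) (hy : ∀ i : Θ, (i : ℕ) < b → y i = 0) (n : Θ)
    (hn : (n : ℕ) < a + b) : (x * y) n = 0 := by
  rw [mul_apply]
  refine Finset.sum_eq_zero fun i _ => Finset.sum_eq_zero fun j _ => ?_
  split_ifs with h
  · by_cases hi : (i : ℕ) < a
    · rw [hx i hi, Ext.zero_comp]
    · rw [hy j (by omega), Ext.comp_zero]
  · rfl

/-- Two degrees summing to zero are both zero, so the projection to degree zero is multiplicative.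
-/
theorem degZero_mul (x y : AuslanderYoneda Θ hΘ M) :
    (x * y).degZero = x.degZero ≫ y.degZero := by
  refine (Ext.mk₀_bijective M M).1 ?_
  rw [← Ext.mk₀_comp_mk₀, mk₀_degZero, mk₀_degZero, mk₀_degZero, mul_apply,
    Finset.sum_eq_single ⟨0, hΘ.zero_mem⟩, Finset.sum_eq_single ⟨0, hΘ.zero_mem⟩]
  · exact dif_pos rfl
  · intro j _ hj
    rw [dif_neg]
    exact fun h => hj (Subtype.ext (by simpa using h))
  · simp
  · intro i _ hi
    refine Finset.sum_eq_zero fun j _ => ?_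
    rw [dif_neg]
    intro h
    have h' : (i : ℕ) + (j : ℕ) = 0 := h
    exact hi (Subtype.ext (by change (i : ℕ) = 0; omega))
  · simp

theorem degZero_add (x y : AuslanderYoneda Θ hΘ M) :
    (x + y).degZero = x.degZero + y.degZero :=
  map_add Ext.addEquiv₀ _ _

theorem degZero_one : (1 : AuslanderYoneda Θ hΘ M).degZero = 𝟙 M := by
  rw [degZero, one_apply_zero]
  exact Ext.addEquiv₀.apply_symm_apply _

theorem degZero_zero : (0 : AuslanderYoneda Θ hΘ M).degZero = 0 :=
  map_zero Ext.addEquiv₀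

theorem degZero_eq_zero_iff (x : AuslanderYoneda Θ hΘ M) :
    x.degZero = 0 ↔ x ⟨0, hΘ.zero_mem⟩ = 0 :=
  map_eq_zero_iff _ Ext.addEquiv₀.injective

theorem degZero_smul {k : Type*} [Field k] [Linear k C] (c : k) (x : AuslanderYoneda Θ hΘ M) :
    (c • x).degZero = c • x.degZero :=
  (Ext.mk₀_bijective M M).1 (by rw [Ext.mk₀_smul, mk₀_degZero, mk₀_degZero]; rfl)

end Basic

section Modules

variable {k A : Type u} [Field k] [Ring A] [Algebra k A] [Module.Finite k A]
  {Θ : Finset ℕ} {hΘ : IsAdmissible (Θ : Set ℕ)} {M : ModuleCat.{u} A}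

omit [Module.Finite k A] in
/-- A product with a map that factors through the regular module lies in degree zero. -/
theorem ofHom_comp_mul_apply_of_ne (a : M ⟶ ModuleCat.of A A) (b : ModuleCat.of A A ⟶ M)
    (y : AuslanderYoneda Θ hΘ M) (n : Θ) (hn : (n : ℕ) ≠ 0) :
    (ofHom Θ hΘ (a ≫ b) * y) n = 0 := by
  have : Projective (ModuleCat.of A A) := (IsProjective.iff_projective A).1 inferInstance
  obtain ⟨m, hm⟩ := Nat.exists_eq_succ_of_ne_zero hn
  -- This composite lies in `Ext^n(A, M)` with `n > 0` and `A` projective.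
  have h0 : (Ext.mk₀ b).comp (y n) (zero_add _) = 0 := by
    have : Subsingleton (Ext.{u} (ModuleCat.of A A) M (n : ℕ)) := by
      rw [hm]
      exact Ext.subsingleton_of_projective _ _ _
    exact Subsingleton.elim _ _
  rw [ofHom_mul_apply, ← Ext.mk₀_comp_mk₀_assoc, h0, Ext.comp_zero]

/-- The elements of positive degree annihilate the `ν`-stably projective modules over the
Auslander–Yoneda algebra of a torsionless generator. -/
theorem smul_eq_zero [Module.Finite A M] [Module.Finite k (AuslanderYoneda Θ hΘ M)]
    (ht : IsTorsionless A M) (hg : IsGeneratorModule A M)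
    {P : ModuleCat.{u} (AuslanderYoneda Θ hΘ M)}
    (hP : IsNuStablyProjective k (AuslanderYoneda Θ hΘ M) P) (j : AuslanderYoneda Θ hΘ M)
    (hj : j.degZero = 0) (p : P) : j • p = 0 := by
  let F : ℕ → Submodule k (AuslanderYoneda Θ hΘ M) := fun d =>
    { carrier := {x | ∀ i : Θ, (i : ℕ) < d → x i = 0}
      add_mem' := fun {x y} hx hy i hi => by rw [add_apply, hx i hi, hy i hi, add_zero]
      zero_mem' := fun _ _ => rfl
      smul_mem' := fun c x hx i hi => by rw [smul_apply, hx i hi, smul_zero] }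
  let J : Submodule k (AuslanderYoneda Θ hΘ M) :=
    { carrier := {x | x.degZero = 0}
      add_mem' := fun {x y} (hx : x.degZero = 0) (hy : y.degZero = 0) =>
        show (x + y).degZero = 0 by rw [degZero_add, hx, hy, add_zero]
      zero_mem' := degZero_zero
      smul_mem' := fun c x (hx : x.degZero = 0) =>
        show (c • x).degZero = 0 by rw [degZero_smul, hx, smul_zero] }
  let C : Submodule k (AuslanderYoneda Θ hΘ M) :=
    { carrier := {x | ∀ i : Θ, (i : ℕ) ≠ 0 → x i = 0}
      add_mem' := fun {x y} hx hy i hi => by rw [add_apply, hx i hi, hy i hi, add_zero]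
      zero_mem' := fun _ _ => rfl
      smul_mem' := fun c x hx i hi => by rw [smul_apply, hx i hi, smul_zero] }
  have hJF : ∀ y ∈ J, ∀ i : Θ, (i : ℕ) < 1 → y i = 0 := fun y hy i hi => by
    rw [show i = ⟨0, hΘ.zero_mem⟩ from Subtype.ext (by change (i : ℕ) = 0; omega)]
    exact (degZero_eq_zero_iff y).1 hy
  -- `J` consists of the elements without degree zero part, `C` of those concentrated in degree
  -- zero, and the set `𝔭` of the degree zero maps that factor through `A`. The filtration `F` is by
  -- lowest degree.
  refine hP.smul_eq_zero J C {x | ∃ (a : M ⟶ ModuleCat.of A A) (b : ModuleCat.of A A ⟶ M),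
    x = ofHom Θ hΘ (a ≫ b)} ?_ ?_ ?_ ?_ F ?_ ?_ (Θ.sup id + 1) ?_ hj p
  · intro x hx y
    change (x * y).degZero = 0
    rw [degZero_mul, show x.degZero = 0 from hx, Limits.zero_comp]
  · rintro _ ⟨a, b, rfl⟩ y i hi
    exact ofHom_comp_mul_apply_of_ne a b y i hi
  · intro x hC hJ
    refine ext' fun i => ?_
    by_cases hi : (i : ℕ) = 0
    · exact hJF x hJ i (by omega)
    · exact hC i hi
  · intro z hz
    change z.degZero = 0
    -- Maps `M → A` separate the points of a torsionless module, and the maps `s i : A → M` are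
    -- jointly injective for a generator. So `z` has zero degree zero part as soon as its products
    -- with all composites `a ≫ b` vanish.
    obtain ⟨P, f, _, _, hf⟩ := ht
    obtain ⟨n, s, r, hsr⟩ := inAdd_iff.1 hg
    obtain ⟨σ, hσ⟩ := (Module.projective_def (R := A) (P := P)).1 inferInstance
    refine ModuleCat.hom_ext (LinearMap.ext fun m => ?_)
    refine hf (hσ.injective (Finsupp.ext fun q => ?_))
    rw [show (0 : M ⟶ M).hom m = 0 from rfl, map_zero, map_zero, Finsupp.zero_apply]
    let a : M ⟶ ModuleCat.of A A := ModuleCat.ofHom (Finsupp.lapply q ∘ₗ σ ∘ₗ f)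
    change a.hom (z.degZero.hom m) = 0
    have h1 : ∀ i, s i (a.hom (z.degZero.hom m)) = 0 := fun i => by
      have := hz _ ⟨a, ModuleCat.ofHom (s i), rfl⟩
      have := congrArg degZero this
      rw [degZero_mul, degZero_ofHom, degZero_zero] at this
      exact LinearMap.congr_fun (congrArg ModuleCat.Hom.hom this) m
    have := LinearMap.congr_fun hsr (a.hom (z.degZero.hom m))
    rw [LinearMap.sum_apply] at this
    rw [← LinearMap.id_apply (R := A) (a.hom (z.degZero.hom m)), ← this]
    refine Finset.sum_eq_zero fun i _ => ?_
    rw [LinearMap.comp_apply, h1, map_zero]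
  · exact eq_top_iff.2 fun x _ i hi => absurd hi (Nat.not_lt_zero _)
  · intro n x hx y hy i hi
    exact mul_apply_eq_zero hx (hJF y hy) i hi
  -- One more than the largest degree in `Θ` exhausts the filtration.
  · refine eq_bot_iff.2 fun x hx => (Submodule.mem_bot k).2 (ext' fun i => hx i ?_)
    exact Nat.lt_succ_of_le (Finset.le_sup (f := id) i.2)

/-- Auslander–Yoneda algebras of torsionless generators over Frobenius-finite algebras are
Frobenius-finite. -/
theorem isFrobeniusFinite (hA : IsFrobeniusFinite k A) [Module.Finite A M]
    (ht : IsTorsionless A M) (hg : IsGeneratorModule A M) :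
    IsFrobeniusFinite k (AuslanderYoneda Θ hΘ M) := by
  let _ : Module k M := ModuleCat.moduleOfAlgebraModule M
  have : IsScalarTower k A M := ModuleCat.isScalarTower_of_algebra_moduleCat M
  have : Module.Finite k (AuslanderYoneda Θ hΘ M) := by
    have : ∀ i : Θ, Module.Finite k (Ext.{u} M M (i : ℕ)) := fun i => finite_ext M M i
    exact inferInstanceAs (Module.Finite k (∀ i : Θ, Ext.{u} M M (i : ℕ)))
  let π₀ : AuslanderYoneda Θ hΘ M →ₗ[k] (Module.End A M)ᵐᵒᵖ :=
    { toFun := fun x => MulOpposite.op x.degZero.hom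
      map_add' := fun x y => by rw [degZero_add]; rfl
      map_smul' := fun c x => by rw [degZero_smul]; rfl }
  let π : AuslanderYoneda Θ hΘ M →ₐ[k] (Module.End A M)ᵐᵒᵖ := AlgHom.ofLinearMap π₀
    (congrArg (fun f : M ⟶ M => MulOpposite.op f.hom) degZero_one)
    (fun x y => by
      change MulOpposite.op (x * y).degZero.hom = _
      rw [degZero_mul]
      rfl)
  refine .of_quotient π (fun f => ⟨ofHom Θ hΘ (ModuleCat.ofHom f.unop), ?_⟩)
    (hA.end_of_generator hg) fun P hP r hr p => smul_eq_zero ht hg hP r ?_ p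
  · change MulOpposite.op (ofHom Θ hΘ (ModuleCat.ofHom f.unop)).degZero.hom = f
    rw [degZero_ofHom]
    rfl
  · exact ModuleCat.hom_ext (congrArg MulOpposite.unop hr)

end Modules

end AuslanderYoneda

/-! ### Self-injective and representation-finite algebras. -/

section SelfInjective

variable {k A : Type u} [Field k] [Ring A] [Algebra k A] [Module.Finite k A]

/-- Over a self-injective algebra, the Nakayama transform of a projective module is projective. -/
theorem projective_nakayama_of_selfInjective (hA : Module.Injective A A) (P : ModuleCat.{u} A)
    [Module.Finite A P] [Module.Projective A P] : Module.Projective A (nakayama k A P) := by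
  classical
  have : IsArtinianRing A := IsArtinianRing.of_finite k A
  obtain ⟨ι, _, N, hN, ⟨f⟩⟩ := exists_indec_decomposition (ModuleCat.of A A)
  have := fun i => (hN i).1
  have hdec : IsSummandOf (A := A) (fun i => N i) A := isSummandOf_pi (A := A) (fun i => N i) f
  let σ : ∀ i, N i →ₗ[A] A := fun i => f.symm.toLinearMap ∘ₗ LinearMap.single A (fun i => N i) i
  let ρ : ∀ i, A →ₗ[A] N i := fun i => LinearMap.proj i ∘ₗ f.toLinearMap
  have hρσ : ∀ i x, ρ i (σ i x) = x := fun i x => by simp [ρ, σ]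
  have hproj : ∀ i, Module.Projective A (N i) := fun i =>
    Module.Projective.of_split (σ i) (ρ i) (LinearMap.ext (hρσ i))
  -- `N i` is injective as a summand of `A`, so its embedding into a power of `D(A) = ν A` splits.
  -- By indecomposability it is a summand of a single `ν (N j)`, hence isomorphic to it.
  have hex : ∀ i, ∃ j, Nonempty (N i ≃ₗ[A] nakayama k A (N j)) := by
    intro i
    obtain ⟨n, g, hg⟩ := exists_injective_nakayama k (N i)
    obtain ⟨h, hh⟩ := hA.out g hg (σ i)
    have h1 : IsSummandOf (A := A) (fun _ : Fin n => nakayama k A (ModuleCat.of A A)) (N i) :=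
      isSummandOf_of_retract (isSummandOf_pi (A := A)
        (fun _ : Fin n => nakayama k A (ModuleCat.of A A)) (LinearEquiv.refl A _)) g (ρ i ∘ₗ h)
        (LinearMap.ext fun x => by
          rw [LinearMap.comp_apply, LinearMap.comp_apply, hh, hρσ, LinearMap.id_apply])
    obtain ⟨-, s, r, hsr⟩ := (hN i).2.exists_retract h1
    obtain ⟨j, t, w, htw⟩ := (hN i).2.exists_retract (isSummandOf_of_retract
      (isSummandOf_nakayama (k := k) (P := ModuleCat.of A A) hdec) s r hsr)
    have := (hN i).2.1
    exact ⟨j, (hN j).2.nakayama.equiv_of_retract t w htw⟩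
  choose φ hφ using hex
  let S : Setoid ι :=
    { r := fun i j => Nonempty (N i ≃ₗ[A] N j)
      iseqv := ⟨fun i => ⟨LinearEquiv.refl A _⟩, fun ⟨e⟩ => ⟨e.symm⟩, fun ⟨e⟩ ⟨e'⟩ => ⟨e.trans e'⟩⟩ }
  -- The assignment `i ↦ j` is well defined on isomorphism classes, as `ν` reflects isomorphisms,
  -- and injective, as `ν` preserves them. By finiteness it is onto, so every `ν (N i)` is
  -- projective.
  let Φ : Quotient S → Quotient S := Quotient.map φ fun i j ⟨e⟩ =>
    nonempty_equiv_of_nakayama (((hφ i).some.symm.trans e).trans (hφ j).some)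
  have hinj : Function.Injective Φ := by
    rintro ⟨i⟩ ⟨j⟩ hij
    obtain ⟨e⟩ : Nonempty (N (φ i) ≃ₗ[A] N (φ j)) := Quotient.exact hij
    exact Quotient.sound ⟨((hφ i).some.trans (nakEquiv k e)).trans (hφ j).some.symm⟩
  have hν : ∀ i, Module.Projective A (nakayama k A (N i)) := fun i => by
    obtain ⟨⟨j⟩, hj⟩ := Finite.injective_iff_surjective.1 hinj (Quotient.mk S i)
    obtain ⟨e⟩ : Nonempty (N (φ j) ≃ₗ[A] N i) := Quotient.exact hj
    exact Module.Projective.of_equiv ((hφ j).some.trans (nakEquiv k e))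
  have hνA : Module.Projective A (nakayama k A (ModuleCat.of A A)) :=
    ((isSummandOf_nakayama (k := k) (P := ModuleCat.of A A) hdec).finite_projective
      fun i => ⟨finite_nakayama, hν i⟩).2
  obtain ⟨n, hn⟩ := (inAdd_of_finite_projective (A := A) (Y := P)).isSummandOf
  exact ((isSummandOf_nakayama (k := k) (X := fun _ => ModuleCat.of A A) hn).finite_projective
    fun _ => ⟨finite_nakayama, hνA⟩).2

/-- Representation-finite algebras are Frobenius-finite. -/
theorem IsRepresentationFinite.isFrobeniusFinite (h : IsRepresentationFinite A) :
    IsFrobeniusFinite k A := by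
  have : IsArtinianRing A := IsArtinianRing.of_finite k A
  refine isFrobeniusFinite_of_isListFinite fun P hP _ => ?_
  have := hP.finite
  have := hP.projective
  -- `P` lies in `add(A)`, and the opposite of `End(A)` is `A`.
  refine .end_of_inAdd k (Q := A) inAdd_of_finite_projective ?_
  exact .of_ringEquiv ((RingEquiv.op (RingEquiv.moduleEndSelf A)).symm.trans
    (RingEquiv.opOp A).symm) h.isListFinite

/-- Finitely generated modules over self-injective algebras are torsionless. -/
theorem isTorsionless_of_selfInjective (k : Type u) [Field k] [Algebra k A] [Module.Finite k A]
    (hA : Module.Injective A A) (X : ModuleCat.{u} A) [Module.Finite A X] : IsTorsionless A X := by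
  obtain ⟨n, f, hf⟩ := exists_injective_nakayama k X
  have := projective_nakayama_of_selfInjective (k := k) hA (ModuleCat.of A A)
  have : Module.Finite A (nakayama k A (ModuleCat.of A A)) := finite_nakayama
  exact ⟨ModuleCat.of A (Fin n → nakayama k A (ModuleCat.of A A)), f,
    inferInstanceAs (Module.Finite A (Fin n → nakayama k A (ModuleCat.of A A))),
    (inAdd_pi_self (A := A) (Z := nakayama k A (ModuleCat.of A A)) n).projective, hf⟩

end SelfInjective

end FrobFin

/-! ### The proposition. -/

open FrobFin

theorem mainTheorem9 (k : Type u) [Field k] :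
    -- (1) endomorphism algebras of generator-cogenerators; Auslander algebras
    (∀ (A : Type u) [Ring A] [Algebra k A] (M : Type u) [AddCommGroup M] [Module A M]
        [Module k M] [IsScalarTower k A M],
      IsFrobeniusFinite k A → Module.Finite A M →
      IsGeneratorModule A M → IsCogeneratorModule k A M →
        IsFrobeniusFinite k (Module.End A M)ᵐᵒᵖ) ∧
    (∀ (A : Type u) [Ring A] [Algebra k A],
      IsAuslanderAlgebra k A → IsFrobeniusFinite k A) ∧
    -- (2) Auslander–Yoneda algebras
    (∀ (A : Type u) [Ring A] [Algebra k A] (M : ModuleCat.{u} A) (Θ : Finset ℕ)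
        (hΘ : IsAdmissible (Θ : Set ℕ)),
      IsFrobeniusFinite k A → Module.Finite A M →
      IsTorsionless A M → IsGeneratorModule A M →
      (∀ i ∈ Θ, i ≠ 0 → Subsingleton (Abelian.Ext.{u} M (ModuleCat.of A A) i)) →
        IsFrobeniusFinite k (AuslanderYoneda Θ hΘ M)) ∧
    (∀ (A : Type u) [Ring A] [Algebra k A] (X : ModuleCat.{u} A) (Θ : Finset ℕ)
        (hΘ : IsAdmissible (Θ : Set ℕ)),
      Module.Finite k A → IsRepresentationFinite A → Module.Injective A A →
      Module.Finite A X →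
        IsFrobeniusFinite k (AuslanderYoneda Θ hΘ (ModuleCat.of A (A × X)))) ∧
    -- (3) triangular matrix algebras
    (∀ (A B M : Type u) [Ring A] [Algebra k A] [Ring B] [Algebra k B] [AddCommGroup M]
        [Module k M] [Module B M] [Module Aᵐᵒᵖ M] [SMulCommClass B Aᵐᵒᵖ M]
        [IsScalarTower k B M] [IsScalarTower k Aᵐᵒᵖ M],
      IsFrobeniusFinite k A → IsFrobeniusFinite k B → Module.Finite k M →
        IsFrobeniusFinite k (TriangularMatrix A B M)) ∧
    (∀ (m : ℕ) (A : Fin m → Type u) (M : Fin m → Fin m → Type u)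
        [∀ i, Ring (A i)] [∀ i, Algebra k (A i)]
        [∀ i j, AddCommGroup (M i j)] [∀ i j, Module k (M i j)]
        [∀ i j, Module (A i) (M i j)] [∀ i j, Module (A j)ᵐᵒᵖ (M i j)]
        [∀ i j, SMulCommClass (A i) (A j)ᵐᵒᵖ (M i j)]
        [∀ i j, IsScalarTower k (A i) (M i j)] [∀ i j, IsScalarTower k (A j)ᵐᵒᵖ (M i j)]
        (T : TriangularSystem k A M),
      (∀ i, IsFrobeniusFinite k (A i)) → (∀ i j, j < i → Module.Finite k (M i j)) →
        IsFrobeniusFinite k T.MatrixAlgebra) ∧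
    -- (4) Beilinson–Green algebras
    (∀ (R : Type u) [Ring R] [Algebra k R] (G : ℕ → Submodule k R) [GradedAlgebra G] (n : ℕ),
      Module.Finite k R → (∀ i, n < i → G i = ⊥) → IsFrobeniusFinite k (G 0) →
        ∀ m, 1 ≤ m → m ≤ n → IsFrobeniusFinite k (beilinsonGreen G m)) := by
  refine ⟨?_, ?_, ?_, ?_, ?_, ?_, ?_⟩
  · intro A _ _ M _ _ _ _ hA _ hM _
    exact hA.end_of_generator hM
  · intro A _ _ hA
    have := hA.finite
    exact isFrobeniusFinite_of_gldim_le_two hA.gldim_le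
  · intro A _ _ M Θ hΘ hA _ ht hg _
    have := hA.1
    exact AuslanderYoneda.isFrobeniusFinite hA ht hg
  · intro A _ _ X Θ hΘ _ hrep hinj _
    have : Module.Finite A (ModuleCat.of A (A × X)) := inferInstanceAs (Module.Finite A (A × X))
    exact AuslanderYoneda.isFrobeniusFinite hrep.isFrobeniusFinite
      (isTorsionless_of_selfInjective k hinj (ModuleCat.of A (A × X)))
      (InAdd.of_retract (LinearMap.inl A A X) (LinearMap.fst A A X) (LinearMap.fst_comp_inl A A X))
  · intro A B M _ _ _ _ _ _ _ _ _ _ _ hA hB hM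
    exact isFrobeniusFinite_triangularMatrix k A B M hA hB hM
  · intro m A M _ _ _ _ _ _ _ _ _ T hA hM
    exact isFrobeniusFinite_matrixAlgebra k T hA hM
  · intro R _ _ G _ n _ _ h m _ _
    exact isFrobeniusFinite_beilinsonGreen k G h m
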